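/- **Theorem (Hamiltonian structure for GP).** Let $d\ge 1$, $\kappa\in\{1,-1\}$. *Spaces.* An operator $A\in\mathcal L(\mathcal S(\mathbb R^{dk}),\mathcal S'(\mathbb R^{dk}))$ has Schwartz kernel $K_A\in\mathcal S'(\mathbb R^{dk}\times\mathbb R^{dk})$, $\langle Af,g\rangle=\langle K_A,g\otimes f\rangle$. It has the *good mapping property* if for every $\alpha\le k$ the distribution $$\int A(f)(x_1,\dots,x_k)\,g(x_1,\dots,x_{\alpha-1},x_\alpha',x_{\alpha+1},\dots,x_k)\,dx_1\cdots dx_{\alpha-1}dx_{\alpha+1}\cdots dx_k$$ is a Schwartz function of $(x_\alpha,x_\alpha')\in\mathbb R^{2d}$ depending bilinearly and continuously on $f,g\in\mathcal S(\mathbb R^{dk})$. Let $\mathfrak G_\infty$ be the space of sequences $A=(A^{(k)})_{k\ge1}$ with finitely many nonzero terms, where $A^{(k)}:\mathcal S_s(\mathbb R^{dk})\to\mathcal S_s'(\mathbb R^{dk})$ is continuous, has the good mapping property (bosonic operators being identified with $A^{(k)}\circ\mathrm{Sym}_k$) and satisfies $(A^{(k)})^*=-A^{(k)}$. Let $\mathfrak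 G_\infty^*$ be the real topological vector space (product topology) of sequences $\Gamma=(\gamma^{(k)})_{k\ge1}$ of self-adjoint integral operators with Schwartz kernels $\gamma^{(k)}(\underline x_k;\underline x_k')$ that are symmetric in $\underline x_k$ and, separately, in $\underline x_k'$. Put $\mathrm{Tr}(A^{(k)}\gamma^{(k)})=\langle K_{A^{(k)}},(\gamma^{(k)})^t\rangle$, where $\gamma^t(\underline x;\underline x')=\gamma(\underline x';\underline x)$, and $\mathrm{Tr}(A\cdot\Gamma)=\sum_k\mathrm{Tr}(A^{(k)}\gamma^{(k)})$. *Bracket.* On $\mathfrak G_\infty$ let $$[A,B]^{(k)}=\mathrm{Sym}_k\sum_{\ell+j-1=k}\ \sum_{\alpha\le\ell,\ \beta\le j}\bigl(A^{(\ell)}\circ_\alpha^\beta B^{(j)}-B^{(j)}\circ_\beta^\alpha A^{(\ell)}\bigr),$$ where $\mathrm{Sym}_k$ is the average over all simultaneous relabellings of the $k$ particles (the result being regarded as an operator $\mathcal S_s\to\mathcal S_s'$) and $A^{(\ell)}\circ_\alpha^\beta B^{(j)}=A^{(\ell)}_{(1,\dots,\ell)}B^{(j)}_{\beta\to\alpha}$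 is defined by $$\langle(A^{(\ell)}\circ_\alpha^\beta B^{(j)})f,g\rangle=\langle K_{A^{(\ell)}},\Phi(f,g)^t\rangle,\qquad \Phi(f,g)(\underline x_\ell;\underline x_\ell')=\int (B^{(j)}_{\beta\to\alpha}f)(\underline x_\ell,z)\,g(\underline x'_\ell,z)\,dz,\quad z\in\mathbb R^{d(j-1)};$$ here $B^{(j)}_{\beta\to\alpha}$ acts through its $\beta$-th variable on $x_\alpha$ and through its other $j-1$ variables on the last $j-1$ variables $z$. *Poisson structure.* Let $\mathcal A_\infty$ be the algebra of real functionals on $\mathfrak G_\infty^*$ generated by the constants and the functionals $\Gamma\mapsto i\,\mathrm{Tr}(A\cdot\Gamma)$, $A\in\mathfrak G_\infty$. For $F\in\mathcal A_\infty$ the Gâteaux derivative $dF[\Gamma]$ is identified with an element of $\mathfrak G_\infty$ through $dF[\Gamma](v)=i\,\mathrm{Tr}(dF[\Gamma]\cdot v)$, and $$\{F,G\}(\Gamma)=i\,\mathrm{Tr}\bigl([dF[\Gamma],dG[\Gamma]]\cdot\Gamma\bigr),\qquad F,G\in\mathcal A_\infty .$$ A *Hamiltonian vector field* of $H\in\mathcal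 A_\infty$ is a smooth (in the Gâteaux sense: all iterated directional derivatives exist and are jointly continuous) map $X:\mathfrak G_\infty^*\to\mathfrak G_\infty^*$ with $dF[\Gamma](X(\Gamma))=\{F,H\}(\Gamma)$ for all $F\in\mathcal A_\infty$ and $\Gamma\in\mathfrak G_\infty^*$. *Gross–Pitaevskii.* Let $$H_{GP}(\Gamma)=\mathrm{Tr}(\mathbf W_{GP}\cdot\Gamma)=\mathrm{Tr}(-\Delta_{x_1}\gamma^{(1)})+\kappa\,\mathrm{Tr}(\delta(X_1-X_2)\gamma^{(2)}),\qquad \mathbf W_{GP}=(-\Delta_{x_1},\kappa\,\delta(X_1-X_2),0,\dots).$$ The cubic Gross–Pitaevskii hierarchy is $$i\partial_t\gamma^{(k)}=-\Bigl[\sum_{j=1}^k\Delta_{x_j},\gamma^{(k)}\Bigr]+2\kappa\sum_{j=1}^k\bigl(B^+_{j;k+1}-B^-_{j;k+1}\bigr)\gamma^{(k+1)},\qquad k\ge1,$$ where $(B^+_{j;k+1}\gamma^{(k+1)})(\underline x_k;\underline x_k')=\gamma^{(k+1)}(\underline x_k,x_j;\underline x_k',x_j)$ and $(B^-_{j;k+1}\gamma^{(k+1)})(\underline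 x_k;\underline x_k')=\gamma^{(k+1)}(\underline x_k,x_j';\underline x_k',x_j')$. *Claim.* $H_{GP}$ is real-valued and belongs to $\mathcal A_\infty$; it has exactly one Hamiltonian vector field $X_{H_{GP}}$; and for every compact interval $I=[a,b]$ with $a<b$ and every $\Gamma\in C^\infty(I;\mathfrak G_\infty^*)$ (one-sided derivatives at the end points), $\Gamma$ solves the cubic Gross–Pitaevskii hierarchy on $I$ if and only if $$\Bigl(\frac{d}{dt}\Gamma\Bigr)(t)=X_{H_{GP}}(\Gamma(t))\qquad\text{for all }t\in I .$$ -/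

import Mathlib

open SchwartzMap MeasureTheory Filter Topology

noncomputable section

namespace GPHierarchy

/-! ### Configuration spaces, density kernels and distribution-valued operators

Throughout, the index `n : ℕ` labels the component with `n + 1` particles, so that the
hierarchies `(γ^(k))` with `k ≥ 1` are indexed by `n = k - 1`. -/

/-- The one-particle space `ℝ^d`. -/
abbrev E (d : ℕ) : Type := EuclideanSpace ℝ (Fin d)

/-- The `m`-particle configuration space `(ℝ^d)^m`. -/
abbrev X (d m : ℕ) : Type := Fin m → E d

/-- Schwartz functions `γ(x; x')` on `(ℝ^d)^(n+1) × (ℝ^d)^(n+1)`; these are the kernels of the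
elements of `L(𝓢', 𝓢)`. -/
abbrev Density (d n : ℕ) : Type := 𝓢(X d (n + 1) × X d (n + 1), ℂ)

/-- Tempered distributions on `(ℝ^d)^(n+1) × (ℝ^d)^(n+1)`; these are the Schwartz kernels of the
elements of `L(𝓢, 𝓢')`. The kernel `K` and its operator `A` determine each other through
`⟨A f, g⟩ = K (g ⊗ f)`, where `(g ⊗ f)(x, x') = g(x) f(x')`. -/
abbrev Ker (d n : ℕ) : Type := Density d n →L[ℂ] ℂ

/-- Transposition of a kernel, `γ^t(x; x') = γ(x'; x)`. -/
def transpose {d n : ℕ} : Density d n →L[ℂ] Density d n :=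
  compCLMOfContinuousLinearEquiv ℂ
    (ContinuousLinearEquiv.prodComm ℝ (X d (n + 1)) (X d (n + 1)))

/-- Relabelling of the particles in a configuration, `x ↦ (x_{π 1}, …, x_{π k})`. -/
def relabel {d m : ℕ} (π : Equiv.Perm (Fin m)) : X d m ≃L[ℝ] X d m :=
  (LinearEquiv.funCongrLeft ℝ (E d) π).toContinuousLinearEquiv

/-- The action `Θ(x; x') ↦ Θ(x ∘ π; x' ∘ σ)` of a pair of permutations on kernels. -/
def permAct {d n : ℕ} (π σ : Equiv.Perm (Fin (n + 1))) : Density d n →L[ℂ] Density d n :=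
  compCLMOfContinuousLinearEquiv ℂ ((relabel (d := d) π).prodCongr (relabel (d := d) σ))

/-- The generalized trace `Tr (A γ) = ⟨K_A, γ^t⟩`. -/
def trace {d n : ℕ} (K : Ker d n) (γ : Density d n) : ℂ := K (transpose γ)

/-! ### Observable hierarchies -/

/-- `K` is the kernel of an operator from bosonic Schwartz functions to bosonic tempered
distributions (such an operator `A` being identified with its extension `A ∘ Sym`): the kernel is
invariant under permutations of each of its two groups of variables. -/
def IsBosonicKer {d n : ℕ} (K : Ker d n) : Prop :=
  ∀ (π σ : Equiv.Perm (Fin (n + 1))) (Θ : Density d n), K (permAct π σ Θ) = K Θ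

/-- Skew-adjointness `A* = -A`, where `⟨A* g, conj f⟩ = conj ⟨A f, conj g⟩`; in terms of kernels,
`K(x; x') = - conj K(x'; x)`. -/
def IsSkewAdjoint {d n : ℕ} (K : Ker d n) : Prop :=
  ∀ Θ Θ' : Density d n, (∀ x x', Θ' (x, x') = starRingEnd ℂ (Θ (x', x))) →
    K Θ' = - starRingEnd ℂ (K Θ)

/-- The good mapping property. For every particle label `α`, the distribution in `u ∈ ℝ^d`
depending on the parameter `y ∈ ℝ^d`
`∫ (A f)(x_1, …, u, …, x_k) g(x_1, …, y, …, x_k) dx_1 … dx_{α-1} dx_{α+1} … dx_k`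
is given by a Schwartz function `Φ f g` of `(u, y) ∈ ℝ^d × ℝ^d` which depends bilinearly and
continuously on `(f, g)`. The pairing of this distribution with a test function `φ` is the value
of the kernel on the function `(v, w) ↦ φ(v_α) g(v_1, …, y, …, v_k) f(w)`, which is always a
Schwartz function; it is called `Θ` below. -/
def GoodMapping {d n : ℕ} (K : Ker d n) : Prop :=
  ∀ α : Fin (n + 1),
    ∃ Φ : 𝓢(X d (n + 1), ℂ) →ₗ[ℂ] 𝓢(X d (n + 1), ℂ) →ₗ[ℂ] 𝓢(E d × E d, ℂ),
      Continuous (fun p : 𝓢(X d (n + 1), ℂ) × 𝓢(X d (n + 1), ℂ) => Φ p.1 p.2) ∧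
      ∀ (f g : 𝓢(X d (n + 1), ℂ)) (φ : 𝓢(E d, ℂ)) (y : E d) (Θ : Density d n),
        (∀ v w, Θ (v, w) = φ (v α) * g (Function.update v α y) * f w) →
        K Θ = ∫ u, Φ f g (u, y) * φ u

/-- The elements of `𝔊_∞`: finite sequences of skew-adjoint bosonic operators in `L(𝓢_s, 𝓢_s')`
with the good mapping property. -/
def IsObservable {d : ℕ} (A : ∀ n, Ker d n) : Prop :=
  {n | A n ≠ 0}.Finite ∧ ∀ n, IsBosonicKer (A n) ∧ IsSkewAdjoint (A n) ∧ GoodMapping (A n)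

/-- The trace `Tr (A · Γ) = ∑_k Tr (A^(k) γ^(k))` of a finite sequence `A` against a
hierarchy `Γ`. -/
def hierTrace {d : ℕ} (A : ∀ n, Ker d n) (Γ : ∀ n, Density d n) : ℂ :=
  ∑ᶠ n, trace (A n) (Γ n)

/-! ### The Lie bracket of observable hierarchies -/

/-- The configuration `(x, z)` of `n + 1` particles, where `x` has `a + 1` particles, `z` has `b`
particles and `n = a + b`. -/
def join {d a b n : ℕ} (h : a + b = n) (x : X d (a + 1)) (z : X d b) : X d (n + 1) :=
  fun i => Fin.append x z (Fin.cast (by omega) i)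

/-- `Φ` is the function `Φ_{B,α,β}(f, g)` of `(x; x') ∈ (ℝ^d)^(a+1) × (ℝ^d)^(a+1)`,
`Φ(x; x') = ∫ (B_{(α, a+2, …, a+b+1)} f)(x, z) g(x', z) dz`,
in which the distribution-valued operator `B` acts on the `α`-th variable (through its own
`β`-th variable) and on the last `b` variables. As the good mapping property of `B` shows, this
distribution in `x_α` is a function; the equality is tested against `φ(x_α)`. -/
def IsSymbol {d a b n : ℕ} (h : a + b = n) (B : Ker d b) (α : Fin (a + 1)) (β : Fin (b + 1))
    (f g : 𝓢(X d (n + 1), ℂ)) (Φ : Density d a) : Prop :=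
  ∀ (φ : 𝓢(E d, ℂ)) (x x' : X d (a + 1)) (Θ : Density d b),
    (∀ v w, Θ (v, w) = φ (v β) * g (join h x' (β.removeNth v)) *
      f (join h (Function.update x α (w β)) (β.removeNth w))) →
    B Θ = ∫ u, Φ (Function.update x α u, x') * φ u

/-- `C` is the kernel of the contraction `A ∘_α^β B`:
`⟨(A ∘_α^β B) f, g⟩ = ⟨K_A, Φ_{B,α,β}(f, g)^t⟩` for all Schwartz functions `f` and `g`. (When `B`
has the good mapping property, there is exactly one `Φ` for given `f` and `g`.) -/
def IsContraction {d a b n : ℕ} (h : a + b = n) (A : Ker d a) (B : Ker d b)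
    (α : Fin (a + 1)) (β : Fin (b + 1)) (C : Ker d n) : Prop :=
  ∀ (f g : 𝓢(X d (n + 1), ℂ)) (Φ : Density d a), IsSymbol h B α β f g Φ →
    ∀ Θ : Density d n, (∀ x x', Θ (x, x') = g x * f x') → C Θ = A (transpose Φ)

open Classical in
/-- The contraction `A ∘_α^β B` (it exists, uniquely, when `B` has the good mapping property). -/
def contraction {d a b n : ℕ} (h : a + b = n) (A : Ker d a) (B : Ker d b)
    (α : Fin (a + 1)) (β : Fin (b + 1)) : Ker d n :=
  if hC : ∃ C, IsContraction h A B α β C then hC.choose else 0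

/-- `[A, B]_1 = ∑_{α, β} (A ∘_α^β B - B ∘_β^α A)`. -/
def oneBracket {d a b n : ℕ} (h : a + b = n) (A : Ker d a) (B : Ker d b) : Ker d n :=
  ∑ α : Fin (a + 1), ∑ β : Fin (b + 1),
    (contraction h A B α β - contraction ((Nat.add_comm b a).trans h) B A β α)

/-- The symmetrization `Sym_k (C) = (1/k!) ∑_π C_(π(1), …, π(k))`, as an operator from bosonic
Schwartz functions to bosonic tempered distributions: it is the operator `Sym_k ∘ C ∘ Sym_k`,
whose kernel is averaged over the permutations of both groups of variables. -/
def symmetrize {d n : ℕ} (C : Ker d n) : Ker d n :=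
  (((n + 1).factorial : ℂ)⁻¹ ^ 2) •
    ∑ π : Equiv.Perm (Fin (n + 1)), ∑ σ : Equiv.Perm (Fin (n + 1)), C.comp (permAct π σ)

/-- The bracket of `𝔊_∞`: `[A, B]^(k) = Sym_k (∑_{ℓ + j - 1 = k} [A^(ℓ), B^(j)]_1)`. -/
def lieBracket {d : ℕ} (A B : ∀ n, Ker d n) : ∀ n, Ker d n := fun n =>
  symmetrize (∑ i : Fin (n + 1), oneBracket (Nat.add_sub_of_le i.is_le) (A i) (B (n - i)))

/-! ### Density matrix hierarchies -/

/-- The real topological vector space `𝔊_∞^*` of density matrix hierarchies: sequences of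
self-adjoint operators with Schwartz kernels that are invariant under permutations of `x` and,
separately, of `x'`. It carries the product topology. -/
def DensityHierarchy (d : ℕ) : Submodule ℝ (∀ n, Density d n) where
  carrier := {Γ | ∀ n, (∀ π σ, permAct π σ (Γ n) = Γ n) ∧
    ∀ x x', Γ n (x, x') = starRingEnd ℂ (Γ n (x', x))}
  add_mem' := by
    intro Γ Γ' h h' n
    refine ⟨fun π σ => ?_, fun x x' => ?_⟩
    · simp [(h n).1 π σ, (h' n).1 π σ]
    · simp only [Pi.add_apply, add_apply, map_add]
      rw [(h n).2 x x', (h' n).2 x x']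
  zero_mem' := by
    intro n
    exact ⟨fun π σ => by simp, fun x x' => by simp⟩
  smul_mem' := by
    intro c Γ h n
    refine ⟨fun π σ => ?_, fun x x' => ?_⟩
    · rw [Pi.smul_apply, ← Complex.coe_smul, map_smul, (h n).1 π σ]
    · simp only [Pi.smul_apply, smul_apply, Complex.real_smul, map_mul,
        Complex.conj_ofReal]
      rw [(h n).2 x x']

/-! ### The weak Lie–Poisson structure -/

/-- The algebra `𝒜_∞` of real functionals on `𝔊_∞^*` generated, under pointwise operations, by the
constants and the trace functionals `Γ ↦ i Tr (A · Γ)`, `A ∈ 𝔊_∞`. (A subalgebra contains the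
constants, and trace functionals are continuous and linear, hence smooth.) -/
def admissible (d : ℕ) : Subalgebra ℝ (DensityHierarchy d → ℝ) :=
  Algebra.adjoin ℝ {F | ∃ A : ∀ n, Ker d n, IsObservable A ∧
    ∀ Γ : DensityHierarchy d, (F Γ : ℂ) = Complex.I * hierTrace A Γ.1}

open Classical in
/-- The Gâteaux derivative `dF[Γ]`, identified with an observable hierarchy through the trace
pairing: `dF[Γ](v) = i Tr (dF[Γ] · v)` for all `v ∈ 𝔊_∞^*`. For `F ∈ 𝒜_∞` there is exactly one
such hierarchy. -/
def gradient {d : ℕ} (F : DensityHierarchy d → ℝ) (Γ : DensityHierarchy d) : ∀ n, Ker d n :=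
  if h : ∃ A : ∀ n, Ker d n, IsObservable A ∧
      ∀ v : DensityHierarchy d, ((lineDeriv ℝ F Γ v : ℝ) : ℂ) = Complex.I * hierTrace A v.1
    then h.choose else 0

/-- The Lie–Poisson bracket `{F, G}(Γ) = i Tr ([dF[Γ], dG[Γ]] · Γ)` for `F, G ∈ 𝒜_∞`. -/
def poissonBracket {d : ℕ} (F G : DensityHierarchy d → ℝ) (Γ : DensityHierarchy d) : ℂ :=
  Complex.I * hierTrace (lieBracket (gradient F Γ) (gradient G Γ)) Γ.1

/-- Smoothness in the sense of Gâteaux of a map between real topological vector spaces: the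
iterated directional derivatives `D r x (v_1, …, v_r)` of all orders exist and are jointly
continuous. -/
def GateauxSmooth {V W : Type*} [AddCommGroup V] [Module ℝ V] [TopologicalSpace V]
    [AddCommGroup W] [Module ℝ W] [TopologicalSpace W] (f : V → W) : Prop :=
  ∃ D : ∀ r : ℕ, V → (Fin r → V) → W, (∀ x v, D 0 x v = f x) ∧
    (∀ r, Continuous fun p : V × (Fin r → V) => D r p.1 p.2) ∧
    ∀ (r : ℕ) (x : V) (v : Fin r → V) (w : V),
      Tendsto (fun t : ℝ => t⁻¹ • (D r (x + t • w) v - D r x v)) (𝓝[≠] 0)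
        (𝓝 (D (r + 1) x (Fin.snoc v w)))

/-- `Y` is a Hamiltonian vector field of `H` with respect to the weak Lie–Poisson structure: a
smooth vector field on `𝔊_∞^*` with `dF[Γ](Y(Γ)) = {F, H}(Γ)` for all `F ∈ 𝒜_∞`. -/
def IsHamiltonianVectorField {d : ℕ} (H : DensityHierarchy d → ℝ)
    (Y : DensityHierarchy d → DensityHierarchy d) : Prop :=
  GateauxSmooth Y ∧ ∀ F ∈ admissible d, ∀ Γ,
    ((lineDeriv ℝ F Γ (Y Γ) : ℝ) : ℂ) = poissonBracket F H Γ

/-! ### The Gross–Pitaevskii Hamiltonian -/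

/-- The diagonal embedding `x ↦ ((x, …, x), (x, …, x))`. -/
def diag (d n : ℕ) : E d →L[ℝ] X d (n + 1) × X d (n + 1) :=
  (ContinuousLinearMap.pi fun _ => ContinuousLinearMap.id ℝ (E d)).prod
    (ContinuousLinearMap.pi fun _ => ContinuousLinearMap.id ℝ (E d))

theorem antilipschitz_diag (d n : ℕ) : AntilipschitzWith 1 (diag d n) := by
  refine AddMonoidHomClass.antilipschitz_of_bound (diag d n) fun x => ?_
  have h1 : ‖(diag d n x).1‖ ≤ ‖diag d n x‖ := norm_fst_le _
  have h2 : ‖(diag d n x).1 0‖ ≤ ‖(diag d n x).1‖ := norm_le_pi_norm _ _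
  rw [NNReal.coe_one, one_mul]
  exact h2.trans h1

/-- `Θ ↦ ∫ Θ(x, …, x; x, …, x) dx`. -/
def diagIntegral (d n : ℕ) : Ker d n :=
  (integralCLM ℂ (volume : Measure (E d))).comp
    (compCLMOfAntilipschitz ℂ (diag d n).hasTemperateGrowth (antilipschitz_diag d n))

/-- The `i`-th coordinate direction of the variable `x'` of a one-particle kernel `Θ(x; x')`. -/
def inputDir (d : ℕ) (i : Fin d) : X d (0 + 1) × X d (0 + 1) :=
  (0, fun _ => EuclideanSpace.single i 1)

/-- The kernel of the one-particle operator `-Δ`, i.e. `-Δ_{x'} δ(x - x')`, so that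
`⟨-Δ f, g⟩ = - ∫ g(x) (Δ f)(x) dx`. -/
def negLaplacian (d : ℕ) : Ker d 0 :=
  - ∑ i : Fin d, (diagIntegral d 0).comp
      (LineDeriv.lineDerivOpCLM ℂ (Density d 0) (inputDir d i) ∘L
        LineDeriv.lineDerivOpCLM ℂ (Density d 0) (inputDir d i))

/-- The kernel of the two-particle multiplication operator `δ(X_1 - X_2)`:
`⟨δ(X_1 - X_2) f, g⟩ = ∫ g(x, x) f(x, x) dx`. -/
def delta (d : ℕ) : Ker d 1 := diagIntegral d 1

/-- `W_GP = (-Δ_{x_1}, κ δ(X_1 - X_2), 0, …)`. -/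
def gpGenerator (d : ℕ) (κ : ℝ) : ∀ n, Ker d n
  | 0 => negLaplacian d
  | 1 => (κ : ℂ) • delta d
  | _ + 2 => 0

/-- The Gross–Pitaevskii Hamiltonian
`H_GP(Γ) = Tr(-Δ γ^(1)) + κ Tr(δ(X_1 - X_2) γ^(2))` (these traces are real on `𝔊_∞^*`). -/
def gpHamiltonian (d : ℕ) (κ : ℝ) (Γ : DensityHierarchy d) : ℝ :=
  (trace (negLaplacian d) (Γ.1 0) + κ * trace (delta d) (Γ.1 1)).re

/-! ### Smooth curves and the Gross–Pitaevskii hierarchy -/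

/-- The curve `Γ` in a topological vector space has derivative `Γ'` at `t` within `I`. -/
def HasCurveDeriv {V : Type*} [AddCommGroup V] [Module ℝ V] [TopologicalSpace V]
    (Γ : ℝ → V) (Γ' : V) (I : Set ℝ) (t : ℝ) : Prop :=
  Tendsto (slope Γ t) (𝓝[I \ {t}] t) (𝓝 Γ')

/-- `Γ ∈ C^∞(I; V)`, with one-sided derivatives at the end points of the interval `I`. -/
def SmoothCurveOn {V : Type*} [AddCommGroup V] [Module ℝ V] [TopologicalSpace V]
    (Γ : ℝ → V) (I : Set ℝ) : Prop :=
  ∃ D : ℕ → ℝ → V, (∀ t ∈ I, D 0 t = Γ t) ∧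
    ∀ r, ∀ t ∈ I, HasCurveDeriv (D r) (D (r + 1) t) I t

open Laplacian in
/-- The kernel of `[Δ_{x_1} + ⋯ + Δ_{x_k}, γ^(k)]`, that is
`∑_j (Δ_{x_j} - Δ_{x_j'}) γ^(k)(x; x')`. -/
def laplaceCommutator {d n : ℕ} (γ : Density d n) (x x' : X d (n + 1)) : ℂ :=
  ∑ j : Fin (n + 1),
    ((Δ fun y : E d => γ (Function.update x j y, x')) (x j) -
      (Δ fun y : E d => γ (x, Function.update x' j y)) (x' j))

/-- The kernel of `B_{k+1} γ^(k+1) = ∑_j (B_{j;k+1}^+ - B_{j;k+1}^-) γ^(k+1)`, where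
`(B_{j;k+1}^+ γ)(x; x') = γ(x, x_j; x', x_j)` and `(B_{j;k+1}^- γ)(x; x') = γ(x, x_j'; x', x_j')`. -/
def collision {d n : ℕ} (γ : Density d (n + 1)) (x x' : X d (n + 1)) : ℂ :=
  ∑ j : Fin (n + 1),
    (γ ((Fin.snoc x (x j) : X d (n + 2)), (Fin.snoc x' (x j) : X d (n + 2))) -
      γ ((Fin.snoc x (x' j) : X d (n + 2)), (Fin.snoc x' (x' j) : X d (n + 2))))

/-- `Γ` solves the Gross–Pitaevskii hierarchy
`i ∂_t γ^(k) = -[Δ_{x_1} + ⋯ + Δ_{x_k}, γ^(k)] + 2 κ B_{k+1} γ^(k+1)`, `k ≥ 1`, on `I`. -/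
def SolvesGP {d : ℕ} (κ : ℝ) (I : Set ℝ) (Γ : ℝ → DensityHierarchy d) : Prop :=
  ∀ t ∈ I, ∀ (n : ℕ) (x x' : X d (n + 1)),
    HasDerivWithinAt (fun s => Complex.I * (Γ s).1 n (x, x'))
      (- laplaceCommutator ((Γ t).1 n) x x' + 2 * κ * collision ((Γ t).1 (n + 1)) x x') I t

end GPHierarchy

end

/-! The vector field is found by dividing the hierarchy by i: X(Γ)^(k) = i[ΣΔ, γ^(k)] − 2iκ B
γ^(k+1), which is `gpField`. It is a continuous linear map of the space of density hierarchies into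
itself, hence Gâteaux smooth. The Hamiltonian is the trace functional of A_GP = −i W_GP, so its
gradient is this constant observable. Everything rests on one identity, Tr([A, A_GP]·Γ) = Tr(A·X(Γ))
for all observables A (`hierTrace_lieBracket_gpObservable`), applied to A = dF[Γ].

Only the one- and two-particle components of A_GP enter the bracket, so four contractions have to be
computed. In A ∘ W the operator W acts first and its symbol is explicit. In W ∘ A the operator W is
a differential operator D restricted to the diagonal, and A is known only through its good mapping
property, which represents it by a continuous bilinear map T. For product functions the contraction
is the integral of p(u) D(T(f₂, g₂))(u). As D is symmetric it can be moved to p, and Dp is then a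
test function inside A (`isContraction_diagonal`). The separate symmetry of γ in x and in x' finally
turns the permuted arguments into the commutator with the Laplacian and into the collision operator.
The factor 2 counts the two particles of δ(X₁ − X₂).

Passing from products to general functions, and the uniqueness of contractions (which are defined by
choice), both need the totality of tensor products in Schwartz space (`eq_zero_of_tensor`). A
cut-off function χ₁⊗χ₂·θ is, by Fourier inversion, an integral of products, and a distribution that
vanishes on every integrand vanishes on the integral (`apply_partialIntegral_eq_zero`).

Gradients are unique because an observable that has zero trace against all density hierarchies is
zero (`IsObservable.eq_zero`). The vector field is unique because, conversely, observables separate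
density hierarchies: a self-adjoint Schwartz kernel η gives the observable iη, and its trace against
η is i times the squared L² norm of η. For the last claim, evaluation at a point (x; x') is
continuous, so the derivative of a smooth curve in the space of hierarchies is determined by the
pointwise derivatives in the Gross–Pitaevskii equations. -/

noncomputable section

namespace GPHierarchy

section

open scoped ContDiff BoundedContinuousFunction

/-! ### Seminorms on Schwartz spaces -/

section Seminorms

variable {V W U : Type*} [NormedAddCommGroup V] [NormedSpace ℝ V]
  [NormedAddCommGroup W] [NormedSpace ℝ W] [NormedAddCommGroup U] [NormedSpace ℝ U]

/-- The largest of the Schwartz seminorms with both indices at most `m`. -/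
def supSeminorm (V : Type*) [NormedAddCommGroup V] [NormedSpace ℝ V] (m : ℕ) :
    Seminorm ℂ 𝓢(V, ℂ) :=
  (Finset.Iic (m, m)).sup (schwartzSeminormFamily ℂ V ℂ)

theorem seminorm_le_supSeminorm {k n m : ℕ} (hk : k ≤ m) (hn : n ≤ m) (f : 𝓢(V, ℂ)) :
    SchwartzMap.seminorm ℂ k n f ≤ supSeminorm V m f := by
  have : schwartzSeminormFamily ℂ V ℂ (k, n) ≤ supSeminorm V m :=
    Finset.le_sup (f := schwartzSeminormFamily ℂ V ℂ)
      (Finset.mem_Iic.2 (Prod.mk_le_mk.2 ⟨hk, hn⟩))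
  exact this f

theorem supSeminorm_le {m : ℕ} {f : 𝓢(V, ℂ)} {C : ℝ} (hC : 0 ≤ C)
    (h : ∀ k n, k ≤ m → n ≤ m → SchwartzMap.seminorm ℂ k n f ≤ C) : supSeminorm V m f ≤ C := by
  refine Seminorm.finset_sup_apply_le hC fun i hi => ?_
  have := Prod.mk_le_mk.1 (Finset.mem_Iic.1 hi)
  exact h i.1 i.2 this.1 this.2

theorem supSeminorm_mono {m m' : ℕ} (h : m ≤ m') (f : 𝓢(V, ℂ)) :
    supSeminorm V m f ≤ supSeminorm V m' f :=
  supSeminorm_le (apply_nonneg _ _) fun _ _ hk hn =>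
    seminorm_le_supSeminorm (hk.trans h) (hn.trans h) f

theorem finset_sup_le_supSeminorm (s : Finset (ℕ × ℕ)) :
    ∃ m, ∀ f : 𝓢(V, ℂ), s.sup (schwartzSeminormFamily ℂ V ℂ) f ≤ supSeminorm V m f := by
  refine ⟨s.sup fun i => max i.1 i.2, fun f => ?_⟩
  refine Seminorm.finset_sup_apply_le (apply_nonneg _ _) fun i hi => ?_
  have h := Finset.le_sup (f := fun i : ℕ × ℕ => max i.1 i.2) hi
  exact seminorm_le_supSeminorm ((le_max_left _ _).trans h) ((le_max_right _ _).trans h) f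

theorem continuous_supSeminorm (m : ℕ) : Continuous (supSeminorm V m) := by
  refine Seminorm.continuous' (r := 1) ?_
  refine ((schwartz_withSeminorms ℂ V ℂ).mem_nhds_iff _ _).2 ?_
  exact ⟨Finset.Iic (m, m), 1, one_pos, Seminorm.ball_subset_closedBall _ _ _⟩

theorem mem_nhds_zero_iff_supSeminorm {s : Set 𝓢(V, ℂ)} :
    s ∈ 𝓝 (0 : 𝓢(V, ℂ)) ↔ ∃ m, ∃ r > 0, ∀ f, supSeminorm V m f < r → f ∈ s := by
  rw [(schwartz_withSeminorms ℂ V ℂ).mem_nhds_iff]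
  constructor
  · rintro ⟨t, r, hr, h⟩
    obtain ⟨m, hm⟩ := finset_sup_le_supSeminorm (V := V) t
    refine ⟨m, r, hr, fun f hf => h ?_⟩
    rw [Seminorm.mem_ball_zero]
    exact (hm f).trans_lt hf
  · rintro ⟨m, r, hr, h⟩
    refine ⟨Finset.Iic (m, m), r, hr, fun f hf => h f ?_⟩
    rwa [Seminorm.mem_ball_zero] at hf

/-- A continuous seminorm is dominated by one of the standard ones. -/
theorem exists_le_supSeminorm (q : Seminorm ℂ 𝓢(V, ℂ)) (hq : Continuous q) :
    ∃ m, ∃ C, 0 ≤ C ∧ ∀ f, q f ≤ C * supSeminorm V m f := by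
  obtain ⟨s, C, -, h⟩ := Seminorm.bound_of_continuous (schwartz_withSeminorms ℂ V ℂ) q hq
  obtain ⟨m, hm⟩ := finset_sup_le_supSeminorm (V := V) s
  refine ⟨m, C, C.2, fun f => (h f).trans ?_⟩
  exact mul_le_mul_of_nonneg_left (hm f) C.2

theorem exists_norm_le_supSeminorm (T : 𝓢(V, ℂ) →L[ℂ] ℂ) :
    ∃ m, ∃ C, 0 ≤ C ∧ ∀ f, ‖T f‖ ≤ C * supSeminorm V m f :=
  exists_le_supSeminorm ((normSeminorm ℂ ℂ).comp T.toLinearMap) (continuous_norm.comp T.continuous)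

/-- A jointly continuous bilinear map is bounded with respect to the standard seminorms. -/
theorem exists_bilin_supSeminorm_le (B : 𝓢(V, ℂ) →ₗ[ℂ] 𝓢(W, ℂ) →ₗ[ℂ] 𝓢(U, ℂ))
    (hB : Continuous fun p : 𝓢(V, ℂ) × 𝓢(W, ℂ) => B p.1 p.2) (m : ℕ) :
    ∃ m', ∃ C, 0 ≤ C ∧
      ∀ f g, supSeminorm U m (B f g) ≤ C * supSeminorm V m' f * supSeminorm W m' g := by
  have h0 : {p : 𝓢(V, ℂ) × 𝓢(W, ℂ) | supSeminorm U m (B p.1 p.2) < 1} ∈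
      𝓝 ((0 : 𝓢(V, ℂ)), (0 : 𝓢(W, ℂ))) := by
    refine (isOpen_lt ((continuous_supSeminorm m).comp hB) continuous_const).mem_nhds ?_
    simp
  rw [nhds_prod_eq, Filter.mem_prod_iff] at h0
  obtain ⟨s, hs, t, ht, hst⟩ := h0
  obtain ⟨m₁, r₁, hr₁, h₁⟩ := mem_nhds_zero_iff_supSeminorm.1 hs
  obtain ⟨m₂, r₂, hr₂, h₂⟩ := mem_nhds_zero_iff_supSeminorm.1 ht
  refine ⟨max m₁ m₂, (r₁ * r₂)⁻¹, by positivity, fun f g => ?_⟩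
  -- Homogeneity: (r₁/a) f and (r₂/b) g lie in the neighbourhoods on which B has seminorm below 1.
  -- The strict upper bounds a, b replace the seminorms themselves, which may vanish; they are
  -- removed by letting ε tend to 0.
  have key : ∀ a b : ℝ, supSeminorm V m₁ f < a → supSeminorm W m₂ g < b →
      supSeminorm U m (B f g) ≤ (r₁ * r₂)⁻¹ * a * b := by
    intro a b ha hb
    have ha0 : 0 < a := (apply_nonneg _ _).trans_lt ha
    have hb0 : 0 < b := (apply_nonneg _ _).trans_lt hb
    have hf : ((r₁ / a : ℝ) : ℂ) • f ∈ s := by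
      refine h₁ _ ?_
      rw [map_smul_eq_mul, Complex.norm_real, Real.norm_of_nonneg (by positivity), div_mul_eq_mul_div,
        div_lt_iff₀ ha0]
      exact mul_lt_mul_of_pos_left ha hr₁
    have hg : ((r₂ / b : ℝ) : ℂ) • g ∈ t := by
      refine h₂ _ ?_
      rw [map_smul_eq_mul, Complex.norm_real, Real.norm_of_nonneg (by positivity), div_mul_eq_mul_div,
        div_lt_iff₀ hb0]
      exact mul_lt_mul_of_pos_left hb hr₂
    have := hst (Set.mk_mem_prod hf hg)
    simp only [Set.mem_ofPred_eq, map_smul, LinearMap.smul_apply, map_smul_eq_mul, Complex.norm_real,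
      Real.norm_of_nonneg (show 0 ≤ r₁ / a by positivity),
      Real.norm_of_nonneg (show 0 ≤ r₂ / b by positivity)] at this
    have e : (r₁ * r₂)⁻¹ * a * b = (r₁ / a * (r₂ / b))⁻¹ := by field_simp
    rw [e, ← one_div, le_div_iff₀' (by positivity)]
    linarith
  have h1 : supSeminorm U m (B f g) ≤
      (r₁ * r₂)⁻¹ * supSeminorm V m₁ f * supSeminorm W m₂ g := by
    refine ge_of_tendsto (x := 𝓝[>] (0 : ℝ))
      (f := fun ε => (r₁ * r₂)⁻¹ * (supSeminorm V m₁ f + ε) * (supSeminorm W m₂ g + ε)) ?_ ?_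
    · have : Continuous fun ε : ℝ =>
        (r₁ * r₂)⁻¹ * (supSeminorm V m₁ f + ε) * (supSeminorm W m₂ g + ε) := by fun_prop
      simpa using (this.tendsto 0).mono_left nhdsWithin_le_nhds
    · filter_upwards [self_mem_nhdsWithin] with ε hε
      exact key _ _ (lt_add_of_pos_right _ hε) (lt_add_of_pos_right _ hε)
  refine h1.trans ?_
  have := supSeminorm_mono (le_max_left m₁ m₂) f
  have := supSeminorm_mono (le_max_right m₁ m₂) g
  gcongr

/-- Only the product of the two seminorms has to tend to zero, so the same argument gives continuity
at the origin and continuity at zero in each variable separately, the three inputs of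
`continuous_of_continuousAt_zero₂`. -/
theorem tendsto_bilin_zero {X : Type*} {B : 𝓢(V, ℂ) →ₗ[ℂ] 𝓢(W, ℂ) →ₗ[ℂ] 𝓢(U, ℂ)}
    (h : ∀ m, ∃ m', ∃ C, 0 ≤ C ∧
      ∀ f g, supSeminorm U m (B f g) ≤ C * supSeminorm V m' f * supSeminorm W m' g)
    {l : Filter X} {F : X → 𝓢(V, ℂ)} {G : X → 𝓢(W, ℂ)}
    (hFG : ∀ m, Tendsto (fun x => supSeminorm V m (F x) * supSeminorm W m (G x)) l (𝓝 0)) :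
    Tendsto (fun x => B (F x) (G x)) l (𝓝 0) := by
  intro s hs
  rw [Filter.mem_map]
  obtain ⟨m, r, hr, h₁⟩ := mem_nhds_zero_iff_supSeminorm.1 hs
  obtain ⟨m', C, hC, hB⟩ := h m
  have := (hFG m').const_mul C
  rw [mul_zero] at this
  filter_upwards [this.eventually (gt_mem_nhds hr)] with x hx
  refine h₁ _ ((hB _ _).trans_lt ?_)
  rwa [mul_assoc]

/-- A bilinear map that is bounded with respect to the standard seminorms is jointly continuous. -/
theorem continuous_bilin_of_supSeminorm_le (B : 𝓢(V, ℂ) →ₗ[ℂ] 𝓢(W, ℂ) →ₗ[ℂ] 𝓢(U, ℂ))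
    (h : ∀ m, ∃ m', ∃ C, 0 ≤ C ∧
      ∀ f g, supSeminorm U m (B f g) ≤ C * supSeminorm V m' f * supSeminorm W m' g) :
    Continuous fun p : 𝓢(V, ℂ) × 𝓢(W, ℂ) => B p.1 p.2 := by
  let B' : 𝓢(V, ℂ) →+ 𝓢(W, ℂ) →+ 𝓢(U, ℂ) :=
    AddMonoidHom.mk' (fun f => (B f).toAddMonoidHom) fun a b => by ext; simp
  refine continuous_of_continuousAt_zero₂ B' ?_ (fun f => ?_) (fun g => ?_)
  · have e : B' ((0 : 𝓢(V, ℂ)), (0 : 𝓢(W, ℂ))).1 ((0 : 𝓢(V, ℂ)), (0 : 𝓢(W, ℂ))).2 = 0 := by simp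
    rw [ContinuousAt, e]
    refine tendsto_bilin_zero h (F := fun p : 𝓢(V, ℂ) × 𝓢(W, ℂ) => p.1) (G := fun p => p.2)
      fun m => ?_
    have : Continuous fun p : 𝓢(V, ℂ) × 𝓢(W, ℂ) => supSeminorm V m p.1 * supSeminorm W m p.2 :=
      ((continuous_supSeminorm m).comp continuous_fst).mul
        ((continuous_supSeminorm m).comp continuous_snd)
    simpa using this.tendsto (0, 0)
  · rw [ContinuousAt, map_zero]
    refine tendsto_bilin_zero h (F := fun _ => f) (G := fun p => p) fun m => ?_
    have : Continuous fun p : 𝓢(W, ℂ) => supSeminorm V m f * supSeminorm W m p :=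
      continuous_const.mul (continuous_supSeminorm m)
    simpa using this.tendsto 0
  · have e : B' 0 g = 0 := by simp
    rw [ContinuousAt, e]
    refine tendsto_bilin_zero h (F := fun p => p) (G := fun _ => g) fun m => ?_
    have : Continuous fun p : 𝓢(V, ℂ) => supSeminorm V m p * supSeminorm W m g :=
      (continuous_supSeminorm m).mul continuous_const
    simpa using this.tendsto 0

theorem one_add_norm_pow_mul_le (f : 𝓢(V, ℂ)) (k n : ℕ) (x : V) :
    (1 + ‖x‖) ^ k * ‖iteratedFDeriv ℝ n f x‖ ≤ 2 ^ k * supSeminorm V (max k n) f := by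
  refine (one_add_le_sup_seminorm_apply (𝕜 := ℂ) (m := (k, n)) le_rfl le_rfl f x).trans ?_
  gcongr
  refine Seminorm.finset_sup_apply_le (apply_nonneg _ _) fun i hi => ?_
  have := Prod.mk_le_mk.1 (Finset.mem_Iic.1 hi)
  exact seminorm_le_supSeminorm (this.1.trans (le_max_left _ _)) (this.2.trans (le_max_right _ _)) f

theorem one_add_norm_pow_mul_apply_le (f : 𝓢(V, ℂ)) (k : ℕ) (x : V) :
    (1 + ‖x‖) ^ k * ‖f x‖ ≤ 2 ^ k * supSeminorm V k f := by
  simpa using one_add_norm_pow_mul_le f k 0 x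

end Seminorms

/-! ### Tensor products of Schwartz functions -/

section Tensor

variable {V W : Type*} [NormedAddCommGroup V] [NormedSpace ℝ V]
  [NormedAddCommGroup W] [NormedSpace ℝ W]

theorem norm_iteratedFDeriv_comp_fst_le (a : 𝓢(V, ℂ)) (n : ℕ) (z : V × W) :
    ‖iteratedFDeriv ℝ n (fun z : V × W => a z.1) z‖ ≤ ‖iteratedFDeriv ℝ n a z.1‖ := by
  have : (fun z : V × W => a z.1) = a ∘ ContinuousLinearMap.fst ℝ V W := rfl
  rw [this, ContinuousLinearMap.iteratedFDeriv_comp_right (i := n) _ (a.smooth ⊤) z (mod_cast le_top)]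
  refine (ContinuousMultilinearMap.norm_compContinuousLinearMap_le _ _).trans ?_
  refine mul_le_of_le_one_right (norm_nonneg _) (Finset.prod_le_one (fun _ _ => norm_nonneg _) ?_)
  exact fun _ _ => ContinuousLinearMap.norm_fst_le _ _ _

theorem norm_iteratedFDeriv_comp_snd_le (b : 𝓢(W, ℂ)) (n : ℕ) (z : V × W) :
    ‖iteratedFDeriv ℝ n (fun z : V × W => b z.2) z‖ ≤ ‖iteratedFDeriv ℝ n b z.2‖ := by
  have : (fun z : V × W => b z.2) = b ∘ ContinuousLinearMap.snd ℝ V W := rfl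
  rw [this, ContinuousLinearMap.iteratedFDeriv_comp_right (i := n) _ (b.smooth ⊤) z (mod_cast le_top)]
  refine (ContinuousMultilinearMap.norm_compContinuousLinearMap_le _ _).trans ?_
  refine mul_le_of_le_one_right (norm_nonneg _) (Finset.prod_le_one (fun _ _ => norm_nonneg _) ?_)
  exact fun _ _ => ContinuousLinearMap.norm_snd_le _ _ _

/-- Leibniz rule. Since ‖z‖^k ≤ ‖z.1‖^k + ‖z.2‖^k, the weight falls on one of the two factors, which
costs the factor 2; the binomial coefficients add up to 2 ^ n. -/
theorem norm_pow_mul_iteratedFDeriv_tensor_le (a : 𝓢(V, ℂ)) (b : 𝓢(W, ℂ)) {k n m : ℕ}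
    (hk : k ≤ m) (hn : n ≤ m) (z : V × W) :
    ‖z‖ ^ k * ‖iteratedFDeriv ℝ n (fun z : V × W => a z.1 * b z.2) z‖ ≤
      2 ^ n * 2 * supSeminorm V m a * supSeminorm W m b := by
  have h1 : ContDiff ℝ ∞ (fun z : V × W => a z.1) := (a.smooth ⊤).comp contDiff_fst
  have h2 : ContDiff ℝ ∞ (fun z : V × W => b z.2) := (b.smooth ⊤).comp contDiff_snd
  have h3 := norm_iteratedFDeriv_mul_le h1 h2 z (n := n) (mod_cast le_top)
  have hz : ‖z‖ ^ k ≤ ‖z.1‖ ^ k + ‖z.2‖ ^ k := by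
    rcases le_total ‖z.1‖ ‖z.2‖ with h | h
    · rw [Prod.norm_def, max_eq_right h]
      exact le_add_of_nonneg_left (by positivity)
    · rw [Prod.norm_def, max_eq_left h]
      exact le_add_of_nonneg_right (by positivity)
  have hterm : ∀ i ∈ Finset.range (n + 1), ‖z‖ ^ k *
      ((n.choose i : ℝ) * ‖iteratedFDeriv ℝ i (fun z : V × W => a z.1) z‖ *
        ‖iteratedFDeriv ℝ (n - i) (fun z : V × W => b z.2) z‖) ≤
      (n.choose i : ℝ) * (2 * supSeminorm V m a * supSeminorm W m b) := by
    intro i hi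
    have hi' : i ≤ n := Nat.lt_succ_iff.1 (Finset.mem_range.1 hi)
    have ha := norm_iteratedFDeriv_comp_fst_le (W := W) a i z
    have hb := norm_iteratedFDeriv_comp_snd_le (V := V) b (n - i) z
    have A0 := ((norm_iteratedFDeriv_le_seminorm ℂ a i z.1).trans
      (seminorm_le_supSeminorm (Nat.zero_le m) (hi'.trans hn) a))
    have A1 := ((le_seminorm ℂ k i a z.1).trans (seminorm_le_supSeminorm hk (hi'.trans hn) a))
    have B0 := ((norm_iteratedFDeriv_le_seminorm ℂ b (n - i) z.2).trans
      (seminorm_le_supSeminorm (Nat.zero_le m) ((Nat.sub_le _ _).trans hn) b))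
    have B1 := ((le_seminorm ℂ k (n - i) b z.2).trans
      (seminorm_le_supSeminorm hk ((Nat.sub_le _ _).trans hn) b))
    have e : ‖z‖ ^ k * ((n.choose i : ℝ) * ‖iteratedFDeriv ℝ i (fun z : V × W => a z.1) z‖ *
        ‖iteratedFDeriv ℝ (n - i) (fun z : V × W => b z.2) z‖) ≤ (n.choose i : ℝ) *
        ((‖z.1‖ ^ k * ‖iteratedFDeriv ℝ i a z.1‖) * ‖iteratedFDeriv ℝ (n - i) b z.2‖ +
        ‖iteratedFDeriv ℝ i a z.1‖ * (‖z.2‖ ^ k * ‖iteratedFDeriv ℝ (n - i) b z.2‖)) := by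
      calc _ ≤ (‖z.1‖ ^ k + ‖z.2‖ ^ k) * ((n.choose i : ℝ) * ‖iteratedFDeriv ℝ i a z.1‖ *
          ‖iteratedFDeriv ℝ (n - i) b z.2‖) := by gcongr
        _ = _ := by ring
    refine e.trans ?_
    rw [mul_assoc 2, two_mul]
    gcongr
  calc _ ≤ ‖z‖ ^ k * ∑ i ∈ Finset.range (n + 1),
        (n.choose i : ℝ) * ‖iteratedFDeriv ℝ i (fun z : V × W => a z.1) z‖ *
        ‖iteratedFDeriv ℝ (n - i) (fun z : V × W => b z.2) z‖ := by gcongr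
    _ ≤ ∑ i ∈ Finset.range (n + 1),
        (n.choose i : ℝ) * (2 * supSeminorm V m a * supSeminorm W m b) := by
      rw [Finset.mul_sum]
      exact Finset.sum_le_sum hterm
    _ = _ := by
      rw [← Finset.sum_mul]
      have : (∑ i ∈ Finset.range (n + 1), (n.choose i : ℝ)) = 2 ^ n := by
        exact_mod_cast Nat.sum_range_choose n
      rw [this]
      ring

/-- The tensor product `(a ⊗ b)(v, w) = a(v) b(w)`. -/
def tensor : 𝓢(V, ℂ) →ₗ[ℂ] 𝓢(W, ℂ) →ₗ[ℂ] 𝓢(V × W, ℂ) :=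
  LinearMap.mk₂ ℂ
    (fun a b =>
      { toFun := fun z => a z.1 * b z.2
        smooth' := ((a.smooth ⊤).comp contDiff_fst).mul ((b.smooth ⊤).comp contDiff_snd)
        decay' := fun _ _ => ⟨_, fun z =>
          norm_pow_mul_iteratedFDeriv_tensor_le a b (le_max_left _ _) (le_max_right _ _) z⟩ })
    (fun a a' b => by ext z; exact add_mul _ _ _)
    (fun c a b => by ext z; exact mul_assoc _ _ _)
    (fun a b b' => by ext z; exact mul_add _ _ _)
    (fun c a b => by ext z; exact mul_left_comm _ _ _)

@[simp]
theorem tensor_apply (a : 𝓢(V, ℂ)) (b : 𝓢(W, ℂ)) (z : V × W) : tensor a b z = a z.1 * b z.2 := rfl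

theorem supSeminorm_tensor_le (m : ℕ) (a : 𝓢(V, ℂ)) (b : 𝓢(W, ℂ)) :
    supSeminorm (V × W) m (tensor a b) ≤ 2 ^ m * 2 * supSeminorm V m a * supSeminorm W m b := by
  have ha : 0 ≤ supSeminorm V m a := apply_nonneg _ _
  have hb : 0 ≤ supSeminorm W m b := apply_nonneg _ _
  refine supSeminorm_le (by positivity) fun k n hk hn => ?_
  refine SchwartzMap.seminorm_le_bound ℂ k n _ (by positivity) fun z => ?_
  have h : (2 : ℝ) ^ n ≤ 2 ^ m := pow_le_pow_right₀ one_le_two hn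
  refine (norm_pow_mul_iteratedFDeriv_tensor_le a b hk hn z).trans ?_
  gcongr

theorem continuous_tensor : Continuous fun p : 𝓢(V, ℂ) × 𝓢(W, ℂ) => tensor p.1 p.2 :=
  continuous_bilin_of_supSeminorm_le tensor fun m =>
    ⟨m, _, by positivity, fun a b => supSeminorm_tensor_le m a b⟩

/-- Tensor product with a fixed first factor. -/
def tensorLeft (a : 𝓢(V, ℂ)) : 𝓢(W, ℂ) →L[ℂ] 𝓢(V × W, ℂ) :=
  ⟨tensor a, continuous_tensor.comp (Continuous.prodMk_right a)⟩

/-- Tensor product with a fixed second factor. -/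
def tensorRight (b : 𝓢(W, ℂ)) : 𝓢(V, ℂ) →L[ℂ] 𝓢(V × W, ℂ) :=
  ⟨tensor.flip b, continuous_tensor.comp (Continuous.prodMk_left b)⟩

end Tensor

end

section

open scoped ContDiff BoundedContinuousFunction

/-! ### Slices of Schwartz functions -/

section Slice

variable {P V : Type*} [NormedAddCommGroup P] [NormedSpace ℝ P]
  [NormedAddCommGroup V] [NormedSpace ℝ V]

/-- The slice `v ↦ H(p, v)` of a Schwartz function. -/
def slice (p : P) : 𝓢(P × V, ℂ) →L[ℂ] 𝓢(V, ℂ) :=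
  compCLMOfAntilipschitz (K := 1) (g := fun v : V => (p, v)) ℂ
    (by
      have : (fun v : V => (p, v)) =
          (fun _ => (p, 0)) + (ContinuousLinearMap.inr ℝ P V : V → P × V) := by
        ext v <;> simp
      rw [this]
      exact (Function.HasTemperateGrowth.const _).add (ContinuousLinearMap.hasTemperateGrowth _))
    (fun v w => by
      rw [ENNReal.coe_one, one_mul, Prod.edist_eq]
      exact le_max_right _ _)

@[simp]
theorem slice_apply (p : P) (H : 𝓢(P × V, ℂ)) (v : V) : slice p H v = H (p, v) := rfl

theorem iteratedFDeriv_slice (p : P) (H : 𝓢(P × V, ℂ)) (n : ℕ) (v : V) :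
    iteratedFDeriv ℝ n (slice p H) v =
      (iteratedFDeriv ℝ n H (p, v)).compContinuousLinearMap
        fun _ => ContinuousLinearMap.inr ℝ P V := by
  have h1 : (slice p H : V → ℂ) =
      (fun z : P × V => H ((p, 0) + z)) ∘ ContinuousLinearMap.inr ℝ P V := by
    ext v
    simp
  have h2 : ContDiff ℝ ∞ fun z : P × V => H ((p, 0) + z) :=
    (H.smooth ⊤).comp (contDiff_const.add contDiff_id)
  rw [h1, ContinuousLinearMap.iteratedFDeriv_comp_right (i := n) _ h2 v (mod_cast le_top),
    iteratedFDeriv_comp_add_left]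
  simp

theorem norm_compContinuousLinearMap_inr_le {n : ℕ}
    (M : ContinuousMultilinearMap ℝ (fun _ : Fin n => P × V) ℂ) :
    ‖M.compContinuousLinearMap fun _ => ContinuousLinearMap.inr ℝ P V‖ ≤ ‖M‖ := by
  refine (ContinuousMultilinearMap.norm_compContinuousLinearMap_le _ _).trans ?_
  refine mul_le_of_le_one_right (norm_nonneg _) (Finset.prod_le_one (fun _ _ => norm_nonneg _) ?_)
  exact fun _ _ => ContinuousLinearMap.norm_inr_le_one _ _ _

/-- Both ‖p‖ and ‖v‖ are bounded by the norm of the pair, so weights in p are absorbed by seminorms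
of `H`. Thus slices decay faster than any power of p, which makes them integrable in p. -/
theorem one_add_norm_pow_mul_seminorm_slice_le (p : P) (H : 𝓢(P × V, ℂ)) (N k n : ℕ) :
    (1 + ‖p‖) ^ N * SchwartzMap.seminorm ℂ k n (slice p H) ≤
      2 ^ (N + k) * supSeminorm (P × V) (max (N + k) n) H := by
  rw [← le_div_iff₀' (by positivity)]
  refine SchwartzMap.seminorm_le_bound ℂ k n _ (by positivity) fun v => ?_
  rw [le_div_iff₀' (by positivity), iteratedFDeriv_slice]
  have h1 : ‖p‖ ≤ ‖(p, v)‖ := norm_fst_le (p, v)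
  have h2 : ‖v‖ ≤ 1 + ‖(p, v)‖ := (norm_snd_le (p, v)).trans (by linarith)
  calc _ ≤ (1 + ‖(p, v)‖) ^ N * ((1 + ‖(p, v)‖) ^ k * ‖iteratedFDeriv ℝ n H (p, v)‖) := by
        gcongr
        exact norm_compContinuousLinearMap_inr_le _
    _ = (1 + ‖(p, v)‖) ^ (N + k) * ‖iteratedFDeriv ℝ n H (p, v)‖ := by ring
    _ ≤ _ := one_add_norm_pow_mul_le H (N + k) n (p, v)

theorem supSeminorm_slice_le (p : P) (H : 𝓢(P × V, ℂ)) (m : ℕ) :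
    supSeminorm V m (slice p H) ≤ 2 ^ m * supSeminorm (P × V) m H := by
  refine supSeminorm_le (by positivity) fun k n hk hn => ?_
  have := one_add_norm_pow_mul_seminorm_slice_le p H 0 k n
  rw [pow_zero, one_mul, zero_add] at this
  refine this.trans ?_
  have := supSeminorm_mono (max_le hk hn) H
  have h : (2 : ℝ) ^ k ≤ 2 ^ m := pow_le_pow_right₀ one_le_two hk
  gcongr

/-- Mean value inequality on P × {v}, where the weight ‖v‖^k is constant and can be divided out (if
it is 0 there is nothing to show). It costs one derivative and yields continuity of slices in p. -/
theorem seminorm_slice_sub_le (p q : P) (H : 𝓢(P × V, ℂ)) (k n : ℕ) :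
    SchwartzMap.seminorm ℂ k n (slice p H - slice q H) ≤
      SchwartzMap.seminorm ℂ k (n + 1) H * ‖p - q‖ := by
  refine SchwartzMap.seminorm_le_bound ℂ k n _ (by positivity) fun v => ?_
  have hs : ∀ p : P, ContDiffAt ℝ n (slice p H) v := fun p => (slice p H).contDiffAt n
  have e : (⇑(slice p H - slice q H) : V → ℂ) = ⇑(slice p H) - ⇑(slice q H) := by
    ext; simp
  rw [e, iteratedFDeriv_sub_apply (hs p) (hs q), iteratedFDeriv_slice, iteratedFDeriv_slice]
  have hd : ∀ z, DifferentiableAt ℝ (iteratedFDeriv ℝ n H) z := fun z =>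
    ((H.smooth ⊤).differentiable_iteratedFDeriv (m := n)
      (by exact_mod_cast WithTop.coe_lt_top _)).differentiableAt
  have h4 : ‖(iteratedFDeriv ℝ n H (p, v)).compContinuousLinearMap
        (fun _ => ContinuousLinearMap.inr ℝ P V) - (iteratedFDeriv ℝ n H (q, v)).compContinuousLinearMap
        (fun _ => ContinuousLinearMap.inr ℝ P V)‖ ≤
      ‖iteratedFDeriv ℝ n H (p, v) - iteratedFDeriv ℝ n H (q, v)‖ :=
    norm_compContinuousLinearMap_inr_le (iteratedFDeriv ℝ n H (p, v) - iteratedFDeriv ℝ n H (q, v))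
  rcases (pow_nonneg (norm_nonneg v) k).eq_or_lt with h0 | h0
  · rw [← h0, zero_mul]
    positivity
  have hb : ∀ z ∈ (Set.univ : Set P) ×ˢ ({v} : Set V),
      ‖fderiv ℝ (iteratedFDeriv ℝ n H) z‖ ≤
        SchwartzMap.seminorm ℂ k (n + 1) H / ‖v‖ ^ k := by
    rintro ⟨s, w⟩ ⟨-, hw⟩
    obtain rfl : w = v := hw
    rw [norm_fderiv_iteratedFDeriv, le_div_iff₀' h0]
    refine le_trans ?_ (le_seminorm ℂ k (n + 1) H (s, w))
    gcongr
    exact norm_snd_le (s, w)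
  have hmv := Convex.norm_image_sub_le_of_norm_fderiv_le (𝕜 := ℝ)
    (fun z _ => hd z) hb (convex_univ.prod (convex_singleton v))
    (x := (q, v)) (y := (p, v)) (by simp) (by simp)
  have h3 : ‖((p, v) : P × V) - (q, v)‖ = ‖p - q‖ := by simp [Prod.norm_def]
  rw [h3, div_mul_eq_mul_div, le_div_iff₀' h0] at hmv
  refine le_trans ?_ hmv
  gcongr

theorem seminorm_slice_le_rpow (p : P) (H : 𝓢(P × V, ℂ)) (N k n : ℕ) :
    SchwartzMap.seminorm ℂ k n (slice p H) ≤
      2 ^ (N + k) * supSeminorm (P × V) (max (N + k) n) H * (1 + ‖p‖) ^ (-(N : ℝ)) := by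
  rw [Real.rpow_neg (by positivity), Real.rpow_natCast, ← div_eq_mul_inv,
    le_div_iff₀' (by positivity)]
  exact one_add_norm_pow_mul_seminorm_slice_le p H N k n

theorem continuous_slice (H : 𝓢(P × V, ℂ)) : Continuous fun p : P => slice p H := by
  rw [continuous_iff_continuousAt]
  intro q
  rw [ContinuousAt, (schwartz_withSeminorms ℂ V ℂ).tendsto_nhds]
  rintro ⟨k, n⟩ ε hε
  have : Tendsto (fun p : P => SchwartzMap.seminorm ℂ k (n + 1) H * ‖p - q‖) (𝓝 q) (𝓝 0) := by
    have : Continuous fun p : P => SchwartzMap.seminorm ℂ k (n + 1) H * ‖p - q‖ := by fun_prop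
    simpa using this.tendsto q
  filter_upwards [this.eventually (gt_mem_nhds hε)] with p hp
  exact (seminorm_slice_sub_le p q H k n).trans_lt hp

end Slice

/-! ### Derivatives as bounded continuous functions -/

section Jet

variable {V : Type*} [NormedAddCommGroup V] [NormedSpace ℝ V]

/-- Bounded continuous functions with values in the multilinear forms of degree `i.2`. -/
def BoundedForms (V : Type*) [NormedAddCommGroup V] [NormedSpace ℝ V] (i : ℕ × ℕ) : Type _ :=
  V →ᵇ ContinuousMultilinearMap ℝ (fun _ : Fin i.2 => V) ℂ

instance (i : ℕ × ℕ) : NormedAddCommGroup (BoundedForms V i) :=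
  inferInstanceAs (NormedAddCommGroup (V →ᵇ ContinuousMultilinearMap ℝ (fun _ : Fin i.2 => V) ℂ))

instance (i : ℕ × ℕ) : NormedSpace ℝ (BoundedForms V i) :=
  inferInstanceAs (NormedSpace ℝ (V →ᵇ ContinuousMultilinearMap ℝ (fun _ : Fin i.2 => V) ℂ))

instance (i : ℕ × ℕ) : CompleteSpace (BoundedForms V i) :=
  inferInstanceAs (CompleteSpace (V →ᵇ ContinuousMultilinearMap ℝ (fun _ : Fin i.2 => V) ℂ))

/-- Evaluation at a point. -/
def BoundedForms.evalAt (i : ℕ × ℕ) (x : V) :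
    BoundedForms V i →L[ℝ] ContinuousMultilinearMap ℝ (fun _ : Fin i.2 => V) ℂ :=
  let e : (V →ᵇ ContinuousMultilinearMap ℝ (fun _ : Fin i.2 => V) ℂ) →L[ℝ]
      ContinuousMultilinearMap ℝ (fun _ : Fin i.2 => V) ℂ := BoundedContinuousFunction.evalCLM ℝ x
  e

theorem BoundedForms.ext {i : ℕ × ℕ} {f g : BoundedForms V i}
    (h : ∀ x, BoundedForms.evalAt i x f = BoundedForms.evalAt i x g) : f = g :=
  BoundedContinuousFunction.ext (β := ContinuousMultilinearMap ℝ (fun _ : Fin i.2 => V) ℂ) h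

theorem BoundedForms.norm_le {i : ℕ × ℕ} {f : BoundedForms V i} {C : ℝ} (hC : 0 ≤ C)
    (h : ∀ x, ‖BoundedForms.evalAt i x f‖ ≤ C) : ‖f‖ ≤ C :=
  (BoundedContinuousFunction.norm_le (β := ContinuousMultilinearMap ℝ (fun _ : Fin i.2 => V) ℂ)
    hC).2 h

theorem BoundedForms.norm_evalAt_le {i : ℕ × ℕ} (f : BoundedForms V i) (x : V) :
    ‖BoundedForms.evalAt i x f‖ ≤ ‖f‖ :=
  BoundedContinuousFunction.norm_coe_le_norm
    (β := ContinuousMultilinearMap ℝ (fun _ : Fin i.2 => V) ℂ) f x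

/-- The weighted derivative `x ↦ ‖x‖ ^ k D^n f(x)` as a bounded continuous function. -/
def weightedDerivFun (i : ℕ × ℕ) (f : 𝓢(V, ℂ)) : BoundedForms V i :=
  BoundedContinuousFunction.ofNormedAddCommGroup
    (fun x => ‖x‖ ^ i.1 • iteratedFDeriv ℝ i.2 f x)
    ((continuous_norm.pow _).smul ((f.smooth ⊤).continuous_iteratedFDeriv (mod_cast le_top)))
    (SchwartzMap.seminorm ℂ i.1 i.2 f)
    (fun x => by
      rw [norm_smul, norm_pow, norm_norm]
      exact le_seminorm ℂ i.1 i.2 f x)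

theorem evalAt_weightedDerivFun (i : ℕ × ℕ) (f : 𝓢(V, ℂ)) (x : V) :
    BoundedForms.evalAt i x (weightedDerivFun i f) = ‖x‖ ^ i.1 • iteratedFDeriv ℝ i.2 f x := rfl

/-- The map `f ↦ ‖x‖ ^ k D^n f` as a continuous linear map. -/
def weightedDeriv (V : Type*) [NormedAddCommGroup V] [NormedSpace ℝ V] (i : ℕ × ℕ) :
    𝓢(V, ℂ) →L[ℝ] BoundedForms V i :=
  mkCLMtoNormedSpace (weightedDerivFun i)
    (fun f g => BoundedForms.ext fun x => by
      have e : (⇑(f + g) : V → ℂ) = ⇑f + ⇑g := by ext; simp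
      rw [map_add, evalAt_weightedDerivFun, evalAt_weightedDerivFun, evalAt_weightedDerivFun, e,
        iteratedFDeriv_add_apply (f.contDiffAt _) (g.contDiffAt _), smul_add])
    (fun c f => BoundedForms.ext fun x => by
      have e : (⇑(c • f) : V → ℂ) = c • ⇑f := by ext; simp
      rw [RingHom.id_apply, map_smul, evalAt_weightedDerivFun, evalAt_weightedDerivFun, e,
        iteratedFDeriv_const_smul_apply (f.contDiffAt _), smul_comm])
    ⟨{i}, 1, zero_le_one, fun f => by
      rw [one_mul, Finset.sup_singleton]
      refine BoundedForms.norm_le (apply_nonneg _ _) fun x => ?_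
      rw [evalAt_weightedDerivFun, norm_smul, norm_pow, norm_norm]
      exact le_seminorm ℝ i.1 i.2 f x⟩

theorem evalAt_weightedDeriv (i : ℕ × ℕ) (f : 𝓢(V, ℂ)) (x : V) :
    BoundedForms.evalAt i x (weightedDeriv V i f) = ‖x‖ ^ i.1 • iteratedFDeriv ℝ i.2 f x := rfl

theorem norm_weightedDeriv_le (i : ℕ × ℕ) (f : 𝓢(V, ℂ)) :
    ‖weightedDeriv V i f‖ ≤ SchwartzMap.seminorm ℂ i.1 i.2 f :=
  BoundedForms.norm_le (apply_nonneg _ _) fun x => by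
    rw [evalAt_weightedDeriv, norm_smul, norm_pow, norm_norm]
    exact le_seminorm ℂ i.1 i.2 f x

theorem seminorm_le_norm_weightedDeriv (i : ℕ × ℕ) (f : 𝓢(V, ℂ)) :
    SchwartzMap.seminorm ℂ i.1 i.2 f ≤ ‖weightedDeriv V i f‖ := by
  refine SchwartzMap.seminorm_le_bound ℂ _ _ _ (norm_nonneg (weightedDeriv V i f)) fun x => ?_
  have := BoundedForms.norm_evalAt_le (weightedDeriv V i f) x
  rwa [evalAt_weightedDeriv, norm_smul, norm_pow, norm_norm] at this

end Jet

/-! ### Differentiation under the integral sign -/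

section ParametricIntegral

variable {α V F : Type*} [MeasurableSpace α] {μ : Measure α}
  [NormedAddCommGroup V] [NormedSpace ℝ V] [NormedAddCommGroup F] [NormedSpace ℝ F]

/-- The derivative of the n-th iterated derivative is the (n+1)-st only up to currying, a linear
isometry. `e` stands for that isometry, so that domination and measurability are required of g'
alone. -/
theorem hasFDerivAt_integral_of_isometryEquiv {G G' : Type*} [NormedAddCommGroup G]
    [NormedSpace ℝ G] [NormedAddCommGroup G'] [NormedSpace ℝ G'] (e : (V →L[ℝ] G) ≃ₗᵢ[ℝ] G')
    {g : α → V → G} {g' : α → V → G'} {b b' : α → ℝ} (hd : ∀ a x, DifferentiableAt ℝ (g a) x)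
    (he : ∀ a x, g' a x = e (fderiv ℝ (g a) x))
    (hm : ∀ x, AEStronglyMeasurable (fun a => g a x) μ)
    (hm' : ∀ x, AEStronglyMeasurable (fun a => g' a x) μ)
    (hb : ∀ a x, ‖g a x‖ ≤ b a) (hb' : ∀ a x, ‖g' a x‖ ≤ b' a)
    (hi : Integrable b μ) (hi' : Integrable b' μ) (x : V) :
    HasFDerivAt (fun x => ∫ a, g a x ∂μ) (e.symm (∫ a, g' a x ∂μ)) x := by
  have he' : ∀ a x, fderiv ℝ (g a) x = e.symm (g' a x) := fun a x => by
    rw [he, LinearIsometryEquiv.symm_apply_apply]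
  have h := e.symm.toContinuousLinearEquiv.integral_comp_comm (μ := μ) fun a => g' a x
  have h' : e.symm (∫ a, g' a x ∂μ) = ∫ a, fderiv ℝ (g a) x ∂μ := by
    simp_rw [he']
    exact h.symm
  rw [h']
  refine hasFDerivAt_integral_of_dominated_of_fderiv_le (s := Set.univ) (bound := b')
    (F := fun x a => g a x) (F' := fun x a => fderiv ℝ (g a) x)
    Filter.univ_mem (Eventually.of_forall fun y => hm y) (hi.mono' (hm x)
      (Eventually.of_forall fun a => hb a x)) ?_ ?_ hi' ?_
  · simp_rw [he']
    exact e.symm.continuous.comp_aestronglyMeasurable (hm' x)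
  · refine Eventually.of_forall fun a y _ => ?_
    rw [he', LinearIsometryEquiv.norm_map]
    exact hb' a y
  · exact Eventually.of_forall fun a y _ => (hd a y).hasFDerivAt

theorem hasFDerivAt_integral_iteratedFDeriv {f : α → V → F} {b : ℕ → α → ℝ}
    (hf : ∀ a, ContDiff ℝ ∞ (f a))
    (hm : ∀ n x, AEStronglyMeasurable (fun a => iteratedFDeriv ℝ n (f a) x) μ)
    (hb : ∀ n a x, ‖iteratedFDeriv ℝ n (f a) x‖ ≤ b n a) (hi : ∀ n, Integrable (b n) μ)
    (n : ℕ) (x : V) :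
    HasFDerivAt (fun x => ∫ a, iteratedFDeriv ℝ n (f a) x ∂μ)
      ((continuousMultilinearCurryLeftEquiv ℝ (fun _ : Fin (n + 1) => V) F)
        (∫ a, iteratedFDeriv ℝ (n + 1) (f a) x ∂μ)) x := by
  refine hasFDerivAt_integral_of_isometryEquiv
    (continuousMultilinearCurryLeftEquiv ℝ (fun _ : Fin (n + 1) => V) F).symm
    (g := fun a => iteratedFDeriv ℝ n (f a)) (g' := fun a => iteratedFDeriv ℝ (n + 1) (f a))
    (fun a x => ?_) (fun a x => ?_) (hm n) (hm (n + 1)) (hb n) (hb (n + 1)) (hi n) (hi (n + 1)) x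
  · exact ((hf a).differentiable_iteratedFDeriv (m := n)
      (by exact_mod_cast WithTop.coe_lt_top _)).differentiableAt
  · rw [iteratedFDeriv_succ_eq_comp_left, Function.comp_apply]

theorem iteratedFDeriv_integral {f : α → V → F} {b : ℕ → α → ℝ}
    (hf : ∀ a, ContDiff ℝ ∞ (f a))
    (hm : ∀ n x, AEStronglyMeasurable (fun a => iteratedFDeriv ℝ n (f a) x) μ)
    (hb : ∀ n a x, ‖iteratedFDeriv ℝ n (f a) x‖ ≤ b n a) (hi : ∀ n, Integrable (b n) μ)
    (n : ℕ) : iteratedFDeriv ℝ n (fun x => ∫ a, f a x ∂μ) =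
      fun x => ∫ a, iteratedFDeriv ℝ n (f a) x ∂μ := by
  induction n with
  | zero =>
    ext1 x
    simp only [iteratedFDeriv_zero_eq_comp, Function.comp_apply]
    exact ((continuousMultilinearCurryFin0 ℝ V F).symm.toContinuousLinearEquiv.integral_comp_comm
      _).symm
  | succ n ih =>
    ext1 x
    rw [iteratedFDeriv_succ_eq_comp_left, Function.comp_apply, ih,
      (hasFDerivAt_integral_iteratedFDeriv hf hm hb hi n x).fderiv,
      LinearIsometryEquiv.symm_apply_apply]

theorem contDiff_integral {f : α → V → F} {b : ℕ → α → ℝ}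
    (hf : ∀ a, ContDiff ℝ ∞ (f a))
    (hm : ∀ n x, AEStronglyMeasurable (fun a => iteratedFDeriv ℝ n (f a) x) μ)
    (hb : ∀ n a x, ‖iteratedFDeriv ℝ n (f a) x‖ ≤ b n a) (hi : ∀ n, Integrable (b n) μ) :
    ContDiff ℝ ∞ fun x => ∫ a, f a x ∂μ := by
  refine contDiff_of_differentiable_iteratedFDeriv fun n _ => ?_
  rw [iteratedFDeriv_integral hf hm hb hi n]
  exact fun x => (hasFDerivAt_integral_iteratedFDeriv hf hm hb hi n x).differentiableAt

end ParametricIntegral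

/-! ### Partial integration -/

section WeightIntegral

variable {P : Type*} [NormedAddCommGroup P] [MeasurableSpace P] (μ : Measure P)

/-- The constant in the estimate of `∫ (1 + ‖p‖) ^ (-N) dp`. -/
def weightIntegral : ℝ := ∫ p, (1 + ‖p‖) ^ (-(μ.integrablePower : ℝ)) ∂μ

theorem weightIntegral_nonneg : 0 ≤ weightIntegral μ :=
  integral_nonneg fun _ => by positivity

end WeightIntegral

section PartialIntegral

variable {P V : Type*} [NormedAddCommGroup P] [NormedSpace ℝ P] [FiniteDimensional ℝ P]
  [MeasurableSpace P] [BorelSpace P]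
  [NormedAddCommGroup V] [NormedSpace ℝ V] (μ : Measure P) [μ.HasTemperateGrowth]

theorem aestronglyMeasurable_iteratedFDeriv_slice (H : 𝓢(P × V, ℂ)) (n : ℕ) (v : V) :
    AEStronglyMeasurable (fun p => iteratedFDeriv ℝ n (slice p H) v) μ := by
  have h : Continuous fun p => BoundedForms.evalAt (0, n) v (weightedDeriv V (0, n) (slice p H)) :=
    (BoundedForms.evalAt (0, n) v).continuous.comp
      ((weightedDeriv V (0, n)).continuous.comp (continuous_slice H))
  have e : ∀ p, BoundedForms.evalAt (0, n) v (weightedDeriv V (0, n) (slice p H)) =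
      iteratedFDeriv ℝ n (slice p H) v := fun p => by
    rw [evalAt_weightedDeriv, pow_zero, one_smul]
  simp only [e] at h
  exact h.aestronglyMeasurable

theorem norm_iteratedFDeriv_slice_le_rpow (H : 𝓢(P × V, ℂ)) (n : ℕ) (p : P) (v : V) :
    ‖iteratedFDeriv ℝ n (slice p H) v‖ ≤
      2 ^ (μ.integrablePower + 0) * supSeminorm (P × V) (max (μ.integrablePower + 0) n) H *
        (1 + ‖p‖) ^ (-(μ.integrablePower : ℝ)) :=
  (norm_iteratedFDeriv_le_seminorm ℂ _ n v).trans (seminorm_slice_le_rpow p H _ 0 n)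

theorem iteratedFDeriv_integral_slice (H : 𝓢(P × V, ℂ)) (n : ℕ) :
    iteratedFDeriv ℝ n (fun v => ∫ p, H (p, v) ∂μ) =
      fun v => ∫ p, iteratedFDeriv ℝ n (slice p H) v ∂μ :=
  iteratedFDeriv_integral (f := fun p v => slice p H v) (fun p => (slice p H).smooth ⊤)
    (fun n v => aestronglyMeasurable_iteratedFDeriv_slice μ H n v)
    (fun k p v => norm_iteratedFDeriv_slice_le_rpow μ H k p v)
    (fun n => (Measure.integrable_pow_neg_integrablePower μ).const_mul _) n

/-- Partial integration `v ↦ ∫ H(p, v) dp`. -/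
def partialIntegral : 𝓢(P × V, ℂ) →L[ℂ] 𝓢(V, ℂ) :=
  mkCLM (fun H v => ∫ p, H (p, v) ∂μ)
    (fun H H' v => by
      have h : ∀ H : 𝓢(P × V, ℂ), Integrable (fun p => H (p, v)) μ := fun H =>
        ((Measure.integrable_pow_neg_integrablePower μ).const_mul _).mono'
          ((by fun_prop : Continuous fun p => H (p, v)).aestronglyMeasurable)
          (Eventually.of_forall fun p => by
            simpa using norm_iteratedFDeriv_slice_le_rpow μ H 0 p v)
      simpa using integral_add (h H) (h H'))
    (fun c H v => by simpa using integral_const_mul c fun p => H (p, v))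
    (fun H => contDiff_integral (f := fun p v => slice p H v) (fun p => (slice p H).smooth ⊤)
      (fun n v => aestronglyMeasurable_iteratedFDeriv_slice μ H n v)
      (fun k p v => norm_iteratedFDeriv_slice_le_rpow μ H k p v)
      (fun n => (Measure.integrable_pow_neg_integrablePower μ).const_mul _))
    (by
      rintro ⟨k, n⟩
      set N := μ.integrablePower with hN
      refine ⟨Finset.Iic (max (N + k) n, max (N + k) n), 2 ^ (N + k) * weightIntegral μ,
        mul_nonneg (by positivity) (weightIntegral_nonneg μ), fun H v => ?_⟩
      rw [iteratedFDeriv_integral_slice]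
      have h1 : ∀ p, ‖‖v‖ ^ k • iteratedFDeriv ℝ n (slice p H) v‖ ≤
          2 ^ (N + k) * supSeminorm (P × V) (max (N + k) n) H * (1 + ‖p‖) ^ (-(N : ℝ)) := by
        intro p
        rw [norm_smul, norm_pow, norm_norm]
        exact (le_seminorm ℂ k n _ v).trans (seminorm_slice_le_rpow p H N k n)
      have h2 := norm_integral_le_of_norm_le
        ((Measure.integrable_pow_neg_integrablePower μ).const_mul _) (Eventually.of_forall h1)
      rw [integral_smul, norm_smul, norm_pow, norm_norm, integral_const_mul] at h2
      refine h2.trans (le_of_eq ?_)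
      change _ = 2 ^ (N + k) * weightIntegral μ * supSeminorm (P × V) (max (N + k) n) H
      rw [weightIntegral]
      ring)

@[simp]
theorem partialIntegral_apply (H : 𝓢(P × V, ℂ)) (v : V) :
    partialIntegral μ H v = ∫ p, H (p, v) ∂μ := rfl

/-- In the quotient by K, which is normed because K is closed, the integrand becomes zero, and the
quotient map commutes with the Bochner integral. -/
theorem _root_.Submodule.integral_mem_of_forall_mem {α G : Type*} [MeasurableSpace α]
    {ν : Measure α} [NormedAddCommGroup G] [NormedSpace ℝ G] [CompleteSpace G] (K : Submodule ℝ G)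
    (hK : IsClosed (K : Set G)) {f : α → G} (hf : Integrable f ν) (h : ∀ a, f a ∈ K) :
    ∫ a, f a ∂ν ∈ K := by
  have : IsClosed (K : Set G) := hK
  have h0 : ∀ a, K.mkQL (f a) = 0 := fun a => (Submodule.Quotient.mk_eq_zero K).2 (h a)
  have h1 := ContinuousLinearMap.integral_comp_comm K.mkQL hf
  simp only [h0, integral_zero] at h1
  exact (Submodule.Quotient.mk_eq_zero K).1 h1.symm

/-- A tempered distribution that vanishes on all slices of `H` vanishes on their integral. -/
theorem apply_partialIntegral_eq_zero (L : 𝓢(V, ℂ) →L[ℂ] ℂ) (H : 𝓢(P × V, ℂ))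
    (hL : ∀ p, L (slice p H) = 0) : L (partialIntegral μ H) = 0 := by
  obtain ⟨m, C, hC, hm⟩ := exists_norm_le_supSeminorm L
  -- Schwartz space is not a Banach space. The slices are therefore integrated in a finite product
  -- of Banach spaces of weighted derivatives, whose norm dominates the seminorm that controls L.
  let J : 𝓢(V, ℂ) →L[ℝ] ∀ i : Finset.Iic (m, m), BoundedForms V i.1 :=
    ContinuousLinearMap.pi fun i => weightedDeriv V i.1
  have hJ : ∀ f, supSeminorm V m f ≤ ‖J f‖ := by
    intro f
    refine supSeminorm_le (norm_nonneg _) fun k n hk hn => ?_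
    refine (seminorm_le_norm_weightedDeriv (k, n) f).trans ?_
    exact norm_le_pi_norm (J f) ⟨(k, n), Finset.mem_Iic.2 (Prod.mk_le_mk.2 ⟨hk, hn⟩)⟩
  have hint' : ∀ i, Integrable (fun p => weightedDeriv V i (slice p H)) μ := by
    intro i
    refine ((Measure.integrable_pow_neg_integrablePower μ).const_mul (2 ^ (μ.integrablePower + i.1) *
      supSeminorm (P × V) (max (μ.integrablePower + i.1) i.2) H)).mono'
      ((weightedDeriv V i).continuous.comp (continuous_slice H)).aestronglyMeasurable
      (Eventually.of_forall fun p => ?_)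
    exact (norm_weightedDeriv_le i _).trans (seminorm_slice_le_rpow p H _ i.1 i.2)
  have hint : Integrable (fun p => J (slice p H)) μ := Integrable.of_eval fun i => hint' i.1
  have hJI : J (partialIntegral μ H) = ∫ p, J (slice p H) ∂μ := by
    ext1 i
    rw [eval_integral fun i => hint' i.1]
    refine BoundedForms.ext fun x => ?_
    change BoundedForms.evalAt i.1 x (weightedDeriv V i.1 (partialIntegral μ H)) =
      BoundedForms.evalAt i.1 x (∫ p, weightedDeriv V i.1 (slice p H) ∂μ)
    rw [← ContinuousLinearMap.integral_comp_comm _ (hint' i.1)]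
    simp_rw [evalAt_weightedDeriv]
    rw [integral_smul]
    congr 1
    exact congrFun (iteratedFDeriv_integral_slice μ H i.1.2) x
  -- L need not extend to the Banach space. It is enough that the integral lies in the closure of
  -- the image of ker L: it is then approximated by some f with L f = 0, with an error that is small
  -- in the norm controlling L.
  let N := (LinearMap.ker (L.restrictScalars ℝ).toLinearMap).map J.toLinearMap
  have hK : J (partialIntegral μ H) ∈ N.topologicalClosure := by
    rw [hJI]
    exact Submodule.integral_mem_of_forall_mem _ N.isClosed_topologicalClosure hint fun p =>
      N.le_topologicalClosure (Submodule.mem_map_of_mem (hL p))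
  rw [← SetLike.mem_coe, Submodule.topologicalClosure_coe, Metric.mem_closure_iff] at hK
  refine norm_le_zero_iff.1 (le_of_forall_pos_le_add fun ε hε => ?_)
  obtain ⟨_, ⟨f, hf, rfl⟩, hd⟩ := hK (ε / (C + 1)) (by positivity)
  have hf' : L f = 0 := hf
  have h2 : L (partialIntegral μ H) = L (partialIntegral μ H - f) := by rw [map_sub, hf', sub_zero]
  have h3 : ‖J (partialIntegral μ H - f)‖ < ε / (C + 1) := by
    rw [map_sub, ← dist_eq_norm]
    exact hd
  rw [h2, zero_add]
  calc _ ≤ C * (ε / (C + 1)) := (hm _).trans (by gcongr; exact (hJ _).trans h3.le)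
    _ ≤ (C + 1) * (ε / (C + 1)) := by gcongr; linarith
    _ = ε := by field_simp

end PartialIntegral

end

section

open scoped ContDiff FourierTransform RealInnerProductSpace

/-! ### Density of tensor products -/

/-- Every derivative is bounded: the n-th one is (2πi)^n times a function of modulus one. -/
theorem hasTemperateGrowth_fourierChar :
    Function.HasTemperateGrowth fun t : ℝ => (Real.fourierChar t : ℂ) := by
  have e : (fun t : ℝ => (Real.fourierChar t : ℂ)) =
      fun t : ℝ => Complex.exp ((2 * Real.pi * Complex.I) * t) := by
    ext t
    rw [Real.fourierChar_apply]
    congr 1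
    push_cast
    ring
  rw [e]
  have hn : ∀ n : ℕ, iteratedDeriv n (fun t : ℝ => Complex.exp ((2 * Real.pi * Complex.I) * t)) =
      fun t : ℝ => (2 * Real.pi * Complex.I) ^ n * Complex.exp ((2 * Real.pi * Complex.I) * t) := by
    intro n
    induction n with
    | zero => simp
    | succ n ih =>
      ext t
      rw [iteratedDeriv_succ, ih]
      have h1 : HasDerivAt (fun t : ℝ => (2 * Real.pi * Complex.I) * (t : ℂ))
          (2 * Real.pi * Complex.I) t := by
        simpa using (Complex.ofRealCLM.hasDerivAt (x := t)).const_mul (2 * Real.pi * Complex.I)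
      rw [(h1.cexp.const_mul _).deriv]
      ring
  refine ⟨?_, fun n => ⟨0, (2 * Real.pi) ^ n, fun t => ?_⟩⟩
  · exact (contDiff_const.mul Complex.ofRealCLM.contDiff).cexp
  · rw [norm_iteratedFDeriv_eq_norm_iteratedDeriv, hn, norm_mul, norm_pow]
    have h2 : ‖Complex.exp ((2 * Real.pi * Complex.I) * t)‖ = 1 := by
      have : (2 * Real.pi * Complex.I) * t = ((2 * Real.pi * t : ℝ) : ℂ) * Complex.I := by
        push_cast
        ring
      rw [this, Complex.norm_exp_ofReal_mul_I]
    rw [h2]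
    simp [abs_of_pos Real.pi_pos]

/-! ### Cutoff functions at large scale -/

section Cutoff

variable {V : Type*} [NormedAddCommGroup V] [NormedSpace ℝ V]

/-- The dilation `f ↦ f(c ·)`. -/
def dilate (c : ℝˣ) : 𝓢(V, ℂ) →L[ℂ] 𝓢(V, ℂ) :=
  compCLMOfContinuousLinearEquiv ℂ (ContinuousLinearEquiv.smulLeft c : V ≃L[ℝ] V)

@[simp]
theorem dilate_apply (c : ℝˣ) (f : 𝓢(V, ℂ)) (v : V) : dilate c f v = f ((c : ℝ) • v) := rfl

theorem norm_iteratedFDeriv_dilate_le (c : ℝˣ) (hc : |(c : ℝ)| ≤ 1) (f : 𝓢(V, ℂ)) (n : ℕ) (v : V) :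
    ‖iteratedFDeriv ℝ n (dilate c f) v‖ ≤ SchwartzMap.seminorm ℂ 0 n f := by
  have e : (dilate c f : V → ℂ) = f ∘ ((c : ℝ) • ContinuousLinearMap.id ℝ V) := rfl
  rw [e, ContinuousLinearMap.iteratedFDeriv_comp_right (i := n) _ (f.smooth ⊤) v (mod_cast le_top)]
  refine (ContinuousMultilinearMap.norm_compContinuousLinearMap_le _ _).trans ?_
  refine (mul_le_of_le_one_right (norm_nonneg _)
    (Finset.prod_le_one (fun _ _ => norm_nonneg _) ?_)).trans
      (norm_iteratedFDeriv_le_seminorm ℂ f n _)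
  intro _ _
  rw [norm_smul, Real.norm_eq_abs]
  exact mul_le_one₀ hc (norm_nonneg _) ContinuousLinearMap.norm_id_le

/-- Cutting off a Schwartz function outside of a large ball changes it by a small amount. -/
theorem supSeminorm_sub_dilate_mul_le (χ θ : 𝓢(V, ℂ)) (hχ : ∀ v, ‖v‖ < 1 → χ v = 1)
    (c : ℝˣ) (hc0 : 0 < (c : ℝ)) (hc : (c : ℝ) ≤ 1) (m : ℕ) :
    supSeminorm V m (θ - smulLeftCLM ℂ (dilate c χ : V → ℂ) θ) ≤
      c * (2 ^ m * (1 + supSeminorm V m χ) * supSeminorm V (m + 1) θ) := by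
  have hS : 0 ≤ supSeminorm V m χ := apply_nonneg _ _
  have hT : 0 ≤ supSeminorm V (m + 1) θ := apply_nonneg _ _
  refine supSeminorm_le (by positivity) fun k n hk hn => ?_
  refine SchwartzMap.seminorm_le_bound ℂ k n _ (by positivity) fun x => ?_
  have e : (⇑(θ - smulLeftCLM ℂ (dilate c χ : V → ℂ) θ) : V → ℂ) =
      fun x => (1 - dilate c χ x) * θ x := by
    ext x
    rw [sub_apply, smulLeftCLM_apply_apply (SchwartzMap.hasTemperateGrowth _), smul_eq_mul]
    ring
  rw [e]
  -- Where ‖c x‖ < 1 the difference vanishes near x. Elsewhere 1 ≤ c‖x‖, so one extra power of the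
  -- weight buys the factor c; this is why the seminorm of order m + 1 of θ appears.
  rcases lt_or_ge ‖(c : ℝ) • x‖ 1 with hx | hx
  · have h0 : (fun x => (1 - dilate c χ x) * θ x) =ᶠ[𝓝 x] fun _ => 0 := by
      have : ∀ᶠ y in 𝓝 x, ‖(c : ℝ) • y‖ < 1 :=
        (continuous_const_smul (c : ℝ)).norm.continuousAt.eventually_lt continuousAt_const hx
      filter_upwards [this] with y hy
      rw [dilate_apply, hχ _ hy, sub_self, zero_mul]
    rw [(h0.iteratedFDeriv ℝ n).eq_of_nhds]
    have h1 : iteratedFDeriv ℝ n (fun _ : V => (0 : ℂ)) x = 0 := by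
      exact congrFun iteratedFDeriv_fun_zero x
    rw [h1, norm_zero, mul_zero]
    positivity
  · have hx' : 1 ≤ c * ‖x‖ := by
      rwa [norm_smul, Real.norm_of_nonneg hc0.le] at hx
    have hd1 : ContDiff ℝ ∞ fun x => 1 - dilate c χ x :=
      contDiff_const.sub ((dilate c χ).smooth ⊤)
    have hb1 : ∀ i ≤ n, ‖iteratedFDeriv ℝ i (fun x => 1 - dilate c χ x) x‖ ≤
        1 + supSeminorm V m χ := by
      intro i hi
      have h2 : (fun x => 1 - dilate c χ x) = (fun _ => (1 : ℂ)) - ⇑(dilate c χ) := rfl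
      rw [h2, iteratedFDeriv_sub_apply contDiffAt_const ((dilate c χ).contDiffAt _)]
      refine (norm_sub_le _ _).trans (add_le_add ?_ ?_)
      · rcases Nat.eq_zero_or_pos i with rfl | hi0
        · simp
        · rw [iteratedFDeriv_const_of_ne hi0.ne']
          simp
      · refine (norm_iteratedFDeriv_dilate_le c ?_ χ i x).trans
          (seminorm_le_supSeminorm (Nat.zero_le _) (hi.trans hn) χ)
        rwa [abs_of_pos hc0]
    have h3 := norm_iteratedFDeriv_mul_le hd1 (θ.smooth ⊤) x (n := n) (mod_cast le_top)
    have h4 : ‖x‖ ^ k ≤ c * ‖x‖ ^ (k + 1) := by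
      calc ‖x‖ ^ k = 1 * ‖x‖ ^ k := (one_mul _).symm
        _ ≤ (c * ‖x‖) * ‖x‖ ^ k := by gcongr
        _ = _ := by ring
    calc ‖x‖ ^ k * ‖iteratedFDeriv ℝ n (fun x => (1 - dilate c χ x) * θ x) x‖
        ≤ (c * ‖x‖ ^ (k + 1)) * ∑ i ∈ Finset.range (n + 1), (n.choose i : ℝ) *
          ‖iteratedFDeriv ℝ i (fun x => 1 - dilate c χ x) x‖ * ‖iteratedFDeriv ℝ (n - i) θ x‖ := by
          gcongr
      _ = c * ∑ i ∈ Finset.range (n + 1), (n.choose i : ℝ) *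
          (‖iteratedFDeriv ℝ i (fun x => 1 - dilate c χ x) x‖ *
            (‖x‖ ^ (k + 1) * ‖iteratedFDeriv ℝ (n - i) θ x‖)) := by
          rw [mul_assoc, Finset.mul_sum]
          congr 1
          refine Finset.sum_congr rfl fun i _ => ?_
          ring
      _ ≤ c * ∑ i ∈ Finset.range (n + 1), (n.choose i : ℝ) *
          ((1 + supSeminorm V m χ) * supSeminorm V (m + 1) θ) := by
          gcongr with i hi
          · exact hb1 i (Nat.lt_succ_iff.1 (Finset.mem_range.1 hi))
          · exact (le_seminorm ℂ (k + 1) (n - i) θ x).trans (seminorm_le_supSeminorm (by omega)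
              (by omega) θ)
      _ = c * (2 ^ n * ((1 + supSeminorm V m χ) * supSeminorm V (m + 1) θ)) := by
          rw [← Finset.sum_mul]
          congr 2
          exact_mod_cast Nat.sum_range_choose n
      _ ≤ _ := by
          rw [mul_assoc (2 ^ m)]
          gcongr
          exact one_le_two

end Cutoff

/-! ### Totality of tensor products -/

section Density

variable {P V : Type*} [NormedAddCommGroup P] [NormedSpace ℝ P] [FiniteDimensional ℝ P]
  [NormedAddCommGroup V] [NormedSpace ℝ V] [FiniteDimensional ℝ V]

/-- By Fourier inversion, the cut-off function is a superposition over the frequencies ξ of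
characters multiplied by χ₁ ⊗ χ₂. A character of a sum factorizes, so every such slice is a product
function and is annihilated by L. The cutoffs are what makes the two factors Schwartz functions. -/
theorem tensor_mul_fourier_eq_zero (L : 𝓢(P × V, ℂ) →L[ℂ] ℂ)
    (hL : ∀ a b, L (tensor a b) = 0) (χ₁ : 𝓢(P, ℂ)) (χ₂ : 𝓢(V, ℂ)) (θ : 𝓢(P × V, ℂ)) :
    L (smulLeftCLM ℂ (tensor χ₁ χ₂ : P × V → ℂ) θ) = 0 := by
  -- The norm of a product is a maximum and comes from no inner product, so the Fourier transform is
  -- taken in Euclidean coordinates.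
  let e := toEuclidean (E := P × V)
  let θ' := compCLMOfContinuousLinearEquiv ℂ e.symm θ
  let g : EuclideanSpace ℝ (Fin (Module.finrank ℝ (P × V))) × (P × V) → ℂ :=
    fun z => Real.fourierChar ⟪z.1, e z.2⟫
  have hg : g.HasTemperateGrowth := by
    refine hasTemperateGrowth_fourierChar.comp ?_
    exact (innerSL ℝ).bilinear_hasTemperateGrowth
      (ContinuousLinearMap.fst ℝ (EuclideanSpace ℝ (Fin (Module.finrank ℝ (P × V))))
        (P × V)).hasTemperateGrowth
      ((e.toContinuousLinearMap.comp (ContinuousLinearMap.snd ℝ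
        (EuclideanSpace ℝ (Fin (Module.finrank ℝ (P × V)))) (P × V))).hasTemperateGrowth)
  let H := smulLeftCLM ℂ g (tensor (𝓕 θ') (tensor χ₁ χ₂))
  have hI : smulLeftCLM ℂ (tensor χ₁ χ₂ : P × V → ℂ) θ = partialIntegral volume H := by
    ext x
    rw [smulLeftCLM_apply_apply (SchwartzMap.hasTemperateGrowth _), partialIntegral_apply]
    have h1 : θ x = 𝓕⁻ (𝓕 θ') (e x) := by
      rw [FourierTransform.fourierInv_fourier_eq]
      simp [θ']
    rw [h1, fourierInv_coe, Real.fourierInv_eq, smul_eq_mul, ← integral_const_mul]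
    refine integral_congr_ae (Eventually.of_forall fun ξ => ?_)
    simp only [H]
    rw [smulLeftCLM_apply_apply hg]
    simp only [tensor_apply, smul_eq_mul, g, Circle.smul_def]
    ring
  rw [hI]
  refine apply_partialIntegral_eq_zero volume L H fun ξ => ?_
  have h2 : Function.HasTemperateGrowth fun p =>
      (Real.fourierChar ⟪ξ, e (ContinuousLinearMap.inl ℝ P V p)⟫ : ℂ) :=
    hasTemperateGrowth_fourierChar.comp (((innerSL ℝ ξ).comp (e.toContinuousLinearMap.comp
      (ContinuousLinearMap.inl ℝ P V))).hasTemperateGrowth)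
  have h3 : Function.HasTemperateGrowth fun v =>
      (Real.fourierChar ⟪ξ, e (ContinuousLinearMap.inr ℝ P V v)⟫ : ℂ) :=
    hasTemperateGrowth_fourierChar.comp (((innerSL ℝ ξ).comp (e.toContinuousLinearMap.comp
      (ContinuousLinearMap.inr ℝ P V))).hasTemperateGrowth)
  have hs : slice ξ H = (𝓕 θ') ξ •
      tensor
        (smulLeftCLM ℂ
          (fun p => (Real.fourierChar ⟪ξ, e (ContinuousLinearMap.inl ℝ P V p)⟫ : ℂ)) χ₁)
        (smulLeftCLM ℂ
          (fun v => (Real.fourierChar ⟪ξ, e (ContinuousLinearMap.inr ℝ P V v)⟫ : ℂ)) χ₂) := by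
    ext x
    rw [slice_apply]
    simp only [H, smul_apply, tensor_apply]
    rw [smulLeftCLM_apply_apply hg, smulLeftCLM_apply_apply h2, smulLeftCLM_apply_apply h3]
    have h4 : x = ContinuousLinearMap.inl ℝ P V x.1 + ContinuousLinearMap.inr ℝ P V x.2 := by simp
    have h5 : g (ξ, x) = Real.fourierChar ⟪ξ, e (ContinuousLinearMap.inl ℝ P V x.1)⟫ *
        Real.fourierChar ⟪ξ, e (ContinuousLinearMap.inr ℝ P V x.2)⟫ := by
      simp only [g]
      conv_lhs => rw [h4]
      rw [map_add, inner_add_right, AddChar.map_add_eq_mul, Circle.coe_mul]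
    rw [h5]
    simp only [tensor_apply, smul_eq_mul]
    ring
  rw [hs, map_smul, hL, smul_zero]

/-- A smooth cutoff function that is equal to one on the unit ball. -/
theorem exists_cutoff (V : Type*) [NormedAddCommGroup V] [NormedSpace ℝ V]
    [FiniteDimensional ℝ V] : ∃ χ : 𝓢(V, ℂ), ∀ v, ‖v‖ < 1 → χ v = 1 := by
  obtain ⟨b, hb⟩ : ∃ b : ContDiffBump (0 : V), b.rIn = 1 := ⟨⟨1, 2, one_pos, one_lt_two⟩, rfl⟩
  have hs : HasCompactSupport fun v => ((b v : ℝ) : ℂ) := b.hasCompactSupport.comp_left (g := fun r : ℝ => (r : ℂ)) Complex.ofReal_zero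
  have hd : ContDiff ℝ ∞ fun v => ((b v : ℝ) : ℂ) := (Complex.ofRealCLM.contDiff (n := ∞)).comp b.contDiff
  refine ⟨hs.toSchwartzMap hd, fun v hv => ?_⟩
  have : b v = 1 := b.one_of_mem_closedBall (mem_closedBall_zero_iff.2 (by rw [hb]; exact hv.le))
  simp [this]

/-- A tempered distribution that vanishes on all tensor products is zero. -/
theorem eq_zero_of_tensor (L : 𝓢(P × V, ℂ) →L[ℂ] ℂ) (hL : ∀ a b, L (tensor a b) = 0) : L = 0 := by
  obtain ⟨χ₁, h₁⟩ := exists_cutoff P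
  obtain ⟨χ₂, h₂⟩ := exists_cutoff V
  obtain ⟨m, C, hC, hm⟩ := exists_norm_le_supSeminorm L
  ext θ
  rw [zero_apply]
  set B := C * (2 ^ m * (1 + supSeminorm (P × V) m (tensor χ₁ χ₂)) *
    supSeminorm (P × V) (m + 1) θ) with hB
  -- A dilated product of cutoffs is again a product of cutoffs, so L annihilates the cut-off part
  -- of θ; the remainder is of order c.
  have key : ∀ c : ℝ, 0 < c → c ≤ 1 → ‖L θ‖ ≤ c * B := by
    intro c hc0 hc
    let u : ℝˣ := Units.mk0 c hc0.ne'
    have h3 : (dilate u (tensor χ₁ χ₂) : P × V → ℂ) = tensor (dilate u χ₁) (dilate u χ₂) := by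
      ext x
      simp
    have h4 := supSeminorm_sub_dilate_mul_le (tensor χ₁ χ₂) θ (fun v hv => by
      rw [tensor_apply, h₁ _ ((norm_fst_le v).trans_lt hv), h₂ _ ((norm_snd_le v).trans_lt hv),
        one_mul]) u hc0 hc m
    have h5 : L θ = L (θ - smulLeftCLM ℂ (dilate u (tensor χ₁ χ₂) : P × V → ℂ) θ) := by
      rw [map_sub, h3, tensor_mul_fourier_eq_zero L hL, sub_zero]
    rw [h5]
    refine (hm _).trans ((mul_le_mul_of_nonneg_left h4 hC).trans (le_of_eq ?_))
    rw [hB]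
    change C * (c * _) = _
    ring
  have hlim : Tendsto (fun c : ℝ => c * B) (𝓝[>] 0) (𝓝 0) := by
    have : Continuous fun c : ℝ => c * B := by fun_prop
    simpa using (this.tendsto 0).mono_left nhdsWithin_le_nhds
  refine norm_le_zero_iff.1 (ge_of_tendsto hlim ?_)
  filter_upwards [Ioc_mem_nhdsGT one_pos] with c hc
  exact key c hc.1 hc.2

end Density

end

section

open scoped ContDiff

/-! ### Integrals of bilinear maps along slices -/

theorem continuous_of_linear_of_bound {V : Type*} [NormedAddCommGroup V] [NormedSpace ℝ V]
    (T : 𝓢(V, ℂ) →ₗ[ℂ] ℂ) (m : ℕ) (C : ℝ) (hC : 0 ≤ C)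
    (h : ∀ f, ‖T f‖ ≤ C * supSeminorm V m f) : Continuous T := by
  apply WithSeminorms.continuous_normedSpace_rng ℂ (schwartz_withSeminorms ℂ V ℂ)
  exact ⟨Finset.Iic (m, m), ⟨C, hC⟩, h⟩

section SliceIntegral

variable {P V P' V' U : Type*}
  [NormedAddCommGroup P] [NormedSpace ℝ P] [NormedAddCommGroup V] [NormedSpace ℝ V]
  [NormedAddCommGroup P'] [NormedSpace ℝ P'] [NormedAddCommGroup V'] [NormedSpace ℝ V']
  [NormedAddCommGroup U] [NormedSpace ℝ U]
  {B : 𝓢(V, ℂ) →ₗ[ℂ] 𝓢(V', ℂ) →ₗ[ℂ] 𝓢(U, ℂ)}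
  (hB : Continuous fun p : 𝓢(V, ℂ) × 𝓢(V', ℂ) => B p.1 p.2) (τ : U →L[ℝ] P) (τ' : U →L[ℝ] P')

include hB

theorem continuous_bilin_slice (f : 𝓢(P × V, ℂ)) (g : 𝓢(P' × V', ℂ)) :
    Continuous fun x => B (slice (τ x) f) (slice (τ' x) g) x := by
  have h1 : Continuous fun x => B (slice (τ x) f) (slice (τ' x) g) :=
    hB.comp (((continuous_slice f).comp τ.continuous).prodMk
      ((continuous_slice g).comp τ'.continuous))
  -- Both the function and the point of evaluation vary with x; evaluation is jointly continuous on
  -- bounded continuous functions.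
  have h2 : Continuous fun x =>
      toBoundedContinuousFunctionCLM ℂ U ℂ (B (slice (τ x) f) (slice (τ' x) g)) :=
    (toBoundedContinuousFunctionCLM ℂ U ℂ).continuous.comp h1
  exact continuous_eval.comp (h2.prodMk continuous_id)

/-- The decay in x comes from the value of B, a Schwartz function that is evaluated at x itself; of
the slices only uniform bounds are needed. Hence τ and τ' may be arbitrary continuous linear maps.
-/
theorem exists_norm_bilin_slice_le (N : ℕ) : ∃ m C, 0 ≤ C ∧
    ∀ (f : 𝓢(P × V, ℂ)) (g : 𝓢(P' × V', ℂ)) (x : U),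
      ‖B (slice (τ x) f) (slice (τ' x) g) x‖ ≤ C * supSeminorm (P × V) m f *
        supSeminorm (P' × V') m g * (1 + ‖x‖) ^ (-(N : ℝ)) := by
  obtain ⟨m, C, hC, h⟩ := exists_bilin_supSeminorm_le B hB N
  refine ⟨m, 2 ^ N * (C * 2 ^ m * 2 ^ m), by positivity, fun f g x => ?_⟩
  rw [Real.rpow_neg (by positivity), Real.rpow_natCast, ← div_eq_mul_inv,
    le_div_iff₀' (by positivity)]
  refine (one_add_norm_pow_mul_apply_le _ N x).trans ?_
  calc _ ≤ 2 ^ N * (C * supSeminorm V m (slice (τ x) f) * supSeminorm V' m (slice (τ' x) g)) := by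
        gcongr
        exact h _ _
    _ ≤ 2 ^ N * (C * (2 ^ m * supSeminorm (P × V) m f) *
        (2 ^ m * supSeminorm (P' × V') m g)) := by
        gcongr
        · exact supSeminorm_slice_le _ _ _
        · exact supSeminorm_slice_le _ _ _
    _ = _ := by ring

variable [MeasurableSpace U] [BorelSpace U] (μ : Measure U)
  [μ.HasTemperateGrowth]

theorem integrable_bilin_slice (f : 𝓢(P × V, ℂ)) (g : 𝓢(P' × V', ℂ)) :
    Integrable (fun x => B (slice (τ x) f) (slice (τ' x) g) x) μ := by
  obtain ⟨m, C, hC, h⟩ := exists_norm_bilin_slice_le hB τ τ' μ.integrablePower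
  exact ((Measure.integrable_pow_neg_integrablePower μ).const_mul _).mono'
    (continuous_bilin_slice hB τ τ' f g).aestronglyMeasurable
    (Eventually.of_forall fun x => h f g x)

/-- The integral of a bilinear map along slices, `∫ B(f(τ x, ·), g(τ' x, ·))(x) dx`. -/
def sliceIntegral : 𝓢(P × V, ℂ) →ₗ[ℂ] 𝓢(P' × V', ℂ) →ₗ[ℂ] ℂ :=
  LinearMap.mk₂ ℂ (fun f g => ∫ x, B (slice (τ x) f) (slice (τ' x) g) x ∂μ)
    (fun f f' g => by
      simp only [map_add, LinearMap.add_apply, add_apply]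
      exact integral_add (integrable_bilin_slice hB τ τ' μ f g)
        (integrable_bilin_slice hB τ τ' μ f' g))
    (fun c f g => by
      simp only [map_smul, LinearMap.smul_apply, smul_apply]
      exact integral_smul c _)
    (fun f g g' => by
      simp only [map_add, add_apply]
      exact integral_add (integrable_bilin_slice hB τ τ' μ f g)
        (integrable_bilin_slice hB τ τ' μ f g'))
    (fun c f g => by
      simp only [map_smul, smul_apply]
      exact integral_smul c _)

theorem sliceIntegral_apply (f : 𝓢(P × V, ℂ)) (g : 𝓢(P' × V', ℂ)) :
    sliceIntegral hB τ τ' μ f g = ∫ x, B (slice (τ x) f) (slice (τ' x) g) x ∂μ := rfl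

theorem exists_norm_sliceIntegral_le : ∃ m C, 0 ≤ C ∧
    ∀ (f : 𝓢(P × V, ℂ)) (g : 𝓢(P' × V', ℂ)),
      ‖sliceIntegral hB τ τ' μ f g‖ ≤ C * supSeminorm (P × V) m f * supSeminorm (P' × V') m g := by
  obtain ⟨m, C, hC, h⟩ := exists_norm_bilin_slice_le hB τ τ' μ.integrablePower
  refine ⟨m, C * weightIntegral μ, mul_nonneg hC (weightIntegral_nonneg μ), fun f g => ?_⟩
  have h2 := norm_integral_le_of_norm_le
    ((Measure.integrable_pow_neg_integrablePower μ).const_mul (C * supSeminorm (P × V) m f *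
        supSeminorm (P' × V') m g)) (Eventually.of_forall fun x => h f g x)
  rw [integral_const_mul] at h2
  rw [sliceIntegral_apply]
  refine h2.trans (le_of_eq ?_)
  rw [weightIntegral]
  ring

theorem continuous_sliceIntegral_left (f : 𝓢(P × V, ℂ)) :
    Continuous (sliceIntegral hB τ τ' μ f) := by
  obtain ⟨m, C, hC, h⟩ := exists_norm_sliceIntegral_le hB τ τ' μ
  refine continuous_of_linear_of_bound _ m (C * supSeminorm (P × V) m f) (by positivity) fun g => ?_
  exact h f g

theorem continuous_sliceIntegral_right (g : 𝓢(P' × V', ℂ)) :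
    Continuous ((sliceIntegral hB τ τ' μ).flip g) := by
  obtain ⟨m, C, hC, h⟩ := exists_norm_sliceIntegral_le hB τ τ' μ
  refine continuous_of_linear_of_bound _ m (C * supSeminorm (P' × V') m g) (by positivity)
    fun f => ?_
  exact (h f g).trans (le_of_eq (by ring))

/-- A separately continuous bilinear form that agrees with an integral along slices on tensor
products agrees with it everywhere. -/
theorem integral_bilin_slice_eq [FiniteDimensional ℝ P] [FiniteDimensional ℝ V]
    [FiniteDimensional ℝ P'] [FiniteDimensional ℝ V']
    (R : 𝓢(P × V, ℂ) →ₗ[ℂ] 𝓢(P' × V', ℂ) →ₗ[ℂ] ℂ) (hR : ∀ f, Continuous (R f))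
    (hR' : ∀ g, Continuous (R.flip g))
    (h : ∀ f₁ f₂ g₁ g₂, ∫ x, f₁ (τ x) * g₁ (τ' x) * B f₂ g₂ x ∂μ =
      R (tensor f₁ f₂) (tensor g₁ g₂))
    (f : 𝓢(P × V, ℂ)) (g : 𝓢(P' × V', ℂ)) :
    ∫ x, B (slice (τ x) f) (slice (τ' x) g) x ∂μ = R f g := by
  have hs : ∀ (f₁ : 𝓢(P, ℂ)) (f₂ : 𝓢(V, ℂ)) (p : P), slice p (tensor f₁ f₂) = f₁ p • f₂ := by
    intro f₁ f₂ p
    ext v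
    simp
  have hs' : ∀ (f₁ : 𝓢(P', ℂ)) (f₂ : 𝓢(V', ℂ)) (p : P'), slice p (tensor f₁ f₂) = f₁ p • f₂ := by
    intro f₁ f₂ p
    ext v
    simp
  -- Totality of products is used in one argument at a time: first in g with f a product, then in f
  -- with g arbitrary. Separate continuity suffices for this.
  have h1 : ∀ f₁ f₂ g, sliceIntegral hB τ τ' μ (tensor f₁ f₂) g = R (tensor f₁ f₂) g := by
    intro f₁ f₂ g
    let L : 𝓢(P' × V', ℂ) →L[ℂ] ℂ :=
      ⟨sliceIntegral hB τ τ' μ (tensor f₁ f₂) - R (tensor f₁ f₂),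
        (continuous_sliceIntegral_left hB τ τ' μ _).sub (hR _)⟩
    have hL : L = 0 := eq_zero_of_tensor L fun g₁ g₂ => by
      change sliceIntegral hB τ τ' μ (tensor f₁ f₂) (tensor g₁ g₂) - R _ _ = 0
      rw [sliceIntegral_apply, sub_eq_zero, ← h]
      refine integral_congr_ae (Eventually.of_forall fun x => ?_)
      simp only [hs, hs', map_smul, LinearMap.smul_apply, smul_apply, smul_eq_mul]
      ring
    exact sub_eq_zero.1 (DFunLike.congr_fun hL g)
  let L : 𝓢(P × V, ℂ) →L[ℂ] ℂ :=
    ⟨(sliceIntegral hB τ τ' μ).flip g - R.flip g,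
      (continuous_sliceIntegral_right hB τ τ' μ _).sub (hR' _)⟩
  have hL : L = 0 := eq_zero_of_tensor L fun f₁ f₂ => sub_eq_zero.2 (h1 f₁ f₂ g)
  exact sub_eq_zero.1 (DFunLike.congr_fun hL f)

end SliceIntegral

/-! ### Configurations -/

/-- Pullback of Schwartz functions under a linear equivalence. -/
abbrev pull {V W : Type*} [NormedAddCommGroup V] [NormedSpace ℝ V] [NormedAddCommGroup W]
    [NormedSpace ℝ W] (e : V ≃L[ℝ] W) : 𝓢(W, ℂ) →L[ℂ] 𝓢(V, ℂ) :=
  compCLMOfContinuousLinearEquiv ℂ e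

/-- Totality of products for any linear splitting of the variables; for contractions, f and g are
split in different ways. -/
theorem eq_zero_of_pull_tensor {P V W : Type*} [NormedAddCommGroup P] [NormedSpace ℝ P]
    [FiniteDimensional ℝ P] [NormedAddCommGroup V] [NormedSpace ℝ V] [FiniteDimensional ℝ V]
    [NormedAddCommGroup W] [NormedSpace ℝ W] (e : (P × V) ≃L[ℝ] W) (L : 𝓢(W, ℂ) →L[ℂ] ℂ)
    (hL : ∀ a b, L (pull e.symm (tensor a b)) = 0) : L = 0 := by
  have h := eq_zero_of_tensor (L.comp (pull e.symm)) hL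
  ext f
  have := DFunLike.congr_fun h (pull e f)
  have e1 : pull e.symm (pull e f) = f := by
    ext x
    simp
  simpa [e1] using this

variable {d : ℕ}

/-- Insertion of a particle at position `β`. -/
def insertEquiv {b : ℕ} (β : Fin (b + 1)) : (E d × X d b) ≃L[ℝ] X d (b + 1) :=
  LinearEquiv.toContinuousLinearEquiv
    (LinearEquiv.symm
      { toFun := fun v => (v β, β.removeNth v)
        map_add' := fun _ _ => rfl
        map_smul' := fun _ _ => rfl
        invFun := fun z => β.insertNth z.1 z.2
        left_inv := fun v => Fin.insertNth_self_removeNth β v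
        right_inv := fun z => by simp })

@[simp]
theorem insertEquiv_apply {b : ℕ} (β : Fin (b + 1)) (z : E d × X d b) :
    insertEquiv β z = (β.insertNth z.1 z.2 : X d (b + 1)) := rfl

@[simp]
theorem insertEquiv_symm_apply {b : ℕ} (β : Fin (b + 1)) (v : X d (b + 1)) :
    (insertEquiv β).symm v = (v β, β.removeNth v) := rfl

/-- The equivalence given by `join`. -/
def joinEquiv {a b n : ℕ} (h : a + b = n) : (X d (a + 1) × X d b) ≃L[ℝ] X d (n + 1) :=
  LinearEquiv.toContinuousLinearEquiv
    (LinearEquiv.symm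
      { toFun := fun y => (fun i => y (Fin.cast (by omega) (Fin.castAdd b i)),
          fun j => y (Fin.cast (by omega) (Fin.natAdd (a + 1) j)))
        map_add' := fun _ _ => rfl
        map_smul' := fun _ _ => rfl
        invFun := fun z => join h z.1 z.2
        left_inv := fun y => by
          subst h
          funext i
          obtain ⟨i, rfl⟩ : ∃ i', i = Fin.cast (by omega) (i' : Fin (a + 1 + b)) :=
            ⟨Fin.cast (by omega) i, by simp⟩
          simp only [join, Fin.cast_cast, Fin.cast_eq_self]
          refine Fin.addCases (fun j => ?_) (fun j => ?_) i
          · rw [Fin.append_left]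
          · rw [Fin.append_right]
        right_inv := fun z => by
          ext i : 2
          · simp [join]
          · simp [join] })

@[simp]
theorem joinEquiv_apply {a b n : ℕ} (h : a + b = n) (z : X d (a + 1) × X d b) :
    joinEquiv h z = join h z.1 z.2 := rfl

/-- The configuration in which the particle `β` of the second group is put at position `α` of the
first group. -/
def moveEquiv {a b n : ℕ} (h : a + b = n) (α : Fin (a + 1)) (β : Fin (b + 1)) :
    (X d a × X d (b + 1)) ≃L[ℝ] X d (n + 1) :=
  ((ContinuousLinearEquiv.refl ℝ (X d a)).prodCongr (insertEquiv β).symm).trans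
    ((ContinuousLinearEquiv.prodAssoc ℝ (X d a) (E d) (X d b)).symm.trans
      ((((ContinuousLinearEquiv.prodComm ℝ (X d a) (E d)).trans (insertEquiv α)).prodCongr
        (ContinuousLinearEquiv.refl ℝ (X d b))).trans (joinEquiv h)))

@[simp]
theorem moveEquiv_apply {a b n : ℕ} (h : a + b = n) (α : Fin (a + 1)) (β : Fin (b + 1))
    (z : X d a × X d (b + 1)) :
    moveEquiv h α β z = join h (α.insertNth (z.2 β) z.1) (β.removeNth z.2) := rfl

/-- The function `v ↦ φ(v_β) G(v_1, …, v_{β-1}, v_{β+1}, …)`. -/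
def insertTensor {b : ℕ} (β : Fin (b + 1)) (φ : 𝓢(E d, ℂ)) (G : 𝓢(X d b, ℂ)) :
    𝓢(X d (b + 1), ℂ) :=
  pull (insertEquiv β).symm (tensor φ G)

@[simp]
theorem insertTensor_apply {b : ℕ} (β : Fin (b + 1)) (φ : 𝓢(E d, ℂ)) (G : 𝓢(X d b, ℂ))
    (v : X d (b + 1)) : insertTensor β φ G v = φ (v β) * G (β.removeNth v) := rfl

/-- Testing against compactly supported smooth functions gives equality almost everywhere, and
continuity upgrades it. -/
theorem eq_of_forall_integral_mul_eq {f g : E d → ℂ} (hf : Continuous f) (hg : Continuous g)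
    (h : ∀ φ : 𝓢(E d, ℂ), ∫ u, f u * φ u = ∫ u, g u * φ u) : f = g := by
  have h1 : f =ᵐ[volume] g := by
    refine ae_eq_of_integral_contDiff_smul_eq hf.locallyIntegrable hg.locallyIntegrable
      fun ψ hψ hs => ?_
    have hs' : HasCompactSupport fun v => ((ψ v : ℝ) : ℂ) :=
      hs.comp_left (g := fun r : ℝ => (r : ℂ)) Complex.ofReal_zero
    have hd : ContDiff ℝ ∞ fun v => ((ψ v : ℝ) : ℂ) :=
      (Complex.ofRealCLM.contDiff (n := ∞)).comp hψ
    have := h (hs'.toSchwartzMap hd)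
    simpa [mul_comm] using this
  exact (Continuous.ae_eq_iff_eq volume hf hg).1 h1

/-- The good mapping property in terms of Schwartz functions of one variable. -/
theorem GoodMapping.exists_bilin {b : ℕ} {K : Ker d b} (hK : GoodMapping K) (β : Fin (b + 1)) :
    ∃ B : 𝓢(X d (b + 1), ℂ) →ₗ[ℂ] 𝓢(X d b, ℂ) →ₗ[ℂ] 𝓢(E d, ℂ),
      Continuous (fun p : 𝓢(X d (b + 1), ℂ) × 𝓢(X d b, ℂ) => B p.1 p.2) ∧
      ∀ F G φ, K (tensor (insertTensor β φ G) F) = ∫ u, B F G u * φ u := by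
  obtain ⟨Φ, hΦ, h⟩ := hK β
  obtain ⟨χ, hχ⟩ := exists_cutoff (E d)
  have hχ0 : χ 0 = 1 := hχ 0 (by simp)
  -- `GoodMapping` takes a function g of all b + 1 variables and a parameter y in place of variable
  -- β. A function G of the remaining variables is fed in as g = χ ⊗ G at y = 0, where χ equals 1.
  let T : 𝓢(X d b, ℂ) →L[ℂ] 𝓢(X d (b + 1), ℂ) :=
    (pull (insertEquiv β).symm).comp (tensorLeft χ)
  let S : 𝓢(E d × E d, ℂ) →L[ℂ] 𝓢(E d, ℂ) :=
    (slice (0 : E d)).comp (pull (ContinuousLinearEquiv.prodComm ℝ (E d) (E d)))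
  refine ⟨(Φ.compl₂ T.toLinearMap).compr₂ S.toLinearMap, ?_, fun F G φ => ?_⟩
  · exact S.continuous.comp (hΦ.comp (continuous_fst.prodMk (T.continuous.comp continuous_snd)))
  · refine h F (T G) φ 0 _ fun v w => ?_
    have e : T G (Function.update v β 0) = G (β.removeNth v) := by
      change χ (Function.update v β 0 β) * G (β.removeNth (Function.update v β 0)) = _
      rw [Function.update_self, hχ0, one_mul, Fin.removeNth_update]
    rw [e, tensor_apply, insertTensor_apply]

end

section

open scoped LineDeriv

variable {d : ℕ}

/-! ### Symbols and contractions -/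

/-- The function `w ↦ f(x_1, …, w_β, …, x_{a+1}, w_1, …, w_{β-1}, w_{β+1}, …)`, with `w_β` at
position `α`. -/
def outSlice {a b n : ℕ} (h : a + b = n) (α : Fin (a + 1)) (β : Fin (b + 1))
    (f : 𝓢(X d (n + 1), ℂ)) (x : X d (a + 1)) : 𝓢(X d (b + 1), ℂ) :=
  slice (α.removeNth x) (pull (moveEquiv h α β) f)

/-- The function `z ↦ g(x', z)`. -/
def inSlice {a b n : ℕ} (h : a + b = n) (g : 𝓢(X d (n + 1), ℂ)) (x' : X d (a + 1)) :
    𝓢(X d b, ℂ) :=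
  slice x' (pull (joinEquiv h) g)

section Symbols

variable {a b n : ℕ} {h : a + b = n}

theorem outSlice_apply (α : Fin (a + 1)) (β : Fin (b + 1))
    (f : 𝓢(X d (n + 1), ℂ)) (x : X d (a + 1)) (w : X d (b + 1)) :
    outSlice h α β f x w = f (join h (Function.update x α (w β)) (β.removeNth w)) := by
  change f (moveEquiv h α β (α.removeNth x, w)) = _
  rw [moveEquiv_apply, Fin.insertNth_removeNth]

theorem inSlice_apply (g : 𝓢(X d (n + 1), ℂ)) (x' : X d (a + 1)) (z : X d b) :
    inSlice h g x' z = g (join h x' z) := rfl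

variable {B : Ker d b} {α : Fin (a + 1)} {β : Fin (b + 1)} {f g : 𝓢(X d (n + 1), ℂ)}

theorem isSymbol_iff {Φ : Density d a} : IsSymbol h B α β f g Φ ↔ ∀ φ x x',
    B (tensor (insertTensor β φ (inSlice h g x')) (outSlice h α β f x)) =
      ∫ u, Φ (Function.update x α u, x') * φ u := by
  constructor
  · intro hΦ φ x x'
    refine hΦ φ x x' _ fun v w => ?_
    rw [tensor_apply, insertTensor_apply, outSlice_apply, inSlice_apply]
  · intro hΦ φ x x' Θ hΘ
    rw [← hΦ]
    congr 1
    ext ⟨v, w⟩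
    rw [hΘ, tensor_apply, insertTensor_apply, outSlice_apply, inSlice_apply]

theorem continuous_update_apply (Φ : Density d a) (α : Fin (a + 1)) (x x' : X d (a + 1)) :
    Continuous fun u => Φ (Function.update x α u, x') :=
  Φ.continuous.comp (((continuous_const (y := x)).update α continuous_id).prodMk
    (continuous_const (y := x')))

theorem IsSymbol.unique {Φ Φ' : Density d a} (hΦ : IsSymbol h B α β f g Φ)
    (hΦ' : IsSymbol h B α β f g Φ') : Φ = Φ' := by
  ext ⟨x, x'⟩
  have key := eq_of_forall_integral_mul_eq (continuous_update_apply Φ α x x')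
    (continuous_update_apply Φ' α x x')
    fun φ => (isSymbol_iff.1 hΦ φ x x').symm.trans (isSymbol_iff.1 hΦ' φ x x')
  simpa using congrFun key (x α)

/-- Both sides are continuous in u and define the same distribution, so the symbol is given
pointwise by the bilinear map that represents B. -/
theorem IsSymbol.apply_update {Φ : Density d a} (hΦ : IsSymbol h B α β f g Φ)
    {T : 𝓢(X d (b + 1), ℂ) →ₗ[ℂ] 𝓢(X d b, ℂ) →ₗ[ℂ] 𝓢(E d, ℂ)}
    (hT : ∀ F G φ, B (tensor (insertTensor β φ G) F) = ∫ u, T F G u * φ u)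
    (x x' : X d (a + 1)) (u : E d) :
    Φ (Function.update x α u, x') = T (outSlice h α β f x) (inSlice h g x') u :=
  congrFun (eq_of_forall_integral_mul_eq (continuous_update_apply Φ α x x')
    (SchwartzMap.continuous _)
    fun φ => (isSymbol_iff.1 hΦ φ x x').symm.trans (hT _ _ _)) u

/-- The variables on which B does not act factor out, provided f is split along `moveEquiv` and g
along `joinEquiv`. Existence of symbols for such f and g is enough for uniqueness of contractions,
because products are total. -/
theorem isSymbol_tensor {T : 𝓢(X d (b + 1), ℂ) →ₗ[ℂ] 𝓢(X d b, ℂ) →ₗ[ℂ] 𝓢(E d, ℂ)}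
    (hT : ∀ F G φ, B (tensor (insertTensor β φ G) F) = ∫ u, T F G u * φ u)
    (f₁ : 𝓢(X d a, ℂ)) (f₂ : 𝓢(X d (b + 1), ℂ)) (g₁ : 𝓢(X d (a + 1), ℂ)) (g₂ : 𝓢(X d b, ℂ)) :
    IsSymbol h B α β (pull (moveEquiv h α β).symm (tensor f₁ f₂))
      (pull (joinEquiv h).symm (tensor g₁ g₂))
      (tensor (insertTensor α (T f₂ g₂) f₁) g₁) := by
  refine isSymbol_iff.2 fun φ x x' => ?_
  have e1 : outSlice h α β (pull (moveEquiv h α β).symm (tensor f₁ f₂)) x =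
      f₁ (α.removeNth x) • f₂ := by
    ext w
    simp only [outSlice, slice_apply, compCLMOfContinuousLinearEquiv_apply, Function.comp_apply,
      ContinuousLinearEquiv.symm_apply_apply, tensor_apply, smul_apply, smul_eq_mul]
  have e2 : inSlice h (pull (joinEquiv h).symm (tensor g₁ g₂)) x' = g₁ x' • g₂ := by
    ext w
    simp only [inSlice, slice_apply, compCLMOfContinuousLinearEquiv_apply, Function.comp_apply,
      ContinuousLinearEquiv.symm_apply_apply, tensor_apply, smul_apply, smul_eq_mul]
  rw [e1, e2, hT]
  refine integral_congr_ae (Eventually.of_forall fun u => ?_)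
  simp only [map_smul, LinearMap.smul_apply, smul_apply, smul_eq_mul, tensor_apply,
    insertTensor_apply, Function.update_self, Fin.removeNth_update]
  ring

/-- Two contractions agree whenever f and g are themselves products, since a symbol is known there.
Totality is then used three times: in f, in g, and for the products g ⊗ f among all kernels. -/
theorem IsContraction.unique (hB : GoodMapping B) {A : Ker d a} {C C' : Ker d n}
    (hC : IsContraction h A B α β C) (hC' : IsContraction h A B α β C') : C = C' := by
  obtain ⟨T, -, hT⟩ := hB.exists_bilin β
  rw [← sub_eq_zero]
  refine eq_zero_of_tensor _ fun g f => ?_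
  have h1 : ∀ g₁ g₂, (C - C') (tensor (pull (joinEquiv h).symm (tensor g₁ g₂)) f) = 0 := by
    intro g₁ g₂
    refine DFunLike.congr_fun (eq_zero_of_pull_tensor (moveEquiv h α β) ((C - C').comp
      (tensorLeft (pull (joinEquiv h).symm (tensor g₁ g₂)))) fun f₁ f₂ => ?_) f
    have hs := isSymbol_tensor (h := h) (α := α) hT f₁ f₂ g₁ g₂
    change C (tensor _ _) - C' (tensor _ _) = 0
    rw [hC _ _ _ hs _ fun x x' => tensor_apply _ _ _, hC' _ _ _ hs _ fun x x' => tensor_apply _ _ _,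
      sub_self]
  exact DFunLike.congr_fun (eq_zero_of_pull_tensor (joinEquiv h) ((C - C').comp
    (tensorRight f)) h1) g

theorem contraction_eq (hB : GoodMapping B) {A : Ker d a} {C : Ker d n}
    (hC : IsContraction h A B α β C) : contraction h A B α β = C := by
  have hex : ∃ C, IsContraction h A B α β C := ⟨C, hC⟩
  rw [contraction, dif_pos hex]
  exact hex.choose_spec.unique hB hC

theorem goodMapping_zero : GoodMapping (0 : Ker d b) := by
  intro α
  refine ⟨0, by simpa using continuous_const, fun f g φ y Θ _ => ?_⟩
  simp

theorem contraction_zero_left (hB : GoodMapping B) :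
    contraction h (0 : Ker d a) B α β = 0 :=
  contraction_eq hB fun _ _ _ _ _ _ => rfl

theorem contraction_zero_right (A : Ker d a) :
    contraction h A (0 : Ker d b) α β = 0 := by
  refine contraction_eq goodMapping_zero fun f g Φ hΦ Θ _ => ?_
  have : Φ = 0 := hΦ.unique (isSymbol_iff.2 fun φ x x' => by simp)
  simp [this]

theorem isContraction_of_isSymbol {A : Ker d a} (C : Ker d n)
    (Ψ : 𝓢(X d (n + 1), ℂ) → 𝓢(X d (n + 1), ℂ) → Density d a)
    (hΨ : ∀ f g, IsSymbol h B α β f g (Ψ f g))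
    (hA : ∀ f g, C (tensor g f) = A (transpose (Ψ f g))) : IsContraction h A B α β C := by
  intro f g Φ hΦ Θ hΘ
  rw [hΦ.unique (hΨ f g), ← hA]
  congr 1
  ext ⟨x, x'⟩
  rw [hΘ, tensor_apply]

end Symbols

/-! ### Directional Laplacians -/

/-- The Laplacian in the variable `y ∈ ℝ^d` of `y ↦ f(x + ι y)`, at `y = 0`. -/
def lapAlong {V : Type*} [NormedAddCommGroup V] [NormedSpace ℝ V] (ι : E d →L[ℝ] V) :
    𝓢(V, ℂ) →L[ℂ] 𝓢(V, ℂ) :=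
  ∑ i : Fin d, LineDeriv.lineDerivOpCLM ℂ 𝓢(V, ℂ) (ι (EuclideanSpace.single i 1)) ∘L
    LineDeriv.lineDerivOpCLM ℂ 𝓢(V, ℂ) (ι (EuclideanSpace.single i 1))

theorem lineDerivOp_lineDerivOp_apply {V : Type*} [NormedAddCommGroup V] [NormedSpace ℝ V]
    (f : 𝓢(V, ℂ)) (x m : V) :
    ∂_{m} (∂_{m} f) x = deriv (deriv fun t : ℝ => f (x + t • m)) 0 := by
  have h1 : (deriv fun t : ℝ => f (x + t • m)) = fun t : ℝ => (∂_{m} f) (x + t • m) := by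
    funext t
    rw [lineDerivOp_apply_eq_fderiv]
    have h2 : HasDerivAt (fun t : ℝ => x + t • m) m t := by
      simpa using ((hasDerivAt_id t).smul_const m).const_add x
    exact (f.differentiableAt.hasFDerivAt.comp_hasDerivAt t h2).deriv
  rw [h1, lineDerivOp_apply]
  rfl

theorem lapAlong_apply {V : Type*} [NormedAddCommGroup V] [NormedSpace ℝ V] (ι : E d →L[ℝ] V)
    (f : 𝓢(V, ℂ)) (x : V) : lapAlong ι f x =
      ∑ i, deriv (deriv fun t : ℝ => f (x + ι (t • EuclideanSpace.single i 1))) 0 := by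
  simp only [lapAlong, sum_apply, map_smul]
  exact Finset.sum_congr rfl fun i _ => lineDerivOp_lineDerivOp_apply _ _ _

/-- The Laplacian along ι at x only involves the values of f on x + range ι. Hence functions on
different spaces can be compared; c collects the factors that are not differentiated. -/
theorem lapAlong_apply_congr {V W : Type*} [NormedAddCommGroup V] [NormedSpace ℝ V]
    [NormedAddCommGroup W] [NormedSpace ℝ W] {ι : E d →L[ℝ] V} {ι' : E d →L[ℝ] W}
    {f : 𝓢(V, ℂ)} {g : 𝓢(W, ℂ)} {x : V} {x' : W} (c : ℂ)
    (h : ∀ y, f (x + ι y) = c * g (x' + ι' y)) : lapAlong ι f x = c * lapAlong ι' g x' := by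
  simp only [lapAlong_apply, Finset.mul_sum, h]
  refine Finset.sum_congr rfl fun i _ => ?_
  rw [← deriv_const_mul_field]
  congr 1
  funext t
  rw [← deriv_const_mul_field]

/-- Two integrations by parts, whose signs cancel. -/
theorem integral_lapAlong_mul {V : Type*} [NormedAddCommGroup V] [NormedSpace ℝ V]
    [FiniteDimensional ℝ V] [MeasurableSpace V] [BorelSpace V] (μ : Measure V)
    [μ.IsAddHaarMeasure] (ι : E d →L[ℝ] V) (f g : 𝓢(V, ℂ)) :
    ∫ x, lapAlong ι f x * g x ∂μ = ∫ x, f x * lapAlong ι g x ∂μ := by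
  have hint : ∀ f g : 𝓢(V, ℂ), Integrable (fun x => f x * g x) μ := fun f g =>
    (pairing (ContinuousLinearMap.mul ℂ ℂ) f g).integrable
  simp only [lapAlong, sum_apply, Finset.sum_mul, Finset.mul_sum]
  rw [integral_finsetSum _ fun i _ => hint _ _, integral_finsetSum _ fun i _ => hint _ _]
  refine Finset.sum_congr rfl fun i _ => ?_
  set m := ι (EuclideanSpace.single i 1)
  change ∫ x, ∂_{m} (∂_{m} f) x * g x ∂μ = ∫ x, f x * ∂_{m} (∂_{m} g) x ∂μ
  rw [integral_mul_lineDerivOp_right_eq_neg_left, ← neg_eq_iff_eq_neg,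
    ← integral_mul_lineDerivOp_right_eq_neg_left]

end

section

variable {d : ℕ}

/-! ### Contractions with diagonal operators -/

/-- The diagonal embedding `u ↦ (u, …, u)`. -/
def constConf (d m : ℕ) : E d →L[ℝ] X d m :=
  ContinuousLinearMap.pi fun _ => ContinuousLinearMap.id ℝ (E d)

@[simp]
theorem constConf_apply {m : ℕ} (u : E d) : constConf d m u = fun _ => u := rfl

/-- The linear map `(v; w) ↦ (v_β, …, v_β, v_1, …; v_β, …, w_β, …, v_β, w_1, …)`, where the
variables `v_β` and `w_β` are omitted from the last groups and `w_β` stands at position `α`. -/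
def swapMap {a b n : ℕ} (h : a + b = n) (α : Fin (a + 1)) (β : Fin (b + 1)) :
    (X d (b + 1) × X d (b + 1)) →L[ℝ] X d (n + 1) × X d (n + 1) :=
  let v : (X d (b + 1) × X d (b + 1)) →L[ℝ] E d × X d b :=
    ((insertEquiv (d := d) β).symm : X d (b + 1) →L[ℝ] E d × X d b).comp
      (ContinuousLinearMap.fst ℝ (X d (b + 1)) (X d (b + 1)))
  let w : (X d (b + 1) × X d (b + 1)) →L[ℝ] X d (b + 1) :=
    ContinuousLinearMap.snd ℝ (X d (b + 1)) (X d (b + 1))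
  ((joinEquiv (d := d) h : (X d (a + 1) × X d b) →L[ℝ] X d (n + 1)).comp
    (((constConf d (a + 1)).comp ((ContinuousLinearMap.fst ℝ (E d) (X d b)).comp v)).prod
      ((ContinuousLinearMap.snd ℝ (E d) (X d b)).comp v))).prod
  ((moveEquiv (d := d) h α β : (X d a × X d (b + 1)) →L[ℝ] X d (n + 1)).comp
    (((constConf d a).comp ((ContinuousLinearMap.fst ℝ (E d) (X d b)).comp v)).prod w))

theorem swapMap_apply {a b n : ℕ} (h : a + b = n) (α : Fin (a + 1)) (β : Fin (b + 1))
    (v w : X d (b + 1)) : swapMap h α β (v, w) =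
      (joinEquiv h (fun _ => v β, β.removeNth v), moveEquiv h α β (fun _ => v β, w)) := rfl

theorem exists_antilipschitz {V W : Type*} [NormedAddCommGroup V] [NormedSpace ℝ V]
    [FiniteDimensional ℝ V] [NormedAddCommGroup W] [NormedSpace ℝ W] (T : V →L[ℝ] W)
    (hT : Function.Injective T) : ∃ K, AntilipschitzWith K T := by
  obtain ⟨K, -, h⟩ := (T : V →ₗ[ℝ] W).exists_antilipschitzWith (LinearMap.ker_eq_bot.2 hT)
  exact ⟨K, h⟩

/-- Pullback of Schwartz functions under an injective linear map. -/
def restrict {V W : Type*} [NormedAddCommGroup V] [NormedSpace ℝ V]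
    [FiniteDimensional ℝ V] [NormedAddCommGroup W] [NormedSpace ℝ W] (T : V →L[ℝ] W)
    (hT : Function.Injective T) : 𝓢(W, ℂ) →L[ℂ] 𝓢(V, ℂ) :=
  compCLMOfAntilipschitz ℂ T.hasTemperateGrowth (exists_antilipschitz T hT).choose_spec

@[simp]
theorem restrict_apply {V W : Type*} [NormedAddCommGroup V] [NormedSpace ℝ V]
    [FiniteDimensional ℝ V] [NormedAddCommGroup W] [NormedSpace ℝ W] (T : V →L[ℝ] W)
    (hT : Function.Injective T) (f : 𝓢(W, ℂ)) (v : V) : restrict T hT f v = f (T v) := rfl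

theorem swapMap_injective {a b n : ℕ} (h : a + b = n) (α : Fin (a + 1)) (β : Fin (b + 1)) :
    Function.Injective (swapMap (d := d) h α β) := by
  rintro ⟨v, w⟩ ⟨v', w'⟩ hv
  rw [swapMap_apply, swapMap_apply, Prod.mk.injEq] at hv
  have h1 := (joinEquiv h).injective hv.1
  have h2 := (moveEquiv h α β).injective hv.2
  rw [Prod.mk.injEq] at h1 h2
  have h3 : (insertEquiv β).symm v = (insertEquiv β).symm v' := by
    rw [insertEquiv_symm_apply, insertEquiv_symm_apply, Prod.mk.injEq]
    exact ⟨congrFun h1.1 0, h1.2⟩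
  rw [(insertEquiv β).symm.injective h3, h2.2]

/-- Pullback under `swapMap`. -/
def swapDensity {a b n : ℕ} (h : a + b = n) (α : Fin (a + 1)) (β : Fin (b + 1)) :
    Density d n →L[ℂ] Density d b :=
  restrict (swapMap h α β) (swapMap_injective h α β)

theorem continuous_tensor_right {V W : Type*} [NormedAddCommGroup V] [NormedSpace ℝ V]
    [NormedAddCommGroup W] [NormedSpace ℝ W] (a : 𝓢(V, ℂ)) :
    Continuous fun b : 𝓢(W, ℂ) => tensor a b :=
  (tensorLeft a).continuous

theorem continuous_tensor_left {V W : Type*} [NormedAddCommGroup V] [NormedSpace ℝ V]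
    [NormedAddCommGroup W] [NormedSpace ℝ W] (b : 𝓢(W, ℂ)) :
    Continuous fun a : 𝓢(V, ℂ) => tensor a b :=
  (tensorRight b).continuous

/-- For a = 0 the first component carries no information; the second always contains u. Injectivity
keeps the restriction of f₁ ⊗ g₁ to this diagonal a Schwartz function. -/
theorem diagPair_injective (a : ℕ) :
    Function.Injective ((constConf d a).prod (constConf d (a + 1))) := by
  intro u u' hu
  exact congrFun (Prod.mk.inj hu).2 0

/-- The contraction of an operator `A` with a differential operator on the diagonal, where `A` has
the good mapping property and acts first. -/
theorem isContraction_diagonal {a b n : ℕ} (h : a + b = n) {A' : Ker d a} {A : Ker d b}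
    (hA : GoodMapping A) (α : Fin (a + 1)) (β : Fin (b + 1))
    (D : 𝓢(E d, ℂ) →L[ℂ] 𝓢(E d, ℂ)) (D' : Density d b →L[ℂ] Density d b)
    (hD : ∀ φ ψ, ∫ u, D φ u * ψ u = ∫ u, φ u * D ψ u)
    (hD' : ∀ φ G F, D' (tensor (insertTensor β φ G) F) = tensor (insertTensor β (D φ) G) F)
    (hA' : ∀ (Φ : Density d a) (s : E d → 𝓢(E d, ℂ)),
      (∀ u y, s u y = Φ (Function.update (fun _ => u) α y, fun _ => u)) →
      A' (transpose Φ) = ∫ u, D (s u) u) :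
    IsContraction h A' A α β (A.comp (D'.comp (swapDensity h α β))) := by
  intro f g Φ hΦ Θ hΘ
  obtain ⟨T, hTc, hT⟩ := hA.exists_bilin β
  rw [hA' Φ (fun u => T (outSlice h α β f fun _ => u) (inSlice h g fun _ => u))
    fun u y => (hΦ.apply_update hT _ _ _).symm]
  let R : 𝓢(X d a × X d (b + 1), ℂ) →ₗ[ℂ] 𝓢(X d (a + 1) × X d b, ℂ) →ₗ[ℂ] ℂ :=
    LinearMap.compr₂ (((tensor (V := X d (n + 1)) (W := X d (n + 1))).compl₁₂
      (pull (joinEquiv (d := d) h).symm).toLinearMap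
      (pull (moveEquiv (d := d) h α β).symm).toLinearMap).flip)
      (A.comp (D'.comp (swapDensity h α β))).toLinearMap
  have hR : ∀ f g, R f g = A (D' (swapDensity h α β
    (tensor (pull (joinEquiv h).symm g) (pull (moveEquiv h α β).symm f)))) := fun _ _ => rfl
  -- By the good mapping property of A, the value of A' on the symbol is an integral along slices of
  -- the bilinear map D ∘ T. It therefore has to be compared with the claimed kernel only on
  -- products.
  have key := integral_bilin_slice_eq (B := T.compr₂ D.toLinearMap) (D.continuous.comp hTc)
    (constConf d a) (constConf d (a + 1)) volume R
    (fun f => (A.comp (D'.comp (swapDensity h α β))).continuous.comp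
      ((continuous_tensor_left _).comp (pull (joinEquiv h).symm).continuous))
    (fun g => (A.comp (D'.comp (swapDensity h α β))).continuous.comp
      ((continuous_tensor_right _).comp (pull (moveEquiv h α β).symm).continuous))
    (fun f₁ f₂ g₁ g₂ => ?_) (pull (moveEquiv h α β) f) (pull (joinEquiv h) g)
  · have e1 : pull (joinEquiv h).symm (pull (joinEquiv h) g) = g := by
      ext x
      simp only [compCLMOfContinuousLinearEquiv_apply, Function.comp_apply,
        ContinuousLinearEquiv.apply_symm_apply]
    have e2 : pull (moveEquiv h α β).symm (pull (moveEquiv h α β) f) = f := by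
      ext x
      simp only [compCLMOfContinuousLinearEquiv_apply, Function.comp_apply,
        ContinuousLinearEquiv.apply_symm_apply]
    rw [hR, e1, e2] at key
    have e3 : Θ = tensor g f := by
      ext ⟨x, x'⟩
      rw [hΘ, tensor_apply]
    rw [e3]
    exact key.symm
  · let p : 𝓢(E d, ℂ) := restrict _ (diagPair_injective a) (tensor f₁ g₁)
    have e1 : swapDensity h α β (tensor (pull (joinEquiv h).symm (tensor g₁ g₂))
        (pull (moveEquiv h α β).symm (tensor f₁ f₂))) =
        tensor (insertTensor β p g₂) f₂ := by
      ext ⟨v, w⟩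
      simp only [swapDensity, restrict_apply, swapMap_apply, tensor_apply, insertTensor_apply,
        compCLMOfContinuousLinearEquiv_apply, Function.comp_apply,
        ContinuousLinearEquiv.symm_apply_apply, p, ContinuousLinearMap.prod_apply,
        constConf_apply]
      ring
    rw [hR, e1, hD', hT, ← hD]
    exact integral_congr_ae (Eventually.of_forall fun u => mul_comm _ _)

/-! ### The Laplacian and the collision operator on kernels -/

/-- Differentiation of kernels in the variable `x_α`. -/
def leftDir {n : ℕ} (α : Fin (n + 1)) : E d →L[ℝ] X d (n + 1) × X d (n + 1) :=
  (ContinuousLinearMap.single ℝ (fun _ => E d) α).prod 0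

/-- Differentiation of kernels in the variable `x'_α`. -/
def rightDir {n : ℕ} (α : Fin (n + 1)) : E d →L[ℝ] X d (n + 1) × X d (n + 1) :=
  (0 : E d →L[ℝ] X d (n + 1)).prod (ContinuousLinearMap.single ℝ (fun _ => E d) α)

theorem add_single_eq_update {n : ℕ} (x : X d (n + 1)) (α : Fin (n + 1)) (y : E d) :
    x + Pi.single α y = Function.update x α (x α + y) := by
  funext i
  rcases eq_or_ne i α with rfl | hi
  · simp
  · simp [hi]

theorem add_leftDir {n : ℕ} (x x' : X d (n + 1)) (α : Fin (n + 1)) (y : E d) :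
    (x, x') + leftDir α y = (Function.update x α (x α + y), x') := by
  rw [← add_single_eq_update]
  exact Prod.ext rfl (add_zero x')

theorem add_rightDir {n : ℕ} (x x' : X d (n + 1)) (α : Fin (n + 1)) (y : E d) :
    (x, x') + rightDir α y = (x, Function.update x' α (x' α + y)) := by
  rw [← add_single_eq_update]
  exact Prod.ext (add_zero x) rfl

theorem lapAlong_transpose {n : ℕ} (γ : Density d n) (α : Fin (n + 1)) :
    lapAlong (rightDir α) (transpose γ) = transpose (lapAlong (leftDir α) γ) := by
  ext ⟨x, x'⟩
  change lapAlong _ _ _ = lapAlong (leftDir α) γ (x', x)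
  rw [← one_mul (lapAlong (leftDir α) γ (x', x))]
  refine lapAlong_apply_congr 1 fun y => ?_
  rw [add_rightDir, add_leftDir, one_mul]
  rfl

theorem lapAlong_transpose' {n : ℕ} (γ : Density d n) (α : Fin (n + 1)) :
    lapAlong (leftDir α) (transpose γ) = transpose (lapAlong (rightDir α) γ) := by
  ext ⟨x, x'⟩
  change lapAlong _ _ _ = lapAlong (rightDir α) γ (x', x)
  rw [← one_mul (lapAlong (rightDir α) γ (x', x))]
  refine lapAlong_apply_congr 1 fun y => ?_
  rw [add_rightDir, add_leftDir, one_mul]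
  rfl

/-- The linear map `x ↦ (x_1, …, x_{n+1}, e x)`. -/
def snocMap {V : Type*} [NormedAddCommGroup V] [NormedSpace ℝ V] {n : ℕ}
    (p : V →L[ℝ] X d (n + 1)) (e : V →L[ℝ] E d) : V →L[ℝ] X d (n + 2) :=
  ContinuousLinearMap.pi (Fin.snoc (α := fun _ => V →L[ℝ] E d)
    (fun i => (ContinuousLinearMap.proj i).comp p) e)

theorem snocMap_apply {V : Type*} [NormedAddCommGroup V] [NormedSpace ℝ V] {n : ℕ}
    (p : V →L[ℝ] X d (n + 1)) (e : V →L[ℝ] E d) (v : V) :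
    snocMap p e v = (Fin.snoc (p v) (e v) : X d (n + 2)) := by
  funext i
  refine Fin.lastCases ?_ (fun j => ?_) i
  · simp [snocMap]
  · simp [snocMap]

/-- The linear map `(x; x') ↦ (x, e; x', e)`, where `e` is a linear function of `(x; x')`. -/
def collMap {n : ℕ} (e : X d (n + 1) × X d (n + 1) →L[ℝ] E d) :
    X d (n + 1) × X d (n + 1) →L[ℝ] X d (n + 2) × X d (n + 2) :=
  (snocMap (ContinuousLinearMap.fst ℝ _ _) e).prod (snocMap (ContinuousLinearMap.snd ℝ _ _) e)

theorem collMap_apply {n : ℕ} (e : X d (n + 1) × X d (n + 1) →L[ℝ] E d) (x x' : X d (n + 1)) :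
    collMap e (x, x') = ((Fin.snoc x (e (x, x')) : X d (n + 2)),
      (Fin.snoc x' (e (x, x')) : X d (n + 2))) :=
  Prod.ext (snocMap_apply _ _ _) (snocMap_apply _ _ _)

theorem collMap_injective {n : ℕ} (e : X d (n + 1) × X d (n + 1) →L[ℝ] E d) :
    Function.Injective (collMap e) := by
  rintro ⟨x, x'⟩ ⟨y, y'⟩ h
  rw [collMap_apply, collMap_apply, Prod.mk.injEq] at h
  rw [(Fin.snoc_inj.1 h.1).1, (Fin.snoc_inj.1 h.2).1]

/-- The variable `x_α`. -/
def leftVar {n : ℕ} (α : Fin (n + 1)) : X d (n + 1) × X d (n + 1) →L[ℝ] E d :=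
  (ContinuousLinearMap.proj α).comp (ContinuousLinearMap.fst ℝ _ _)

/-- The variable `x'_α`. -/
def rightVar {n : ℕ} (α : Fin (n + 1)) : X d (n + 1) × X d (n + 1) →L[ℝ] E d :=
  (ContinuousLinearMap.proj α).comp (ContinuousLinearMap.snd ℝ _ _)

/-- The map `γ ↦ γ(x, e; x', e)`. -/
def coll {n : ℕ} (e : X d (n + 1) × X d (n + 1) →L[ℝ] E d) :
    Density d (n + 1) →L[ℂ] Density d n :=
  restrict (collMap e) (collMap_injective e)

theorem coll_apply {n : ℕ} (e : X d (n + 1) × X d (n + 1) →L[ℝ] E d) (γ : Density d (n + 1))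
    (x x' : X d (n + 1)) : coll e γ (x, x') = γ ((Fin.snoc x (e (x, x')) : X d (n + 2)),
      (Fin.snoc x' (e (x, x')) : X d (n + 2))) := by
  rw [coll, restrict_apply, collMap_apply]

theorem coll_transpose {n : ℕ} (γ : Density d (n + 1)) (α : Fin (n + 1)) :
    coll (rightVar α) (transpose γ) = transpose (coll (leftVar α) γ) := by
  ext ⟨x, x'⟩
  change _ = coll (leftVar α) γ (x', x)
  rw [coll_apply, coll_apply]
  rfl

end

section

variable {d : ℕ}

/-! ### The good mapping property of the Gross–Pitaevskii generator -/

theorem constConf_injective (m : ℕ) : Function.Injective (constConf d (m + 1)) :=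
  fun _ _ h => congrFun h 0

/-- The direction of differentiation of the variable `x'` of a one-particle kernel. -/
def inputMap (d : ℕ) : E d →L[ℝ] X d (0 + 1) × X d (0 + 1) :=
  (0 : E d →L[ℝ] X d (0 + 1)).prod (constConf d (0 + 1))

theorem diagIntegral_apply {n : ℕ} (Θ : Density d n) :
    diagIntegral d n Θ = ∫ u, Θ (fun _ => u, fun _ => u) := rfl

theorem negLaplacian_apply (Θ : Density d 0) :
    negLaplacian d Θ = - ∫ u, lapAlong (inputMap d) Θ (fun _ => u, fun _ => u) := by
  rw [← diagIntegral_apply, lapAlong, negLaplacian]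
  simp only [neg_apply, sum_apply, map_sum]
  rfl

theorem delta_apply (Θ : Density d 1) : delta d Θ = ∫ u, Θ (fun _ => u, fun _ => u) := rfl

theorem update_fin_one (v : X d (0 + 1)) (α : Fin (0 + 1)) (y : E d) :
    Function.update v α y = fun _ => y := by
  funext i
  rw [show i = α by omega, Function.update_self]

/-- There are no other particles to integrate over: the function of (u, y) is the product −(Δf)(u)
g(y). -/
theorem goodMapping_negLaplacian : GoodMapping (negLaplacian d) := by
  intro α
  let S : 𝓢(X d (0 + 1), ℂ) →L[ℂ] 𝓢(E d, ℂ) := restrict _ (constConf_injective 0)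
  let T : 𝓢(X d (0 + 1), ℂ) →L[ℂ] 𝓢(E d, ℂ) := -(S.comp (lapAlong (constConf d (0 + 1))))
  refine ⟨tensor.compl₁₂ T.toLinearMap S.toLinearMap, ?_, fun f g φ y Θ hΘ => ?_⟩
  · exact continuous_tensor.comp ((T.continuous.comp continuous_fst).prodMk
      (S.continuous.comp continuous_snd))
  · rw [negLaplacian_apply, ← integral_neg]
    refine integral_congr_ae (Eventually.of_forall fun u => ?_)
    change _ = (-lapAlong (constConf d (0 + 1)) f (fun _ => u)) * g (fun _ => y) * φ u
    dsimp only
    rw [lapAlong_apply_congr (ι' := constConf d (0 + 1)) (g := f) (x' := fun _ => u)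
      (φ u * g fun _ => y)]
    · ring
    · intro z
      have e : ((fun _ => u, fun _ => u) : X d (0 + 1) × X d (0 + 1)) + inputMap d z =
          (fun _ => u, (fun _ => u) + constConf d (0 + 1) z) := Prod.ext (add_zero _) rfl
      rw [e, hΘ, update_fin_one]

/-- The linear map `(u, y) ↦ ((u, …, y, …, u), (u, …, u))`, with `y` at position `α`. -/
def exchangeMap {n : ℕ} (α : Fin (n + 1)) : (E d × E d) →L[ℝ] X d (n + 1) × X d (n + 1) :=
  (ContinuousLinearMap.pi fun i => if i = α then ContinuousLinearMap.snd ℝ (E d) (E d) else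
    ContinuousLinearMap.fst ℝ (E d) (E d)).prod
    ((constConf d (n + 1)).comp (ContinuousLinearMap.fst ℝ (E d) (E d)))

theorem exchangeMap_apply {n : ℕ} (α : Fin (n + 1)) (u y : E d) :
    exchangeMap α (u, y) = (Function.update (fun _ => u) α y, fun _ => u) := by
  refine Prod.ext ?_ rfl
  funext i
  rcases eq_or_ne i α with rfl | hi
  · simp [exchangeMap]
  · simp [exchangeMap, hi]

theorem exchangeMap_injective {n : ℕ} (α : Fin (n + 1)) :
    Function.Injective (exchangeMap (d := d) α) := by
  rintro ⟨u, y⟩ ⟨u', y'⟩ h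
  rw [exchangeMap_apply, exchangeMap_apply, Prod.mk.injEq] at h
  have h1 := congrFun h.1 α
  rw [Function.update_self, Function.update_self] at h1
  rw [h1, congrFun h.2 0]

/-- The delta function removes the remaining integral and leaves f(u, u) times g with y at position
α and u at the other one, the restriction of g ⊗ f along an injective linear map. -/
theorem goodMapping_delta : GoodMapping (delta d) := by
  intro α
  let S : Density d 1 →L[ℂ] 𝓢(E d × E d, ℂ) := restrict _ (exchangeMap_injective α)
  refine ⟨(LinearMap.flip tensor).compr₂ S.toLinearMap, ?_, fun f g φ y Θ hΘ => ?_⟩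
  · exact S.continuous.comp (continuous_tensor.comp (continuous_snd.prodMk continuous_fst))
  · rw [delta_apply]
    refine integral_congr_ae (Eventually.of_forall fun u => ?_)
    change _ = tensor g f (exchangeMap α (u, y)) * φ u
    dsimp only
    rw [hΘ, exchangeMap_apply, tensor_apply]
    ring

theorem GoodMapping.smul {n : ℕ} {K : Ker d n} (hK : GoodMapping K) (c : ℂ) :
    GoodMapping (c • K) := by
  intro α
  obtain ⟨Φ, hΦ, h⟩ := hK α
  refine ⟨c • Φ, hΦ.const_smul c, fun f g φ y Θ hΘ => ?_⟩
  change c • K Θ = _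
  rw [h f g φ y Θ hΘ, ← integral_smul]
  refine integral_congr_ae (Eventually.of_forall fun u => ?_)
  simp [mul_assoc]

theorem GoodMapping.add {n : ℕ} {K K' : Ker d n} (hK : GoodMapping K) (hK' : GoodMapping K') :
    GoodMapping (K + K') := by
  intro α
  obtain ⟨Φ, hΦ, h⟩ := hK α
  obtain ⟨Φ', hΦ', h'⟩ := hK' α
  refine ⟨Φ + Φ', hΦ.add hΦ', fun f g φ y Θ hΘ => ?_⟩
  have hint : ∀ F : 𝓢(E d × E d, ℂ), Integrable (fun u => F (u, y) * φ u) := fun F =>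
    (pairing (ContinuousLinearMap.mul ℂ ℂ)
      (slice y (pull (ContinuousLinearEquiv.prodComm ℝ (E d) (E d)) F)) φ).integrable
  change K Θ + K' Θ = _
  rw [h f g φ y Θ hΘ, h' f g φ y Θ hΘ, ← integral_add (hint _) (hint _)]
  refine integral_congr_ae (Eventually.of_forall fun u => ?_)
  simp [add_mul]

/-! ### Contractions with the Gross–Pitaevskii generator -/

theorem join_zero_right {a : ℕ} (h : a + 0 = a) (x : X d (a + 1)) (z : X d 0) :
    join h x z = x := by
  funext i
  exact Fin.append_left x z i

theorem join_one_right {a : ℕ} (h : a + 1 = a + 1) (x : X d (a + 1)) (z : X d 1) :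
    join h x z = (Fin.snoc x (z 0) : X d (a + 2)) := by
  have := Fin.append_right_eq_snoc x z
  exact this

theorem join_zero_left {b : ℕ} (h : 0 + b = b) (x : X d (0 + 1)) (z : X d b) :
    join h x z = (Fin.cons (x 0) z : X d (b + 1)) := by
  funext i
  simp only [join]
  rw [Fin.append_left_eq_cons]
  rfl

theorem join_one_left {b : ℕ} (h : 1 + b = b + 1) (x : X d (1 + 1)) (z : X d b) :
    join h x z = (Fin.cons (x 0) (Fin.cons (x 1) z : X d (b + 1)) : X d (b + 2)) := by
  funext i
  refine Fin.cases ?_ (fun i => Fin.cases ?_ (fun j => ?_) i) i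
  · exact Fin.append_left x z 0
  · exact Fin.append_left x z 1
  · simp only [join, Fin.cons_succ]
    rw [← Fin.append_right x z j]
    congr 1
    ext
    simp
    omega

/-- Here −Δ acts on f before A. With b = 0 there is no variable z, so the symbol is −cΔ in x_α
applied to f(x) g(x'); the transposition in the pairing moves the derivative to x'_α. -/
theorem contraction_smul_negLaplacian {a : ℕ} (h : a + 0 = a) (A : Ker d a) (c : ℂ)
    (α : Fin (a + 1)) (β : Fin (0 + 1)) :
    contraction h A (c • negLaplacian d) α β = -(c • A.comp (lapAlong (rightDir α))) := by
  refine contraction_eq (goodMapping_negLaplacian.smul c) (isContraction_of_isSymbol _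
    (fun f g => -(c • lapAlong (leftDir α) (tensor f g))) (fun f g => ?_) fun f g => ?_)
  · refine isSymbol_iff.2 fun φ x x' => ?_
    change c • negLaplacian d _ = _
    rw [negLaplacian_apply, ← integral_neg, ← integral_smul]
    refine integral_congr_ae (Eventually.of_forall fun u => ?_)
    change c * (-lapAlong (inputMap d) _ _) =
      -(c * lapAlong (leftDir α) (tensor f g) (Function.update x α u, x')) * φ u
    rw [lapAlong_apply_congr (ι' := leftDir α) (g := tensor f g)
      (x' := (Function.update x α u, x')) (φ u)]
    · ring
    · intro z
      have e : ((fun _ => u, fun _ => u) : X d (0 + 1) × X d (0 + 1)) + inputMap d z =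
          (fun _ => u, fun _ => u + z) := Prod.ext (add_zero _) rfl
      rw [e, add_leftDir, tensor_apply, tensor_apply, insertTensor_apply, inSlice_apply,
        outSlice_apply, join_zero_right, join_zero_right, Function.update_self,
        Function.update_idem]
      ring
  · have e : tensor g f = transpose (tensor f g) := by
      ext ⟨x, x'⟩
      change g x * f x' = f x' * g x
      ring
    change -(c • A (lapAlong (rightDir α) (tensor g f))) = _
    rw [e, lapAlong_transpose, map_neg, map_smul, map_neg, map_smul]

/-- The delta function sets z = x_α, so the symbol is c f(x, x_α) g(x', x_α). It does not depend on
β, because both particles of δ sit at the same point. -/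
theorem contraction_smul_delta {a : ℕ} (h : a + 1 = a + 1) (A : Ker d a) (c : ℂ)
    (α : Fin (a + 1)) (β : Fin (1 + 1)) :
    contraction h A (c • delta d) α β = c • A.comp (coll (rightVar α)) := by
  refine contraction_eq (goodMapping_delta.smul c) (isContraction_of_isSymbol _
    (fun f g => c • coll (leftVar α) (tensor f g)) (fun f g => ?_) fun f g => ?_)
  · refine isSymbol_iff.2 fun φ x x' => ?_
    change c • delta d _ = _
    rw [delta_apply, ← integral_smul]
    refine integral_congr_ae (Eventually.of_forall fun u => ?_)
    change c * tensor _ _ _ = c * coll (leftVar α) (tensor f g) (Function.update x α u, x') * φ u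
    rw [coll_apply, tensor_apply, tensor_apply, insertTensor_apply, inSlice_apply, outSlice_apply,
      join_one_right, join_one_right]
    have e : leftVar α (Function.update x α u, x') = u :=
      Function.update_self (β := fun _ => E d) α u x
    rw [e]
    simp only [Fin.removeNth]
    ring
  · have e : tensor g f = transpose (tensor f g) := by
      ext ⟨x, x'⟩
      change g x * f x' = f x' * g x
      ring
    change c • A (coll (rightVar α) (tensor g f)) = _
    rw [e, coll_transpose, map_smul, map_smul]

/-- Now −Δ acts after A, on a function known only through T. Integration by parts moves it to the
test variable v_β of A, hence the derivative along `leftDir β`. -/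
theorem smul_negLaplacian_contraction {b : ℕ} (h : 0 + b = b) {A : Ker d b} (hA : GoodMapping A)
    (c : ℂ) (α : Fin (0 + 1)) (β : Fin (b + 1)) :
    contraction h (c • negLaplacian d) A α β =
      A.comp ((-(c • lapAlong (leftDir β))).comp (swapDensity h α β)) := by
  refine contraction_eq hA (isContraction_diagonal h hA α β
    (-(c • lapAlong (ContinuousLinearMap.id ℝ (E d)))) _ (fun φ ψ => ?_) (fun φ G F => ?_)
    fun Φ s hs => ?_)
  · have e := integral_lapAlong_mul volume (ContinuousLinearMap.id ℝ (E d)) φ ψ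
    simp only [neg_apply, smul_apply, smul_eq_mul, neg_mul, mul_neg, integral_neg]
    simp only [mul_assoc, mul_left_comm _ c, integral_const_mul, e]
  · ext ⟨v, w⟩
    change -(c * lapAlong (leftDir β) _ (v, w)) = -(c * lapAlong _ φ (v β)) * G (β.removeNth v) * F w
    rw [lapAlong_apply_congr (ι' := ContinuousLinearMap.id ℝ (E d)) (g := φ) (x' := v β)
      (G (β.removeNth v) * F w)]
    · ring
    · intro y
      rw [add_leftDir, tensor_apply, insertTensor_apply]
      dsimp only
      rw [Function.update_self, Fin.removeNth_update]
      change _ = _ * φ (v β + y)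
      ring
  · change c • negLaplacian d _ = _
    rw [negLaplacian_apply, ← integral_neg, ← integral_smul]
    refine integral_congr_ae (Eventually.of_forall fun u => ?_)
    change c * -lapAlong (inputMap d) _ _ = -(c * lapAlong _ (s u) u)
    rw [lapAlong_apply_congr (ι' := ContinuousLinearMap.id ℝ (E d)) (g := s u) (x' := u) 1]
    · ring
    · intro z
      have e : ((fun _ => u, fun _ => u) : X d (0 + 1) × X d (0 + 1)) + inputMap d z =
          (fun _ => u, fun _ => u + z) := Prod.ext (add_zero _) rfl
      rw [e, one_mul, hs, update_fin_one]
      rfl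

/-- The case in which D is multiplication by c: nothing is differentiated, and only the evaluation
on the diagonal remains. -/
theorem smul_delta_contraction {b : ℕ} (h : 1 + b = b + 1) {A : Ker d b} (hA : GoodMapping A)
    (c : ℂ) (α : Fin (1 + 1)) (β : Fin (b + 1)) :
    contraction h (c • delta d) A α β = A.comp (c • swapDensity h α β) := by
  have e : ((c • ContinuousLinearMap.id ℂ (Density d b)).comp (swapDensity h α β)) =
      c • swapDensity h α β := by
    ext; rfl
  rw [← e]
  refine contraction_eq hA (isContraction_diagonal h hA α β
    (c • ContinuousLinearMap.id ℂ 𝓢(E d, ℂ)) _ (fun φ ψ => ?_) (fun φ G F => ?_)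
    fun Φ s hs => ?_)
  · refine integral_congr_ae (Eventually.of_forall fun u => ?_)
    change c * φ u * ψ u = φ u * (c * ψ u)
    ring
  · ext ⟨v, w⟩
    change c * (φ (v β) * G (β.removeNth v) * F w) = c * φ (v β) * G (β.removeNth v) * F w
    ring
  · change c • delta d _ = _
    rw [delta_apply, ← integral_smul]
    refine integral_congr_ae (Eventually.of_forall fun u => ?_)
    change c * Φ (fun _ => u, fun _ => u) = c * s u u
    rw [hs, Function.update_eq_self_iff.2 rfl]

end

section

variable {d : ℕ}

/-! ### Symmetric kernels -/

/-- Invariance of a kernel under permutations of each of its two groups of variables. -/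
def IsSymmetric {n : ℕ} (γ : Density d n) : Prop :=
  ∀ π σ, permAct π σ γ = γ

theorem IsSymmetric.apply_comp {n : ℕ} {γ : Density d n} (hγ : IsSymmetric γ)
    {s s' : Fin (n + 1) → Fin (n + 1)} (hs : Function.Injective s) (hs' : Function.Injective s')
    (x x' : X d (n + 1)) : γ (x ∘ s, x' ∘ s') = γ (x, x') := by
  have h := DFunLike.congr_fun (hγ (Equiv.ofBijective s (Finite.injective_iff_bijective.1 hs))
    (Equiv.ofBijective s' (Finite.injective_iff_bijective.1 hs'))) (x, x')
  exact h

/-- Moving the entry β to the front is a reindexing independent of the configuration, so a symmetric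
kernel does not see it. The next two lemmas do the same with an additional particle. -/
theorem exists_cons_removeNth {b : ℕ} (β : Fin (b + 1)) : ∃ s : Fin (b + 1) → Fin (b + 1),
    Function.Injective s ∧ ∀ w : X d (b + 1),
      (Fin.cons (w β) (β.removeNth w) : X d (b + 1)) = w ∘ s := by
  refine ⟨Fin.cons β β.succAbove, Fin.cons_injective_iff.2 ⟨?_, Fin.succAbove_right_injective⟩,
    fun w => ?_⟩
  · rintro ⟨i, hi⟩
    exact Fin.succAbove_ne β i hi
  · funext i
    refine Fin.cases rfl (fun j => rfl) i

theorem exists_cons_cons_removeNth {b : ℕ} (β : Fin (b + 1)) : ∃ s : Fin (b + 2) → Fin (b + 2),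
    Function.Injective s ∧ ∀ (w : X d (b + 1)) (e : E d),
      (Fin.cons e (Fin.cons (w β) (β.removeNth w) : X d (b + 1)) : X d (b + 2)) =
        (Fin.snoc w e : X d (b + 2)) ∘ s := by
  obtain ⟨s, hs, h⟩ := exists_cons_removeNth (d := d) β
  refine ⟨Fin.cons (Fin.last _) (Fin.castSucc ∘ s),
    Fin.cons_injective_iff.2 ⟨?_, (Fin.castSucc_injective _).comp hs⟩, fun w e => ?_⟩
  · rintro ⟨i, hi⟩
    exact (Fin.castSucc_lt_last _).ne hi
  · rw [h]
    funext i
    refine Fin.cases ?_ (fun j => ?_) i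
    · simp
    · simp

theorem exists_cons_cons_removeNth' {b : ℕ} (β : Fin (b + 1)) : ∃ s : Fin (b + 2) → Fin (b + 2),
    Function.Injective s ∧ ∀ (w : X d (b + 1)) (e : E d),
      (Fin.cons (w β) (Fin.cons e (β.removeNth w) : X d (b + 1)) : X d (b + 2)) =
        (Fin.snoc w e : X d (b + 2)) ∘ s := by
  obtain ⟨s, hs, h⟩ := exists_cons_cons_removeNth (d := d) β
  refine ⟨s ∘ Equiv.swap 0 1, hs.comp (Equiv.injective _), fun w e => ?_⟩
  rw [← Function.comp_assoc, ← h]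
  funext i
  refine Fin.cases ?_ (fun i => Fin.cases ?_ (fun j => ?_) i) i
  · simp
  · rw [Function.comp_apply, Fin.succ_zero_eq_one, Equiv.swap_apply_right]
    rfl
  · rw [Function.comp_apply, Equiv.swap_apply_of_ne_of_ne]
    · rfl
    · simp [Fin.ext_iff]
    · simp [Fin.ext_iff]

theorem swapDensity_transpose_zero {b : ℕ} (h : 0 + b = b) (α : Fin (0 + 1)) (β : Fin (b + 1))
    {γ : Density d b} (hγ : IsSymmetric γ) :
    swapDensity h α β (transpose γ) = transpose γ := by
  ext ⟨v, w⟩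
  obtain ⟨s, hs, hs'⟩ := exists_cons_removeNth (d := d) β
  rw [swapDensity, restrict_apply, swapMap_apply]
  change γ (moveEquiv h α β (fun _ => v β, w), joinEquiv h (fun _ => v β, β.removeNth v)) =
    γ (w, v)
  rw [joinEquiv_apply, moveEquiv_apply, join_zero_left, join_zero_left]
  have hα : α = 0 := by omega
  subst hα
  rw [Fin.insertNth_apply_same]
  dsimp only
  rw [hs', hs', hγ.apply_comp hs hs]

/-- Both arguments acquire an additional particle at v_β. Reordering gives γ(w, v_β; v, v_β). The
order within the first group depends on α while that within the second does not, so symmetry in each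
group separately is essential. -/
theorem swapDensity_transpose_one {b : ℕ} (h : 1 + b = b + 1) (α : Fin (1 + 1)) (β : Fin (b + 1))
    {γ : Density d (b + 1)} (hγ : IsSymmetric γ) :
    swapDensity h α β (transpose γ) = transpose (coll (rightVar β) γ) := by
  ext ⟨v, w⟩
  obtain ⟨s, hs, hs'⟩ := exists_cons_cons_removeNth (d := d) β
  obtain ⟨t, ht, ht'⟩ := exists_cons_cons_removeNth' (d := d) β
  rw [swapDensity, restrict_apply, swapMap_apply]
  change γ (moveEquiv h α β (fun _ => v β, w), joinEquiv h (fun _ => v β, β.removeNth v)) =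
    coll (rightVar β) γ (w, v)
  rw [joinEquiv_apply, moveEquiv_apply, join_one_left, join_one_left, coll_apply]
  change _ = γ ((Fin.snoc w (v β) : X d (b + 2)), (Fin.snoc v (v β) : X d (b + 2)))
  dsimp only
  rw [hs' v (v β)]
  obtain rfl | rfl : α = 0 ∨ α = 1 := (Fin.exists_fin_two (p := fun i => α = i)).1 ⟨α, rfl⟩
  · change γ ((Fin.cons (w β) (Fin.cons (v β) (β.removeNth w) : X d (b + 1)) : X d (b + 2)), _) = _
    rw [ht', hγ.apply_comp ht hs]
  · change γ ((Fin.cons (v β) (Fin.cons (w β) (β.removeNth w) : X d (b + 1)) : X d (b + 2)), _) = _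
    rw [hs', hγ.apply_comp hs hs]

/-! ### The bracket with the Gross–Pitaevskii generator -/

/-- The kernel of the commutator `[Δ_{x_1} + ⋯ + Δ_{x_k}, γ]`. -/
def lapComm (d n : ℕ) : Density d n →L[ℂ] Density d n :=
  ∑ α : Fin (n + 1), (lapAlong (leftDir α) - lapAlong (rightDir α))

/-- The collision operator `γ ↦ ∑_j (B_j^+ - B_j^-) γ`. -/
def collComm (d n : ℕ) : Density d (n + 1) →L[ℂ] Density d n :=
  ∑ α : Fin (n + 1), (coll (leftVar α) - coll (rightVar α))

/-- A ∘ (−Δ) and (−Δ) ∘ A put the Laplacian on different groups of variables of the transposed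
kernel, so their difference gives the commutator. The sum over β has a single term. -/
theorem trace_oneBracket_negLaplacian {a : ℕ} (h : a + 0 = a) {A : Ker d a} (hA : GoodMapping A)
    (c : ℂ) {γ : Density d a} (hγ : IsSymmetric γ) :
    trace (oneBracket h A (c • negLaplacian d)) γ = -c * trace A (lapComm d a γ) := by
  simp only [oneBracket, trace, lapComm, sum_apply, sub_apply, map_sum, map_sub,
    contraction_smul_negLaplacian, smul_negLaplacian_contraction _ hA, Finset.mul_sum]
  refine Finset.sum_congr rfl fun α _ => ?_
  rw [Fin.sum_univ_castSucc, Fin.sum_univ_zero, zero_add]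
  change -(c • A (lapAlong (rightDir α) (transpose γ))) -
    A (-(c • lapAlong (leftDir α) (swapDensity _ _ _ (transpose γ)))) = _
  rw [swapDensity_transpose_zero _ _ _ hγ, lapAlong_transpose, lapAlong_transpose', map_neg,
    map_smul, smul_eq_mul, smul_eq_mul]
  ring

/-- Each of the two particles β of δ contributes the same difference of collision terms; this is the
origin of the factor 2. -/
theorem trace_oneBracket_delta {a : ℕ} (h : a + 1 = a + 1) {A : Ker d a} (hA : GoodMapping A)
    (c : ℂ) {γ : Density d (a + 1)} (hγ : IsSymmetric γ) :
    trace (oneBracket h A (c • delta d)) γ = 2 * c * trace A (collComm d a γ) := by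
  simp only [oneBracket, trace, collComm, sum_apply, sub_apply, map_sum, map_sub,
    contraction_smul_delta, smul_delta_contraction _ hA, Finset.mul_sum]
  refine Finset.sum_congr rfl fun α _ => ?_
  have e : ∀ β : Fin (1 + 1), (c • A.comp (coll (rightVar α))) (transpose γ) -
      (A.comp (c • swapDensity ((Nat.add_comm 1 a).trans h) β α)) (transpose γ) =
      c * (A (transpose (coll (leftVar α) γ)) - A (transpose (coll (rightVar α) γ))) := by
    intro β
    change c • A (coll (rightVar α) (transpose γ)) - A (c • swapDensity _ β α (transpose γ)) = _
    rw [swapDensity_transpose_one _ _ _ hγ, coll_transpose, map_smul, smul_eq_mul, smul_eq_mul]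
    ring
  simp only [e, Finset.sum_const, Finset.card_univ, Fintype.card_fin, nsmul_eq_mul]
  push_cast
  ring

theorem oneBracket_zero_right {a b n : ℕ} (h : a + b = n) {A : Ker d a} (hA : GoodMapping A) :
    oneBracket h A (0 : Ker d b) = 0 := by
  simp only [oneBracket, contraction_zero_right, contraction_zero_left hA, sub_self,
    Finset.sum_const_zero]

/-- On a symmetric kernel all (n+1)!² terms of the average coincide, so the symmetrization in the
bracket is invisible to traces. -/
theorem trace_symmetrize {n : ℕ} (C : Ker d n) {γ : Density d n} (hγ : IsSymmetric γ) :
    trace (symmetrize C) γ = trace C γ := by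
  have e : ∀ π σ, C.comp (permAct π σ) (transpose γ) = C (transpose γ) := fun π σ =>
    congrArg (fun γ => C (transpose γ)) (hγ σ π)
  have h0 : ((n + 1).factorial : ℂ) ≠ 0 := Nat.cast_ne_zero.2 (Nat.factorial_ne_zero _)
  simp only [trace, symmetrize, smul_apply, sum_apply, e, Finset.sum_const, Finset.card_univ,
    Fintype.card_perm, Fintype.card_fin, nsmul_eq_mul, smul_eq_mul]
  field_simp

/-- The hierarchy `-i W_GP`. -/
def gpObservable (d : ℕ) (κ : ℝ) : ∀ n, Ker d n := fun n => (-Complex.I) • gpGenerator d κ n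

/-- The components of the Gross–Pitaevskii vector field. -/
def gpField (κ : ℝ) (Γ : ∀ n, Density d n) (n : ℕ) : Density d n :=
  Complex.I • lapComm d n (Γ n) - (2 * Complex.I * κ) • collComm d n (Γ (n + 1))

theorem trace_oneBracket_gpObservable_zero {κ : ℝ} {a : ℕ} (h : a + 0 = a) {A : Ker d a}
    (hA : GoodMapping A) {γ : Density d a} (hγ : IsSymmetric γ) :
    trace (oneBracket h A (gpObservable d κ 0)) γ = Complex.I * trace A (lapComm d a γ) := by
  rw [gpObservable, gpGenerator, trace_oneBracket_negLaplacian h hA _ hγ, neg_neg]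

theorem trace_oneBracket_gpObservable_one {κ : ℝ} {a : ℕ} (h : a + 1 = a + 1) {A : Ker d a}
    (hA : GoodMapping A) {γ : Density d (a + 1)} (hγ : IsSymmetric γ) :
    trace (oneBracket h A (gpObservable d κ 1)) γ =
      -(2 * Complex.I * κ) * trace A (collComm d a γ) := by
  rw [gpObservable, gpGenerator, smul_smul, trace_oneBracket_delta h hA _ hγ]
  ring

theorem oneBracket_gpObservable_add_two {κ : ℝ} {a b n : ℕ} (h : a + b = n) (hb : 2 ≤ b)
    {A : Ker d a} (hA : GoodMapping A) : oneBracket h A (gpObservable d κ b) = 0 := by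
  obtain ⟨b, rfl⟩ := Nat.exists_eq_add_of_le' hb
  have e : gpObservable d κ (b + 2) = 0 :=
    ContinuousLinearMap.ext fun Θ => mul_zero (-Complex.I)
  rw [e, oneBracket_zero_right h hA]

theorem trace_gpField {κ : ℝ} (A : ∀ n, Ker d n) (Γ : ∀ n, Density d n) (n : ℕ) :
    trace (A n) (gpField κ Γ n) = Complex.I * trace (A n) (lapComm d n (Γ n)) +
      -(2 * Complex.I * κ) * trace (A n) (collComm d n (Γ (n + 1))) := by
  simp only [trace, gpField, map_sub, map_smul, smul_eq_mul]
  ring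

theorem trace_lieBracket_gpObservable_zero {κ : ℝ} {A : ∀ n, Ker d n}
    (hA : ∀ n, GoodMapping (A n)) {Γ : ∀ n, Density d n} (hΓ : ∀ n, IsSymmetric (Γ n)) :
    trace (lieBracket A (gpObservable d κ) 0) (Γ 0) =
      Complex.I * trace (A 0) (lapComm d 0 (Γ 0)) := by
  rw [lieBracket, trace_symmetrize _ (hΓ 0),
    Fin.sum_univ_castSucc, Fin.sum_univ_zero, zero_add]
  exact trace_oneBracket_gpObservable_zero (Nat.add_zero 0) (hA 0) (hΓ 0)

theorem trace_lieBracket_gpObservable_succ {κ : ℝ} {A : ∀ n, Ker d n}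
    (hA : ∀ n, GoodMapping (A n)) {Γ : ∀ n, Density d n} (hΓ : ∀ n, IsSymmetric (Γ n)) (n : ℕ) :
    trace (lieBracket A (gpObservable d κ) (n + 1)) (Γ (n + 1)) =
      Complex.I * trace (A (n + 1)) (lapComm d (n + 1) (Γ (n + 1))) +
      -(2 * Complex.I * κ) * trace (A n) (collComm d n (Γ (n + 1))) := by
  -- The particle number of the second factor occurs as a difference that equals 0 or 1 only
  -- propositionally, and the type of the bracket depends on it. Hence b is kept as a variable, to
  -- be substituted.
  have h0 : ∀ (b : ℕ) (h : n + 1 + b = n + 1), b = 0 →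
      trace (oneBracket h (A (n + 1)) (gpObservable d κ b)) (Γ (n + 1)) =
        Complex.I * trace (A (n + 1)) (lapComm d (n + 1) (Γ (n + 1))) := by
    rintro b h rfl
    exact trace_oneBracket_gpObservable_zero h (hA _) (hΓ _)
  have h1 : ∀ (b : ℕ) (h : n + b = n + 1), b = 1 →
      trace (oneBracket h (A n) (gpObservable d κ b)) (Γ (n + 1)) =
        -(2 * Complex.I * κ) * trace (A n) (collComm d n (Γ (n + 1))) := by
    rintro b h rfl
    exact trace_oneBracket_gpObservable_one h (hA _) (hΓ _)
  rw [lieBracket, trace_symmetrize _ (hΓ (n + 1)), trace, sum_apply, Fin.sum_univ_castSucc,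
    Fin.sum_univ_castSucc, Finset.sum_eq_zero, zero_add, add_comm]
  · congr 1
    · exact h0 _ _ (by simp)
    · exact h1 _ _ (by simp)
  · intro i _
    rw [oneBracket_gpObservable_add_two _ ?_ (hA _)]
    · rfl
    · have := i.is_lt
      simp only [Fin.val_castSucc]
      omega

/-- An index shift: A^(n) meets the collision term of γ^(n+1) in component n + 1 of the bracket, but
in component n of the trace against the field. The bracket may reach one particle further than A, so
N + 1 terms are summed; the surplus collision term vanishes because A N = 0. -/
theorem hierTrace_lieBracket_gpObservable {κ : ℝ} {A : ∀ n, Ker d n} (hA : IsObservable A)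
    {Γ : ∀ n, Density d n} (hΓ : ∀ n, IsSymmetric (Γ n)) :
    hierTrace (lieBracket A (gpObservable d κ)) Γ = hierTrace A (gpField κ Γ) := by
  have hg : ∀ n, GoodMapping (A n) := fun n => (hA.2 n).2.2
  obtain ⟨N, hN⟩ : ∃ N, ∀ n, N ≤ n → A n = 0 := by
    obtain ⟨N, hN⟩ := hA.1.bddAbove
    refine ⟨N + 1, fun n hn => ?_⟩
    by_contra h
    have := hN h
    omega
  have htr : ∀ n, N ≤ n → ∀ γ, trace (A n) γ = 0 := by
    intro n hn γ
    rw [hN n hn]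
    rfl
  rw [hierTrace, hierTrace, finsum_eq_sum_of_support_subset (s := Finset.range (N + 1)),
    finsum_eq_sum_of_support_subset (s := Finset.range (N + 1)), Finset.sum_range_succ']
  · simp only [trace_lieBracket_gpObservable_zero hg hΓ, trace_lieBracket_gpObservable_succ hg hΓ,
      trace_gpField, Finset.sum_add_distrib]
    rw [add_right_comm, ← Finset.sum_range_succ'
      (fun n => Complex.I * trace (A n) (lapComm d n (Γ n))), Finset.sum_range_succ
      (fun n => -(2 * Complex.I * κ) * trace (A n) (collComm d n (Γ (n + 1)))), htr N le_rfl,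
      mul_zero, add_zero]
  · intro n hn
    rw [Finset.coe_range, Set.mem_Iio]
    by_contra! h
    exact hn (htr n (by omega) _)
  · intro n hn
    rw [Finset.coe_range, Set.mem_Iio]
    by_contra! h
    obtain ⟨n, rfl⟩ : ∃ m, n = m + 1 := ⟨n - 1, by omega⟩
    refine hn ?_
    simp only [trace_lieBracket_gpObservable_succ hg hΓ, htr n (by omega),
      htr (n + 1) (by omega), mul_zero, add_zero]

end

section

variable {d : ℕ}

/-! ### Traces of hierarchies -/

theorem hierTrace_eq_sum {A : ∀ n, Ker d n} {N : ℕ} (hN : ∀ n, N ≤ n → A n = 0)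
    (Γ : ∀ n, Density d n) : hierTrace A Γ = ∑ n ∈ Finset.range N, trace (A n) (Γ n) := by
  refine finsum_eq_sum_of_support_subset _ fun n hn => ?_
  rw [Finset.coe_range, Set.mem_Iio]
  by_contra! h
  refine hn ?_
  change trace (A n) (Γ n) = 0
  rw [hN n h]
  rfl

theorem IsObservable.exists_eq_zero {A : ∀ n, Ker d n} (hA : IsObservable A) :
    ∃ N, ∀ n, N ≤ n → A n = 0 := by
  obtain ⟨N, hN⟩ := hA.1.bddAbove
  refine ⟨N + 1, fun n hn => ?_⟩
  by_contra h
  have := hN h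
  omega

theorem IsObservable.add {A B : ∀ n, Ker d n} (hA : IsObservable A) (hB : IsObservable B) :
    IsObservable (A + B) := by
  refine ⟨(hA.1.union hB.1).subset fun n hn => ?_, fun n => ⟨fun π σ Θ => ?_, fun Θ Θ' h => ?_,
    (hA.2 n).2.2.add (hB.2 n).2.2⟩⟩
  · by_contra h
    rw [Set.mem_union, not_or] at h
    have h1 : A n = 0 := not_not.1 h.1
    have h2 : B n = 0 := not_not.1 h.2
    refine hn ?_
    rw [Pi.add_apply, h1, h2, add_zero]
  · change A n _ + B n _ = A n Θ + B n Θ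
    rw [(hA.2 n).1, (hB.2 n).1]
  · change A n _ + B n _ = -starRingEnd ℂ (A n Θ + B n Θ)
    rw [(hA.2 n).2.1 Θ Θ' h, (hB.2 n).2.1 Θ Θ' h, map_add]
    ring

theorem IsObservable.smul {A : ∀ n, Ker d n} (hA : IsObservable A) (r : ℝ) :
    IsObservable ((r : ℂ) • A) := by
  refine ⟨hA.1.subset fun n hn h => hn ?_, fun n => ⟨fun π σ Θ => ?_, fun Θ Θ' h => ?_,
    (hA.2 n).2.2.smul r⟩⟩
  · change (r : ℂ) • A n = 0
    rw [h]
    exact ContinuousLinearMap.ext fun Θ => mul_zero (r : ℂ)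
  · change (r : ℂ) * A n _ = r * A n Θ
    rw [(hA.2 n).1]
  · change (r : ℂ) * A n _ = -starRingEnd ℂ (r * A n Θ)
    rw [(hA.2 n).2.1 Θ Θ' h, map_mul, Complex.conj_ofReal]
    ring

theorem isObservable_zero : IsObservable (0 : ∀ n, Ker d n) := by
  refine ⟨?_, fun n => ⟨fun π σ Θ => rfl, fun Θ Θ' h => ?_, goodMapping_zero⟩⟩
  · simp
  · simp

theorem hierTrace_add_left {A B : ∀ n, Ker d n} (hA : IsObservable A) (hB : IsObservable B)
    (Γ : ∀ n, Density d n) : hierTrace (A + B) Γ = hierTrace A Γ + hierTrace B Γ := by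
  obtain ⟨N, hN⟩ := hA.exists_eq_zero
  obtain ⟨M, hM⟩ := hB.exists_eq_zero
  have h1 : ∀ n, max N M ≤ n → A n = 0 := fun n hn => hN n (by omega)
  have h2 : ∀ n, max N M ≤ n → B n = 0 := fun n hn => hM n (by omega)
  rw [hierTrace_eq_sum h1, hierTrace_eq_sum h2, hierTrace_eq_sum (N := max N M),
    ← Finset.sum_add_distrib]
  · rfl
  · intro n hn
    rw [Pi.add_apply, h1 n hn, h2 n hn, add_zero]

theorem hierTrace_smul_left (c : ℂ) (A : ∀ n, Ker d n) (Γ : ∀ n, Density d n) :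
    hierTrace (c • A) Γ = c * hierTrace A Γ := by
  rw [hierTrace, hierTrace, ← smul_eq_mul, smul_finsum]
  rfl

theorem IsObservable.hierTrace_add {A : ∀ n, Ker d n} (hA : IsObservable A)
    (Γ Γ' : ∀ n, Density d n) : hierTrace A (Γ + Γ') = hierTrace A Γ + hierTrace A Γ' := by
  obtain ⟨N, hN⟩ := hA.exists_eq_zero
  simp only [hierTrace_eq_sum hN, ← Finset.sum_add_distrib, trace, Pi.add_apply, map_add]

theorem hierTrace_real_smul (A : ∀ n, Ker d n) (r : ℝ) (Γ : ∀ n, Density d n) :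
    hierTrace A (r • Γ) = r * hierTrace A Γ := by
  rw [hierTrace, hierTrace, ← smul_eq_mul, smul_finsum]
  refine finsum_congr fun n => ?_
  rw [Pi.smul_apply, trace, trace, ← Complex.coe_smul, map_smul, map_smul]

theorem hierTrace_single (A : ∀ n, Ker d n) (n : ℕ) (γ : Density d n) :
    hierTrace A (Pi.single n γ) = trace (A n) γ := by
  rw [hierTrace, finsum_eq_single _ n]
  · rw [Pi.single_eq_same]
  · intro m hm
    rw [Pi.single_eq_of_ne hm, trace, map_zero, map_zero]

theorem hierTrace_single_left (n : ℕ) (K : Ker d n) (Γ : ∀ n, Density d n) :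
    hierTrace (Pi.single n K) Γ = trace K (Γ n) := by
  rw [hierTrace, finsum_eq_single _ n]
  · rw [Pi.single_eq_same]
  · intro m hm
    rw [Pi.single_eq_of_ne hm]
    rfl

theorem isObservable_single {n : ℕ} {K : Ker d n} (h1 : IsBosonicKer K) (h2 : IsSkewAdjoint K)
    (h3 : GoodMapping K) : IsObservable (Pi.single n K : ∀ n, Ker d n) := by
  refine ⟨(Set.finite_singleton n).subset fun m hm => ?_, fun m => ?_⟩
  · by_contra h
    exact hm (Pi.single_eq_of_ne h _)
  · rcases eq_or_ne m n with rfl | h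
    · rw [Pi.single_eq_same]
      exact ⟨h1, h2, h3⟩
    · rw [Pi.single_eq_of_ne h]
      exact isObservable_zero.2 m

theorem IsSkewAdjoint.conj_trace {n : ℕ} {K : Ker d n} (hK : IsSkewAdjoint K) {γ : Density d n}
    (hγ : ∀ x x', γ (x, x') = starRingEnd ℂ (γ (x', x))) :
    starRingEnd ℂ (trace K γ) = -trace K γ := by
  rw [eq_neg_iff_add_eq_zero, add_comm, ← eq_neg_iff_add_eq_zero]
  exact hK _ _ fun x x' => hγ x' x

theorem IsObservable.conj_hierTrace {A : ∀ n, Ker d n} (hA : IsObservable A)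
    (Γ : DensityHierarchy d) : starRingEnd ℂ (hierTrace A Γ.1) = -hierTrace A Γ.1 := by
  obtain ⟨N, hN⟩ := hA.exists_eq_zero
  rw [hierTrace_eq_sum hN, map_sum, ← Finset.sum_neg_distrib]
  exact Finset.sum_congr rfl fun n _ => (hA.2 n).2.1.conj_trace (Γ.2 n).2

/-- The trace functional `Γ ↦ i Tr (A · Γ)` of an observable is real. -/
theorem IsObservable.ofReal_re {A : ∀ n, Ker d n} (hA : IsObservable A) (Γ : DensityHierarchy d) :
    (((Complex.I * hierTrace A Γ.1).re : ℝ) : ℂ) = Complex.I * hierTrace A Γ.1 := by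
  refine Complex.conj_eq_iff_re.1 ?_
  rw [map_mul, hA.conj_hierTrace, Complex.conj_I]
  ring

/-! ### Density matrices with a single component -/

/-- The adjoint `γ^*(x; x') = conj γ(x'; x)` of a kernel. -/
def conjTranspose {n : ℕ} (γ : Density d n) : Density d n :=
  transpose (SchwartzMap.postcompCLM (𝕜 := ℝ) (Complex.conjCLE : ℂ →L[ℝ] ℂ) γ)

theorem conjTranspose_apply {n : ℕ} (γ : Density d n) (x x' : X d (n + 1)) :
    conjTranspose γ (x, x') = starRingEnd ℂ (γ (x', x)) := rfl

theorem permAct_apply {n : ℕ} (π σ : Equiv.Perm (Fin (n + 1))) (γ : Density d n)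
    (x x' : X d (n + 1)) : permAct π σ γ (x, x') = γ (x ∘ π, x' ∘ σ) := rfl

/-- A density matrix hierarchy with a single component. -/
def singleHierarchy (n : ℕ) (γ : Density d n) (h1 : IsSymmetric γ)
    (h2 : ∀ x x', γ (x, x') = starRingEnd ℂ (γ (x', x))) : DensityHierarchy d :=
  ⟨Pi.single n γ, fun m => by
    rcases eq_or_ne m n with rfl | h
    · rw [Pi.single_eq_same]
      exact ⟨h1, h2⟩
    · rw [Pi.single_eq_of_ne h]
      exact (DensityHierarchy d).zero_mem m⟩

/-- This gives uniqueness of gradients. A symmetric kernel is a complex combination of two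
self-adjoint ones, γ + γ* and i(γ − γ*), so complex linearity removes self-adjointness. Bosonic
invariance of `A n` then allows any kernel to be replaced by its symmetrization. -/
theorem IsObservable.eq_zero {A : ∀ n, Ker d n} (hA : IsObservable A)
    (h : ∀ v : DensityHierarchy d, hierTrace A v.1 = 0) : A = 0 := by
  funext n
  have h0 : ∀ γ : Density d n, IsSymmetric γ →
      (∀ x x', γ (x, x') = starRingEnd ℂ (γ (x', x))) → A n (transpose γ) = 0 := by
    intro γ h1 h2
    rw [← trace, ← hierTrace_single]
    exact h (singleHierarchy n γ h1 h2)
  have h1 : ∀ γ : Density d n, IsSymmetric γ → A n (transpose γ) = 0 := by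
    intro γ hγ
    have hγ' : IsSymmetric (conjTranspose γ) := by
      intro π σ
      ext ⟨x, x'⟩
      rw [permAct_apply, conjTranspose_apply, conjTranspose_apply,
        hγ.apply_comp σ.injective π.injective]
    have e1 := h0 (γ + conjTranspose γ) (fun π σ => by rw [map_add, hγ, hγ']) fun x x' => by
      simp only [add_apply, conjTranspose_apply, map_add, Complex.conj_conj]
      ring
    have e2 := h0 (Complex.I • (γ - conjTranspose γ))
      (fun π σ => by rw [map_smul, map_sub, hγ, hγ']) fun x x' => by
      simp only [smul_apply, sub_apply, conjTranspose_apply, map_sub, Complex.conj_conj,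
        smul_eq_mul, map_mul, Complex.conj_I]
      ring
    simp only [map_add] at e1
    simp only [map_smul, map_sub, smul_eq_mul, mul_eq_zero, Complex.I_ne_zero, false_or] at e2
    linear_combination (e1 + e2) / 2
  ext Θ
  have hS : IsSymmetric (∑ π : Equiv.Perm (Fin (n + 1)), ∑ σ : Equiv.Perm (Fin (n + 1)),
      permAct π σ (transpose Θ)) := by
    intro π σ
    ext ⟨x, x'⟩
    rw [permAct_apply]
    simp only [sum_apply, permAct_apply]
    exact Fintype.sum_equiv (Equiv.mulLeft π) _ _ fun π' =>
      Fintype.sum_equiv (Equiv.mulLeft σ) _ _ fun σ' => rfl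
  have key := h1 _ hS
  have e : ∀ π σ, A n (transpose (permAct π σ (transpose Θ))) = A n Θ := fun π σ =>
    (hA.2 n).1 σ π Θ
  simp only [map_sum, e, Finset.sum_const, Finset.card_univ, Fintype.card_perm, Fintype.card_fin,
    nsmul_eq_mul, mul_eq_zero, Nat.cast_eq_zero, Nat.factorial_ne_zero, false_or] at key
  exact key

/-! ### The Gross–Pitaevskii observable -/

theorem lapAlong_conj_apply {V : Type*} [NormedAddCommGroup V] [NormedSpace ℝ V]
    {ι : E d →L[ℝ] V} {f g : 𝓢(V, ℂ)} (h : ∀ x, g x = starRingEnd ℂ (f x)) (x : V) :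
    lapAlong ι g x = starRingEnd ℂ (lapAlong ι f x) := by
  simp only [lapAlong_apply, map_sum, h]
  refine Finset.sum_congr rfl fun i _ => ?_
  have e : ∀ F : ℝ → ℂ, (deriv fun t => starRingEnd ℂ (F t)) = fun t => starRingEnd ℂ (deriv F t) :=
    fun F => funext fun t => deriv.star
  rw [e, e]

/-- On products this is the symmetry of the Laplacian under integration; totality of products gives
the rest. -/
theorem negLaplacian_transpose (Θ : Density d 0) :
    negLaplacian d (transpose Θ) = negLaplacian d Θ := by
  have h : ∀ a b : 𝓢(X d (0 + 1), ℂ), negLaplacian d (tensor a b) =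
      -∫ u, restrict _ (constConf_injective 0) a u *
        lapAlong (ContinuousLinearMap.id ℝ (E d)) (restrict _ (constConf_injective 0) b) u := by
    intro a b
    rw [negLaplacian_apply]
    congr 1
    refine integral_congr_ae (Eventually.of_forall fun u => ?_)
    refine lapAlong_apply_congr (a fun _ => u) fun y => ?_
    have e : ((fun _ => u, fun _ => u) : X d (0 + 1) × X d (0 + 1)) + inputMap d y =
        (fun _ => u, fun _ => u + y) := Prod.ext (add_zero _) rfl
    rw [e]
    rfl
  have h0 : (negLaplacian d).comp transpose - negLaplacian d = 0 := by
    refine eq_zero_of_tensor _ fun a b => ?_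
    have e : transpose (tensor a b) = tensor b a := by
      ext ⟨x, x'⟩
      change a x' * b x = b x * a x'
      ring
    change negLaplacian d (transpose (tensor a b)) - negLaplacian d (tensor a b) = 0
    rw [e, h, h, ← integral_lapAlong_mul, sub_eq_zero]
    congr 1
    exact integral_congr_ae (Eventually.of_forall fun u => mul_comm _ _)
  exact sub_eq_zero.1 (DFunLike.congr_fun h0 Θ)

theorem negLaplacian_conj {Θ Θ' : Density d 0} (h : ∀ x x', Θ' (x, x') = starRingEnd ℂ (Θ (x', x))) :
    negLaplacian d Θ' = starRingEnd ℂ (negLaplacian d Θ) := by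
  rw [← negLaplacian_transpose Θ, negLaplacian_apply, negLaplacian_apply, map_neg, ← integral_conj]
  congr 1
  refine integral_congr_ae (Eventually.of_forall fun u => ?_)
  exact lapAlong_conj_apply (fun x => h x.1 x.2) _

theorem delta_conj {Θ Θ' : Density d 1} (h : ∀ x x', Θ' (x, x') = starRingEnd ℂ (Θ (x', x))) :
    delta d Θ' = starRingEnd ℂ (delta d Θ) := by
  rw [delta_apply, delta_apply, ← integral_conj]
  exact integral_congr_ae (Eventually.of_forall fun u => h _ _)

theorem isObservable_gpObservable (κ : ℝ) : IsObservable (gpObservable d κ) := by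
  refine ⟨(Set.finite_Iio 2).subset fun n hn => ?_, fun n => ?_⟩
  · rw [Set.mem_Iio]
    by_contra! h
    obtain ⟨m, rfl⟩ := Nat.exists_eq_add_of_le' h
    exact hn (ContinuousLinearMap.ext fun Θ => mul_zero (-Complex.I))
  · match n with
    | 0 =>
      refine ⟨fun π σ Θ => ?_, fun Θ Θ' h => ?_, goodMapping_negLaplacian.smul _⟩
      · have e : permAct π σ Θ = Θ := by
          ext ⟨x, x'⟩
          have hπ : ∀ π : Equiv.Perm (Fin (0 + 1)), ∀ x : X d (0 + 1), x ∘ π = x := fun π x =>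
            funext fun i => congrArg x (by omega)
          rw [permAct_apply, hπ, hπ]
        rw [e]
      · change -Complex.I * negLaplacian d Θ' = -starRingEnd ℂ (-Complex.I * negLaplacian d Θ)
        rw [negLaplacian_conj h, map_mul, map_neg, Complex.conj_I]
        ring
    | 1 =>
      -- Permutations fix the diagonal configurations, the only ones that δ sees; hence `rfl`.
      refine ⟨fun π σ Θ => rfl, fun Θ Θ' h => ?_, (goodMapping_delta.smul _).smul _⟩
      change -Complex.I * (κ * delta d Θ') = -starRingEnd ℂ (-Complex.I * (κ * delta d Θ))
      rw [delta_conj h, map_mul, map_neg, Complex.conj_I, map_mul, Complex.conj_ofReal]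
      ring
    | n + 2 =>
      have e : gpObservable d κ (n + 2) = 0 :=
        ContinuousLinearMap.ext fun Θ => mul_zero (-Complex.I)
      rw [e]
      exact isObservable_zero.2 _

theorem hierTrace_gpObservable (κ : ℝ) (Γ : ∀ n, Density d n) :
    Complex.I * hierTrace (gpObservable d κ) Γ = hierTrace (gpGenerator d κ) Γ := by
  change Complex.I * hierTrace ((-Complex.I) • gpGenerator d κ) Γ = _
  rw [hierTrace_smul_left, ← mul_assoc, mul_neg, Complex.I_mul_I, neg_neg, one_mul]

theorem hierTrace_gpGenerator (κ : ℝ) (Γ : ∀ n, Density d n) :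
    hierTrace (gpGenerator d κ) Γ =
      trace (negLaplacian d) (Γ 0) + κ * trace (delta d) (Γ 1) := by
  rw [hierTrace_eq_sum (N := 2), Finset.sum_range_succ, Finset.sum_range_one]
  · rfl
  · intro n hn
    obtain ⟨m, rfl⟩ := Nat.exists_eq_add_of_le' hn
    rfl

/-- Skew-adjointness of −i W_GP makes the trace real on self-adjoint hierarchies, so the real part
in the definition of the Hamiltonian discards nothing. -/
theorem ofReal_gpHamiltonian (κ : ℝ) (Γ : DensityHierarchy d) :
    (gpHamiltonian d κ Γ : ℂ) = Complex.I * hierTrace (gpObservable d κ) Γ.1 := by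
  rw [← (isObservable_gpObservable κ).ofReal_re, hierTrace_gpObservable, hierTrace_gpGenerator]
  rfl

/-! ### Gradients -/

theorem IsObservable.hasLineDerivAt {F : DensityHierarchy d → ℝ} {A : ∀ n, Ker d n}
    (hA : IsObservable A)
    (h : ∀ Γ : DensityHierarchy d, (F Γ : ℂ) = Complex.I * hierTrace A Γ.1)
    (Γ v : DensityHierarchy d) : HasLineDerivAt ℝ F (F v) Γ v := by
  have e : (fun t : ℝ => F (Γ + t • v)) = fun t => F Γ + t * F v := by
    funext t
    apply Complex.ofReal_injective
    rw [Complex.ofReal_add, Complex.ofReal_mul, h, h, h]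
    change _ * hierTrace A (Γ.1 + t • v.1) = _
    rw [hA.hierTrace_add, hierTrace_real_smul]
    ring
  unfold HasLineDerivAt
  rw [e]
  simpa using ((hasDerivAt_id (0 : ℝ)).mul_const (F v)).const_add (F Γ)

/-- Induction over the generated algebra; the Leibniz rule gives G(Γ) A + F(Γ) B, observable because
the coefficients are real. Actual differentiability is carried along, since `lineDeriv` has a
default value and the product rule needs it. -/
theorem exists_hasLineDerivAt {F : DensityHierarchy d → ℝ} (hF : F ∈ admissible d)
    (Γ : DensityHierarchy d) : ∃ A : ∀ n, Ker d n, IsObservable A ∧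
      ∀ v : DensityHierarchy d, ∃ δ : ℝ, HasLineDerivAt ℝ F δ Γ v ∧
        (δ : ℂ) = Complex.I * hierTrace A v.1 := by
  induction hF using Algebra.adjoin_induction with
  | mem F hF =>
    obtain ⟨A, hA, h⟩ := hF
    exact ⟨A, hA, fun v => ⟨F v, hA.hasLineDerivAt h Γ v, h v⟩⟩
  | algebraMap r =>
    refine ⟨0, isObservable_zero, fun v => ⟨0, hasDerivAt_const _ _, ?_⟩⟩
    have e : hierTrace (0 : ∀ n, Ker d n) v.1 = 0 := finsum_zero
    rw [e, mul_zero, Complex.ofReal_zero]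
  | add F G _ _ hF hG =>
    obtain ⟨A, hA, h⟩ := hF
    obtain ⟨B, hB, h'⟩ := hG
    refine ⟨A + B, hA.add hB, fun v => ?_⟩
    obtain ⟨δ, h1, h2⟩ := h v
    obtain ⟨δ', h1', h2'⟩ := h' v
    refine ⟨δ + δ', HasDerivAt.add h1 h1', ?_⟩
    rw [hierTrace_add_left hA hB, Complex.ofReal_add, h2, h2', mul_add]
  | mul F G _ _ hF hG =>
    obtain ⟨A, hA, h⟩ := hF
    obtain ⟨B, hB, h'⟩ := hG
    refine ⟨(G Γ : ℂ) • A + (F Γ : ℂ) • B, (hA.smul _).add (hB.smul _), fun v => ?_⟩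
    obtain ⟨δ, h1, h2⟩ := h v
    obtain ⟨δ', h1', h2'⟩ := h' v
    have key := HasDerivAt.mul h1 h1'
    rw [zero_smul, add_zero] at key
    refine ⟨δ * G Γ + F Γ * δ', key, ?_⟩
    rw [hierTrace_add_left (hA.smul _) (hB.smul _), hierTrace_smul_left, hierTrace_smul_left]
    push_cast
    rw [h2, h2']
    ring

theorem isObservable_gradient {F : DensityHierarchy d → ℝ} (hF : F ∈ admissible d)
    (Γ : DensityHierarchy d) : IsObservable (gradient F Γ) ∧
      ∀ v : DensityHierarchy d,
        ((lineDeriv ℝ F Γ v : ℝ) : ℂ) = Complex.I * hierTrace (gradient F Γ) v.1 := by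
  obtain ⟨A, hA, h⟩ := exists_hasLineDerivAt hF Γ
  have hex : ∃ A : ∀ n, Ker d n, IsObservable A ∧
      ∀ v : DensityHierarchy d, ((lineDeriv ℝ F Γ v : ℝ) : ℂ) = Complex.I * hierTrace A v.1 := by
    refine ⟨A, hA, fun v => ?_⟩
    obtain ⟨δ, h1, h2⟩ := h v
    rw [h1.lineDeriv, h2]
  rw [gradient, dif_pos hex]
  exact hex.choose_spec

theorem gradient_eq {F : DensityHierarchy d → ℝ} {A : ∀ n, Ker d n} (hA : IsObservable A)
    (h : ∀ Γ : DensityHierarchy d, (F Γ : ℂ) = Complex.I * hierTrace A Γ.1)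
    (Γ : DensityHierarchy d) : gradient F Γ = A := by
  have hF : F ∈ admissible d := Algebra.subset_adjoin ⟨A, hA, h⟩
  obtain ⟨h1, h2⟩ := isObservable_gradient hF Γ
  have h3 : ∀ v : DensityHierarchy d, ((lineDeriv ℝ F Γ v : ℝ) : ℂ) =
      Complex.I * hierTrace A v.1 := by
    intro v
    rw [(hA.hasLineDerivAt h Γ v).lineDeriv, h]
  have h4 : gradient F Γ + ((-1 : ℝ) : ℂ) • A = 0 := by
    refine (h1.add (hA.smul _)).eq_zero fun v => ?_
    rw [hierTrace_add_left h1 (hA.smul _), hierTrace_smul_left]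
    have := (h2 v).symm.trans (h3 v)
    have := mul_left_cancel₀ Complex.I_ne_zero this
    rw [this]
    push_cast
    ring
  rw [Complex.ofReal_neg, Complex.ofReal_one, neg_one_smul ℂ A, ← sub_eq_add_neg] at h4
  exact sub_eq_zero.1 h4

end

section

variable {d : ℕ}

/-! ### Hilbert–Schmidt observables -/

instance isAddHaarMeasure_volume_prod (a b : ℕ) :
    (volume : Measure (X d a × X d b)).IsAddHaarMeasure :=
  Measure.prod.instIsAddHaarMeasure _ _

/-- The kernel `i η`, that is `Θ ↦ i ∫ η Θ`. -/
def schwartzKer {n : ℕ} (η : Density d n) : Ker d n :=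
  Complex.I • (integralCLM ℂ (volume : Measure (X d (n + 1) × X d (n + 1)))).comp
    (pairing (ContinuousLinearMap.mul ℂ ℂ) η)

theorem schwartzKer_apply {n : ℕ} (η Θ : Density d n) :
    schwartzKer η Θ = Complex.I * ∫ z, η z * Θ z := rfl

theorem measurePreserving_comp_perm {m : ℕ} (π : Equiv.Perm (Fin m)) :
    MeasurePreserving (fun x : X d m => x ∘ π) := by
  have e : (fun x : X d m => x ∘ π) = MeasurableEquiv.piCongrLeft (fun _ => E d) π.symm := by
    funext x i
    obtain ⟨j, rfl⟩ := π.symm.surjective i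
    rw [MeasurableEquiv.coe_piCongrLeft, Equiv.piCongrLeft_apply_apply, Function.comp_apply,
      Equiv.apply_symm_apply]
  rw [e]
  exact volume_measurePreserving_piCongrLeft (fun _ => E d) π.symm

theorem isBosonicKer_schwartzKer {n : ℕ} {η : Density d n} (hη : IsSymmetric η) :
    IsBosonicKer (schwartzKer η) := by
  intro π σ Θ
  rw [schwartzKer_apply, schwartzKer_apply]
  congr 1
  have hmp : MeasurePreserving (Prod.map (fun x : X d (n + 1) => x ∘ π)
      (fun x : X d (n + 1) => x ∘ σ)) :=
    (measurePreserving_comp_perm π).prod (measurePreserving_comp_perm σ)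
  have hemb : MeasurableEmbedding (Prod.map (fun x : X d (n + 1) => x ∘ π)
      (fun x : X d (n + 1) => x ∘ σ)) :=
    ((relabel (d := d) π).prodCongr
      (relabel (d := d) σ)).toHomeomorph.toMeasurableEquiv.measurableEmbedding
  refine Eq.trans ?_ (hmp.integral_comp hemb fun z => η z * Θ z)
  refine integral_congr_ae (Eventually.of_forall fun z => ?_)
  change η z * Θ (z.1 ∘ π, z.2 ∘ σ) = η (z.1 ∘ π, z.2 ∘ σ) * Θ (z.1 ∘ π, z.2 ∘ σ)
  rw [hη.apply_comp π.injective σ.injective]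

theorem isSkewAdjoint_schwartzKer {n : ℕ} {η : Density d n}
    (hη : ∀ x x', η (x, x') = starRingEnd ℂ (η (x', x))) : IsSkewAdjoint (schwartzKer η) := by
  intro Θ Θ' h
  rw [schwartzKer_apply, schwartzKer_apply, map_mul, Complex.conj_I, neg_mul, neg_neg]
  congr 1
  rw [← integral_conj, Measure.volume_eq_prod, ← integral_prod_swap]
  refine integral_congr_ae (Eventually.of_forall fun z => ?_)
  change η (z.2, z.1) * Θ' (z.2, z.1) = starRingEnd ℂ (η (z.1, z.2) * Θ (z.1, z.2))
  rw [hη z.2 z.1, h, map_mul]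

/-- The linear map `((p, w), (u, y)) ↦ ((v, w), (v', w))`, where `v` and `v'` arise from `p` by
insertion of `u` and of `y` at position `α`. -/
def insertPairMap {n : ℕ} (α : Fin (n + 1)) : ((X d n × X d (n + 1)) × (E d × E d)) →L[ℝ]
    (X d (n + 1) × X d (n + 1)) × (X d (n + 1) × X d (n + 1)) :=
  let pw : ((X d n × X d (n + 1)) × (E d × E d)) →L[ℝ] X d n × X d (n + 1) :=
    ContinuousLinearMap.fst ℝ _ _
  let uy : ((X d n × X d (n + 1)) × (E d × E d)) →L[ℝ] E d × E d :=
    ContinuousLinearMap.snd ℝ _ _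
  let p := (ContinuousLinearMap.fst ℝ (X d n) (X d (n + 1))).comp pw
  let w := (ContinuousLinearMap.snd ℝ (X d n) (X d (n + 1))).comp pw
  let ins : (E d × X d n) →L[ℝ] X d (n + 1) := insertEquiv (d := d) α
  ((ins.comp (((ContinuousLinearMap.fst ℝ (E d) (E d)).comp uy).prod p)).prod w).prod
    ((ins.comp (((ContinuousLinearMap.snd ℝ (E d) (E d)).comp uy).prod p)).prod w)

theorem insertPairMap_apply {n : ℕ} (α : Fin (n + 1)) (p : X d n) (w : X d (n + 1)) (u y : E d) :
    insertPairMap α ((p, w), (u, y)) =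
      ((insertEquiv α (u, p), w), (insertEquiv α (y, p), w)) := rfl

theorem insertPairMap_injective {n : ℕ} (α : Fin (n + 1)) :
    Function.Injective (insertPairMap (d := d) α) := by
  rintro ⟨⟨p, w⟩, u, y⟩ ⟨⟨p', w'⟩, u', y'⟩ h
  rw [insertPairMap_apply, insertPairMap_apply] at h
  simp only [Prod.mk.injEq, EmbeddingLike.apply_eq_iff_eq] at h
  obtain ⟨⟨⟨h1, h2⟩, h3⟩, ⟨⟨h4, -⟩, -⟩⟩ := h
  rw [h1, h2, h3, h4]

/-- Splitting off the particle `α` of the first group of variables. -/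
def splitEquiv {n : ℕ} (α : Fin (n + 1)) :
    (X d (n + 1) × X d (n + 1)) ≃L[ℝ] E d × (X d n × X d (n + 1)) :=
  ((insertEquiv (d := d) α).symm.prodCongr (ContinuousLinearEquiv.refl ℝ (X d (n + 1)))).trans
    (ContinuousLinearEquiv.prodAssoc ℝ (E d) (X d n) (X d (n + 1)))

theorem measurePreserving_splitEquiv {n : ℕ} (α : Fin (n + 1)) :
    MeasurePreserving (splitEquiv (d := d) α) := by
  have h1 : MeasurePreserving (insertEquiv (d := d) α).symm :=
    volume_preserving_piFinSuccAbove (fun _ => E d) α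
  exact (volume_preserving_prodAssoc (α₁ := E d) (β₁ := X d n) (γ₁ := X d (n + 1))).comp
    (h1.prod (MeasurePreserving.id volume))

theorem integral_eq_integral_integral_insert {n : ℕ} (α : Fin (n + 1)) (F : Density d n) :
    ∫ z, F z = ∫ u : E d, ∫ z : X d n × X d (n + 1), F (insertEquiv α (u, z.1), z.2) := by
  have h1 : ∫ z, F z = ∫ z, pull (splitEquiv α).symm F z := by
    rw [← (measurePreserving_splitEquiv (d := d) α).integral_comp
      (splitEquiv (d := d) α).toHomeomorph.toMeasurableEquiv.measurableEmbedding]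
    refine integral_congr_ae (Eventually.of_forall fun z => ?_)
    simp only [compCLMOfContinuousLinearEquiv_apply, Function.comp_apply,
      ContinuousLinearEquiv.symm_apply_apply]
  rw [h1, Measure.volume_eq_prod, integral_prod]
  · rfl
  · have := Measure.prod.instIsAddHaarMeasure (volume : Measure (E d))
      (volume : Measure (X d n × X d (n + 1)))
    exact SchwartzMap.integrable _

/-- The function of (u, y) is i times the integral of η(…u…; w) g(…y…) f(w) over w and the untouched
particles: a partial integral of η ⊗ (g ⊗ f) restricted along an injective linear map. -/
theorem goodMapping_schwartzKer {n : ℕ} (η : Density d n) : GoodMapping (schwartzKer η) := by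
  intro α
  let S : 𝓢((X d (n + 1) × X d (n + 1)) × (X d (n + 1) × X d (n + 1)), ℂ) →L[ℂ] 𝓢(E d × E d, ℂ) :=
    Complex.I • (partialIntegral (volume : Measure (X d n × X d (n + 1)))).comp (restrict _ (insertPairMap_injective α))
  let T : Density d n →L[ℂ] 𝓢(E d × E d, ℂ) := S.comp (tensorLeft η)
  refine ⟨(LinearMap.flip tensor).compr₂ T.toLinearMap, ?_, fun f g φ y Θ hΘ => ?_⟩
  · exact T.continuous.comp (continuous_tensor.comp (continuous_snd.prodMk continuous_fst))
  · rw [schwartzKer_apply]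
    change Complex.I * ∫ z, pairing (ContinuousLinearMap.mul ℂ ℂ) η Θ z = _
    rw [integral_eq_integral_integral_insert α, ← integral_const_mul]
    refine integral_congr_ae (Eventually.of_forall fun u => ?_)
    change Complex.I * ∫ z : X d n × X d (n + 1), η (insertEquiv α (u, z.1), z.2) *
        Θ (insertEquiv α (u, z.1), z.2) =
      (Complex.I * ∫ z : X d n × X d (n + 1), η (insertEquiv α (u, z.1), z.2) *
        (g (insertEquiv α (y, z.1)) * f z.2)) * φ u
    rw [mul_assoc, ← integral_mul_const]
    congr 1
    refine integral_congr_ae (Eventually.of_forall fun z => ?_)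
    dsimp only
    rw [hΘ, insertEquiv_apply, insertEquiv_apply, Fin.insertNth_apply_same, Fin.update_insertNth]
    ring

/-- By self-adjointness, the trace is i times the squared L² norm of η. -/
theorem eq_zero_of_trace_schwartzKer {n : ℕ} {η : Density d n}
    (hη : ∀ x x', η (x, x') = starRingEnd ℂ (η (x', x))) (h : trace (schwartzKer η) η = 0) :
    η = 0 := by
  have h1 : ∫ z, ‖η z‖ ^ 2 = 0 := by
    rw [trace, schwartzKer_apply, mul_eq_zero] at h
    have h2 := h.resolve_left Complex.I_ne_zero
    have h3 : ∀ z, η z * transpose η z = ((‖η z‖ ^ 2 : ℝ) : ℂ) := by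
      rintro ⟨x, x'⟩
      change η (x, x') * η (x', x) = _
      rw [hη x' x, Complex.mul_conj, Complex.normSq_eq_norm_sq]
    simp only [h3] at h2
    rw [integral_complex_ofReal] at h2
    exact_mod_cast h2
  have hint : Integrable fun z => ‖η z‖ ^ 2 := by
    have := (pairing (ContinuousLinearMap.mul ℂ ℂ) η η).integrable (μ := volume).norm
    refine this.congr (Eventually.of_forall fun z => ?_)
    change ‖η z * η z‖ = ‖η z‖ ^ 2
    rw [norm_mul, sq]
  rw [integral_eq_zero_iff_of_nonneg (fun z => by positivity) hint] at h1
  have hc : Continuous fun z => ‖η z‖ ^ 2 := by fun_prop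
  have h2 := (Continuous.ae_eq_iff_eq volume hc continuous_const).1 h1
  ext z
  exact norm_eq_zero.1 ((pow_eq_zero_iff two_ne_zero).1 (congrFun h2 z))

/-- The observables separate the points of the space of density matrix hierarchies. -/
theorem DensityHierarchy.eq_of_hierTrace_eq {Γ Γ' : DensityHierarchy d}
    (h : ∀ A : ∀ n, Ker d n, IsObservable A → hierTrace A Γ.1 = hierTrace A Γ'.1) : Γ = Γ' := by
  rw [← sub_eq_zero]
  refine Subtype.ext (funext fun n => ?_)
  have hη := (Γ - Γ').2 n
  refine eq_zero_of_trace_schwartzKer hη.2 ?_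
  -- The test observable is i times the n-th component of the difference Γ − Γ' itself.
  have hA := isObservable_single (isBosonicKer_schwartzKer hη.1) (isSkewAdjoint_schwartzKer hη.2)
    (goodMapping_schwartzKer ((Γ - Γ').1 n))
  have key := h _ hA
  rw [hierTrace_single_left, hierTrace_single_left] at key
  change trace _ (Γ.1 n - Γ'.1 n) = 0
  rw [trace, map_sub, map_sub]
  exact sub_eq_zero.2 key

end

section

variable {d : ℕ}

/-! ### The Gross–Pitaevskii vector field -/

open Laplacian in
theorem laplacian_update {n : ℕ} (G : 𝓢(X d (n + 1), ℂ)) (α : Fin (n + 1)) (x : X d (n + 1)) :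
    (Δ fun y : E d => G (Function.update x α y)) (x α) =
      lapAlong (ContinuousLinearMap.single ℝ (fun _ => E d) α) G x := by
  let s : 𝓢(E d, ℂ) := slice (α.removeNth x)
    (pull ((ContinuousLinearEquiv.prodComm ℝ (X d n) (E d)).trans (insertEquiv α)) G)
  have hs : ∀ y, s y = G (Function.update x α y) := by
    intro y
    rw [← Fin.insertNth_removeNth]
    rfl
  have h1 : (fun y : E d => G (Function.update x α y)) = s := funext fun y => (hs y).symm
  rw [h1, ← laplacian_apply, laplacian_eq_sum (EuclideanSpace.basisFun (Fin d) ℝ)]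
  have h2 : lapAlong (ContinuousLinearMap.id ℝ (E d)) s (x α) =
      1 * lapAlong (ContinuousLinearMap.single ℝ (fun _ => E d) α) G x := by
    refine lapAlong_apply_congr 1 fun y => ?_
    rw [one_mul, hs, ← add_single_eq_update]
    congr 1
  rw [one_mul] at h2
  rw [← h2, lapAlong]
  simp only [sum_apply, EuclideanSpace.basisFun_apply]
  rfl

theorem lapComm_apply {n : ℕ} (γ : Density d n) (x x' : X d (n + 1)) :
    lapComm d n γ (x, x') = laplaceCommutator γ x x' := by
  simp only [lapComm, laplaceCommutator, sum_apply, sub_apply]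
  refine Finset.sum_congr rfl fun α _ => ?_
  have h1 := laplacian_update (slice x' (transpose γ)) α x
  have h2 := laplacian_update (slice x γ) α x'
  have e1 : lapAlong (leftDir α) γ (x, x') =
      1 * lapAlong (ContinuousLinearMap.single ℝ (fun _ => E d) α) (slice x' (transpose γ)) x := by
    refine lapAlong_apply_congr 1 fun y => ?_
    rw [add_leftDir, one_mul, ← add_single_eq_update]
    rfl
  have e2 : lapAlong (rightDir α) γ (x, x') =
      1 * lapAlong (ContinuousLinearMap.single ℝ (fun _ => E d) α) (slice x γ) x' := by
    refine lapAlong_apply_congr 1 fun y => ?_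
    rw [add_rightDir, one_mul, ← add_single_eq_update]
    rfl
  rw [e1, e2, ← h1, ← h2, one_mul, one_mul]
  rfl

theorem collComm_apply {n : ℕ} (γ : Density d (n + 1)) (x x' : X d (n + 1)) :
    collComm d n γ (x, x') = collision γ x x' := by
  simp only [collComm, collision, sum_apply, sub_apply, coll_apply]
  rfl

theorem gpField_apply (κ : ℝ) (Γ : ∀ n, Density d n) (n : ℕ) (x x' : X d (n + 1)) :
    gpField κ Γ n (x, x') = Complex.I * laplaceCommutator (Γ n) x x' -
      2 * Complex.I * κ * collision (Γ (n + 1)) x x' := by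
  rw [← lapComm_apply, ← collComm_apply]
  rfl

theorem IsSymmetric.lapAlong_leftDir_apply {n : ℕ} {γ : Density d n} (hγ : IsSymmetric γ)
    (π σ : Equiv.Perm (Fin (n + 1))) (α : Fin (n + 1)) (x x' : X d (n + 1)) :
    lapAlong (leftDir α) γ (x ∘ π, x' ∘ σ) = lapAlong (leftDir (π α)) γ (x, x') := by
  rw [← one_mul (lapAlong (leftDir (π α)) γ (x, x'))]
  refine lapAlong_apply_congr 1 fun y => ?_
  have e : Function.update (x ∘ π) α (x (π α) + y) =
      Function.update x (π α) (x (π α) + y) ∘ π := by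
    rw [Function.update_comp_equiv, Equiv.symm_apply_apply]
  rw [add_leftDir, add_leftDir, one_mul, Function.comp_apply, e,
    hγ.apply_comp π.injective σ.injective]

theorem IsSymmetric.lapAlong_rightDir_apply {n : ℕ} {γ : Density d n} (hγ : IsSymmetric γ)
    (π σ : Equiv.Perm (Fin (n + 1))) (α : Fin (n + 1)) (x x' : X d (n + 1)) :
    lapAlong (rightDir α) γ (x ∘ π, x' ∘ σ) = lapAlong (rightDir (σ α)) γ (x, x') := by
  rw [← one_mul (lapAlong (rightDir (σ α)) γ (x, x'))]
  refine lapAlong_apply_congr 1 fun y => ?_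
  have e : Function.update (x' ∘ σ) α (x' (σ α) + y) =
      Function.update x' (σ α) (x' (σ α) + y) ∘ σ := by
    rw [Function.update_comp_equiv, Equiv.symm_apply_apply]
  rw [add_rightDir, add_rightDir, one_mul, Function.comp_apply, e,
    hγ.apply_comp π.injective σ.injective]

/-- Relabelling carries the Laplacian in x_α to that in x_{π α}, so only the sum over all particles
is invariant. The sums over the two groups are reindexed by π and σ independently. -/
theorem IsSymmetric.lapComm {n : ℕ} {γ : Density d n} (hγ : IsSymmetric γ) :
    IsSymmetric (lapComm d n γ) := by
  intro π σ
  ext ⟨x, x'⟩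
  rw [permAct_apply]
  simp only [GPHierarchy.lapComm, sum_apply, sub_apply, Finset.sum_sub_distrib]
  congr 1
  · exact Fintype.sum_equiv π _ _ fun α => hγ.lapAlong_leftDir_apply π σ α x x'
  · exact Fintype.sum_equiv σ _ _ fun α => hγ.lapAlong_rightDir_apply π σ α x x'

theorem exists_snoc_comp {n : ℕ} (π : Equiv.Perm (Fin (n + 1))) :
    ∃ s : Fin (n + 2) → Fin (n + 2), Function.Injective s ∧ ∀ (x : X d (n + 1)) (e : E d),
      (Fin.snoc (x ∘ π) e : X d (n + 2)) = (Fin.snoc x e : X d (n + 2)) ∘ s := by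
  refine ⟨Fin.snoc (Fin.castSucc ∘ π) (Fin.last _), Fin.snoc_injective_iff.2
    ⟨(Fin.castSucc_injective _).comp π.injective, ?_⟩, fun x e => ?_⟩
  · rintro ⟨i, hi⟩
    exact (Fin.castSucc_lt_last _).ne hi
  · funext i
    refine Fin.lastCases ?_ (fun j => ?_) i
    · simp
    · simp

theorem IsSymmetric.collComm {n : ℕ} {γ : Density d (n + 1)} (hγ : IsSymmetric γ) :
    IsSymmetric (collComm d n γ) := by
  intro π σ
  ext ⟨x, x'⟩
  obtain ⟨s, hs, hs'⟩ := exists_snoc_comp (d := d) π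
  obtain ⟨t, ht, ht'⟩ := exists_snoc_comp (d := d) σ
  rw [permAct_apply]
  simp only [GPHierarchy.collComm, sum_apply, sub_apply, Finset.sum_sub_distrib, coll_apply, hs',
    ht', hγ.apply_comp hs ht]
  congr 1
  · exact Fintype.sum_equiv π _ _ fun α => rfl
  · exact Fintype.sum_equiv σ _ _ fun α => rfl

/-- Taking adjoints exchanges the two groups of variables, hence the sign. The factor i in `gpField`
compensates for it, here and for the collision term. -/
theorem lapComm_conj {n : ℕ} {γ : Density d n}
    (hγ : ∀ x x', γ (x, x') = starRingEnd ℂ (γ (x', x))) (x x' : X d (n + 1)) :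
    starRingEnd ℂ (lapComm d n γ (x', x)) = -lapComm d n γ (x, x') := by
  have h : ∀ z, transpose γ z = starRingEnd ℂ (γ z) := fun z => hγ z.2 z.1
  simp only [lapComm, sum_apply, sub_apply, map_sum, map_sub, ← Finset.sum_neg_distrib, neg_sub,
    ← lapAlong_conj_apply h, lapAlong_transpose, lapAlong_transpose']
  rfl

theorem collComm_conj {n : ℕ} {γ : Density d (n + 1)}
    (hγ : ∀ x x', γ (x, x') = starRingEnd ℂ (γ (x', x))) (x x' : X d (n + 1)) :
    starRingEnd ℂ (collComm d n γ (x', x)) = -collComm d n γ (x, x') := by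
  simp only [collComm, sum_apply, sub_apply, map_sum, map_sub, ← Finset.sum_neg_distrib, neg_sub,
    coll_apply, ← hγ]
  rfl

theorem gpField_mem (κ : ℝ) (Γ : DensityHierarchy d) : gpField κ Γ.1 ∈ DensityHierarchy d := by
  intro n
  refine ⟨fun π σ => ?_, fun x x' => ?_⟩
  · rw [gpField, map_sub, map_smul, map_smul, IsSymmetric.lapComm (Γ.2 n).1,
      IsSymmetric.collComm (Γ.2 (n + 1)).1]
  · have h1 := lapComm_conj (Γ.2 n).2 x x'
    have h2 := collComm_conj (Γ.2 (n + 1)).2 x x'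
    simp only [gpField, sub_apply, smul_apply, smul_eq_mul, map_sub, map_mul, h1, h2,
      Complex.conj_I, Complex.conj_ofReal, map_ofNat]
    ring

/-- The Gross–Pitaevskii vector field on the space of density matrix hierarchies. -/
def gpVectorField (d : ℕ) (κ : ℝ) : DensityHierarchy d →L[ℝ] DensityHierarchy d where
  toFun Γ := ⟨gpField κ Γ.1, gpField_mem κ Γ⟩
  map_add' Γ Γ' := by
    refine Subtype.ext (funext fun n => ?_)
    change gpField κ (Γ.1 + Γ'.1) n = gpField κ Γ.1 n + gpField κ Γ'.1 n
    simp only [gpField, Pi.add_apply, map_add, smul_add]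
    abel
  map_smul' r Γ := by
    refine Subtype.ext (funext fun n => ?_)
    change gpField κ (r • Γ.1) n = r • gpField κ Γ.1 n
    simp only [gpField, Pi.smul_apply, ← Complex.coe_smul, map_smul, smul_sub, smul_smul,
      mul_comm]
  cont := by
    refine Continuous.subtype_mk (continuous_pi fun n => ?_) _
    have h : ∀ n, Continuous fun Γ : DensityHierarchy d => Γ.1 n := fun n =>
      (continuous_apply n).comp continuous_subtype_val
    exact (((lapComm d n).continuous.comp (h n)).const_smul Complex.I).sub
      (((collComm d n).continuous.comp (h (n + 1))).const_smul (2 * Complex.I * κ))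

theorem gpVectorField_val (κ : ℝ) (Γ : DensityHierarchy d) :
    (gpVectorField d κ Γ).1 = gpField κ Γ.1 := rfl

theorem gateauxSmooth_of_clm {V W : Type*} [AddCommGroup V] [Module ℝ V] [TopologicalSpace V]
    [AddCommGroup W] [Module ℝ W] [TopologicalSpace W] (T : V →L[ℝ] W) : GateauxSmooth T := by
  refine ⟨fun r x v => match r, v with
    | 0, _ => T x
    | 1, v => T (v 0)
    | _ + 2, _ => 0, fun x v => rfl, fun r => ?_, fun r x v w => ?_⟩
  · match r with
    | 0 => exact T.continuous.comp continuous_fst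
    | 1 => exact T.continuous.comp ((continuous_apply 0).comp continuous_snd)
    | _ + 2 => exact continuous_const
  · match r, v with
    | 0, v =>
      refine tendsto_const_nhds.congr' ?_
      filter_upwards [self_mem_nhdsWithin] with t ht
      change T w = t⁻¹ • (T (x + t • w) - T x)
      rw [map_add, map_smul, add_sub_cancel_left, inv_smul_smul₀ ht]
    | 1, v =>
      refine tendsto_const_nhds.congr fun t => ?_
      change 0 = t⁻¹ • (T (v 0) - T (v 0))
      rw [sub_self, smul_zero]
    | r + 2, v =>
      refine tendsto_const_nhds.congr fun t => ?_
      change (0 : W) = t⁻¹ • (0 - 0)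
      rw [sub_self, smul_zero]

end

section

variable {d : ℕ}

/-! ### The Hamiltonian vector field and the Gross–Pitaevskii hierarchy -/

theorem gpHamiltonian_mem_admissible (κ : ℝ) : gpHamiltonian d κ ∈ admissible d :=
  Algebra.subset_adjoin ⟨gpObservable d κ, isObservable_gpObservable κ, ofReal_gpHamiltonian κ⟩

/-- The bracket identity applied to the observable dF[Γ]: both sides are i times its trace against
the Gross–Pitaevskii field. -/
theorem poissonBracket_gpHamiltonian {κ : ℝ} {F : DensityHierarchy d → ℝ} (hF : F ∈ admissible d)
    (Γ : DensityHierarchy d) : poissonBracket F (gpHamiltonian d κ) Γ =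
      ((lineDeriv ℝ F Γ (gpVectorField d κ Γ) : ℝ) : ℂ) := by
  obtain ⟨h1, h2⟩ := isObservable_gradient hF Γ
  rw [h2, poissonBracket, gradient_eq (isObservable_gpObservable κ) (ofReal_gpHamiltonian κ),
    hierTrace_lieBracket_gpObservable h1 fun n => (Γ.2 n).1]
  rfl

theorem isHamiltonianVectorField_gpVectorField (κ : ℝ) :
    IsHamiltonianVectorField (gpHamiltonian d κ) (gpVectorField d κ) :=
  ⟨gateauxSmooth_of_clm _, fun _ hF Γ => (poissonBracket_gpHamiltonian hF Γ).symm⟩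

/-- A Hamiltonian vector field is determined by its Hamiltonian. -/
theorem IsHamiltonianVectorField.unique {H : DensityHierarchy d → ℝ}
    {Y Z : DensityHierarchy d → DensityHierarchy d} (hY : IsHamiltonianVectorField H Y)
    (hZ : IsHamiltonianVectorField H Z) : Z = Y := by
  funext Γ
  refine DensityHierarchy.eq_of_hierTrace_eq fun A hA => ?_
  let F : DensityHierarchy d → ℝ := fun Γ => (Complex.I * hierTrace A Γ.1).re
  have hF : ∀ Γ, (F Γ : ℂ) = Complex.I * hierTrace A Γ.1 := hA.ofReal_re
  have hmem : F ∈ admissible d := Algebra.subset_adjoin ⟨A, hA, hF⟩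
  -- F is linear, hence its own derivative at every point: equality of the two Poisson brackets says
  -- that Y(Γ) and Z(Γ) have the same trace against A.
  have h := (hZ.2 F hmem Γ).trans (hY.2 F hmem Γ).symm
  rw [(hA.hasLineDerivAt hF Γ _).lineDeriv, (hA.hasLineDerivAt hF Γ _).lineDeriv, hF, hF] at h
  exact mul_left_cancel₀ Complex.I_ne_zero h

/-- Evaluation of a component of a hierarchy at a point. -/
def evalComponent (n : ℕ) (x x' : X d (n + 1)) : DensityHierarchy d →ₗ[ℝ] ℂ where
  toFun Γ := Γ.1 n (x, x')
  map_add' _ _ := rfl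
  map_smul' _ _ := rfl

theorem continuous_evalComponent (n : ℕ) (x x' : X d (n + 1)) :
    Continuous (evalComponent (d := d) n x x') :=
  ((continuous_eval_const (x, x')).comp
    (toBoundedContinuousFunctionCLM ℂ (X d (n + 1) × X d (n + 1)) ℂ).continuous).comp
    ((continuous_apply n).comp continuous_subtype_val)

theorem HasCurveDeriv.hasDerivWithinAt {Γ : ℝ → DensityHierarchy d} {Γ' : DensityHierarchy d}
    {I : Set ℝ} {t : ℝ} (h : HasCurveDeriv Γ Γ' I t) (n : ℕ) (x x' : X d (n + 1)) :
    HasDerivWithinAt (fun s => (Γ s).1 n (x, x')) (Γ'.1 n (x, x')) I t := by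
  rw [hasDerivWithinAt_iff_tendsto_slope]
  refine (((continuous_evalComponent n x x').tendsto Γ').comp h).congr fun s => ?_
  change evalComponent n x x' ((s - t)⁻¹ • (Γ s - Γ t)) = _
  rw [map_smul, map_sub]
  rfl

theorem SmoothCurveOn.exists_hasCurveDeriv {V : Type*} [AddCommGroup V] [Module ℝ V]
    [TopologicalSpace V] {Γ : ℝ → V} {I : Set ℝ} (h : SmoothCurveOn Γ I) {t : ℝ} (ht : t ∈ I) :
    ∃ Γ', HasCurveDeriv Γ Γ' I t := by
  obtain ⟨D, hD, h⟩ := h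
  refine ⟨D 1 t, (h 0 t ht).congr' ?_⟩
  filter_upwards [self_mem_nhdsWithin] with s hs
  rw [slope, slope, hD s hs.1, hD t ht]

/-- The hierarchy is an equation at each point (x; x'), the Hamiltonian equation one in the topology
of hierarchies. Smoothness supplies a derivative in that topology, and evaluating it at points
identifies it with the field. Uniqueness of derivatives within I is what requires a nondegenerate
interval. -/
theorem solvesGP_iff {κ : ℝ} {I : Set ℝ} (hI : UniqueDiffOn ℝ I) {Γ : ℝ → DensityHierarchy d}
    (hΓ : SmoothCurveOn Γ I) :
    SolvesGP κ I Γ ↔ ∀ t ∈ I, HasCurveDeriv Γ (gpVectorField d κ (Γ t)) I t := by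
  have e : ∀ t n (x x' : X d (n + 1)), Complex.I * (gpVectorField d κ (Γ t)).1 n (x, x') =
      -laplaceCommutator ((Γ t).1 n) x x' + 2 * κ * collision ((Γ t).1 (n + 1)) x x' := by
    intro t n x x'
    rw [gpVectorField_val, gpField_apply]
    linear_combination (laplaceCommutator ((Γ t).1 n) x x' -
      2 * κ * collision ((Γ t).1 (n + 1)) x x') * Complex.I_mul_I
  constructor
  · intro h t ht
    obtain ⟨Γ', hΓ'⟩ := hΓ.exists_hasCurveDeriv ht
    have : Γ' = gpVectorField d κ (Γ t) := by
      refine Subtype.ext (funext fun n => ?_)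
      ext ⟨x, x'⟩
      have h1 := (hΓ'.hasDerivWithinAt n x x').const_mul Complex.I
      have h2 := h t ht n x x'
      rw [← e] at h2
      exact mul_left_cancel₀ Complex.I_ne_zero ((hI t ht).eq_deriv _ h1 h2)
    exact this ▸ hΓ'
  · intro h t ht n x x'
    rw [← e]
    exact ((h t ht).hasDerivWithinAt n x x').const_mul Complex.I

end

end GPHierarchy

end

/-! ### The main theorem -/

theorem theorem2p2 (d : ℕ) (hd : 1 ≤ d) (κ : ℝ) (hκ : κ = 1 ∨ κ = -1) :
    (∀ Γ : GPHierarchy.DensityHierarchy d,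
      (GPHierarchy.gpHamiltonian d κ Γ : ℂ) =
        GPHierarchy.hierTrace (GPHierarchy.gpGenerator d κ) Γ.1) ∧
    GPHierarchy.gpHamiltonian d κ ∈ GPHierarchy.admissible d ∧
    ∃ Y : GPHierarchy.DensityHierarchy d → GPHierarchy.DensityHierarchy d,
      GPHierarchy.IsHamiltonianVectorField (GPHierarchy.gpHamiltonian d κ) Y ∧
      (∀ Z, GPHierarchy.IsHamiltonianVectorField (GPHierarchy.gpHamiltonian d κ) Z → Z = Y) ∧
      ∀ (a b : ℝ), a < b → ∀ Γ : ℝ → GPHierarchy.DensityHierarchy d,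
        GPHierarchy.SmoothCurveOn Γ (Set.Icc a b) →
        (GPHierarchy.SolvesGP κ (Set.Icc a b) Γ ↔
          ∀ t ∈ Set.Icc a b, GPHierarchy.HasCurveDeriv Γ (Y (Γ t)) (Set.Icc a b) t) := by
  refine ⟨fun Γ => ?_, GPHierarchy.gpHamiltonian_mem_admissible κ,
    GPHierarchy.gpVectorField d κ, GPHierarchy.isHamiltonianVectorField_gpVectorField κ,
    fun Z hZ => (GPHierarchy.isHamiltonianVectorField_gpVectorField κ).unique hZ,
    fun a b hab Γ hΓ => GPHierarchy.solvesGP_iff (uniqueDiffOn_Icc hab) hΓ⟩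
  rw [GPHierarchy.ofReal_gpHamiltonian, GPHierarchy.hierTrace_gpObservable]
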